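/- **Setting.** Let $\mathbb T$ be the $2\pi$-periodic torus, and let $\Gamma\in L^\infty(\mathbb R)$, $k_*\in\mathbb N=\{1,2,\dots\}$, $b>0$ and $\beta,\lambda_*<1$ be given. Put $$\alpha=\frac{2\sqrt{1-\beta}}{k_*}\cdot\frac{\sqrt{1-\beta}\,\sinh(k_*\sqrt{1-\beta}\,b)+\sqrt{1-\lambda_*}\,\cosh(k_*\sqrt{1-\beta}\,b)}{\sqrt{1-\beta}\,\cosh(k_*\sqrt{1-\beta}\,b)+\sqrt{1-\lambda_*}\,\sinh(k_*\sqrt{1-\beta}\,b)}>0 ,$$ $V_0=\mathbf 1_{|y|\ge b}$ and $V_1=\beta\mathbf 1_{|y|<b}+\alpha\delta_0$, so that $V(\lambda,y)=\lambda V_0(y)+V_1(y)=\lambda\mathbf 1_{|y|\ge b}+\beta\mathbf 1_{|y|<b}+\alpha\delta_0(y)$. Here $V_1$ acts from $H^1(\mathbb R)$ to $H^{-1}(\mathbb R)$ by $\langle V_1f,g\rangle=\beta\int_{|y|<b}fg\,dy+\alpha f(0)g(0)$. For $k\in\mathbb N$ and $\lambda\in\mathbb R$ let $$L_\lambda^k=-\frac{d^2}{dy^2}+k^2\bigl(1-\lambda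 V_0(y)-V_1(y)\bigr)$$ be the operator in $L^2(\mathbb R)$ with domain $D(L_\lambda^k)=\{\phi\in H^1(\mathbb R): -\phi''+k^2(1-\lambda V_0-V_1)\phi\in L^2(\mathbb R)\}$. **Statement.** There is an open interval $I\ni\lambda_*$ with the following properties. * (L0) $V_0\in L^\infty(\mathbb R)$, and $V_1:H^1(\mathbb R)\to H^{-1}(\mathbb R)$ is bounded. * (L1) $L_\lambda^k$ is self-adjoint for all $k\in\mathbb N$ and $\lambda\in\mathbb R$. * (L2) Zero is an isolated simple eigenvalue of $L_{\lambda_*}^{k_*}$, and $0\in\rho(L_\lambda^k)$ for all $(k,\lambda)\in\mathbb N\times I$ with $(k,\lambda)\neq(k_*,\lambda_*)$. * (L3) There are $C>0$ and $K\in\mathbb N$ such that for all $k\ge K$, all $\lambda\in I$ and all $\phi\in D(L_\lambda^k)$, with $f=L_\lambda^k\phi$, $$\|\phi\|_{L^2(\mathbb R)}\le\frac{C}{k^2}\|f\|_{L^2(\mathbb R)},\qquad \|\phi'\|_{L^2(\mathbb R)}\le\frac{C}{k}\|f\|_{L^2(\mathbb R)} .$$ * (Transversality) $\int_{\mathbb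 R}V_0(\phi^*)^2\,dy\neq0$ for every $\phi^*$ that spans the one-dimensional kernel of $L_{\lambda_*}^{k_*}$. Moreover, for every $\phi^*$ that spans $\ker L_{\lambda_*}^{k_*}$ there are $\varepsilon_0>0$ and a smooth curve $$\{(\Phi(\varepsilon),\lambda(\varepsilon)) : |\varepsilon|<\varepsilon_0\}\subset\bigl(H^2(\mathbb T;L^2(\mathbb R))\cap H^1(\mathbb T;H^1(\mathbb R))\bigr)\times I$$ through $(0,\lambda_*)$, such that $\Phi(\varepsilon)\neq0$ for $\varepsilon\neq0$, each $\Phi(\varepsilon)$ has the form $\Phi(x,y)=\sum_{k\in\mathbb N}\phi_k(y)\sin(kx)$, and each $\Phi=\Phi(\varepsilon)$ is, with $\lambda=\lambda(\varepsilon)$, a weak solution of the traveling wave equation $$-\Phi_{yy}-(1-\lambda V_0(y)-V_1(y))\Phi_{xx}+\Gamma(y)(\Phi^3)_{xx}=0 ,$$ that is, $$\int_{\mathbb T}\int_{\mathbb R}\Phi_y\Psi_y-(1-\lambda V_0)\Phi_{xx}\Psi\,dy\,dx-\int_{\mathbb T}\langle V_1\Phi_x(x,\cdot),\Psi_x(x,\cdot)\rangle\,dx+\int_{\mathbb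 T}\int_{\mathbb R}\Gamma\,(\Phi^3)_{xx}\Psi\,dy\,dx=0$$ for all $\Psi\in H^1(\mathbb T;H^1(\mathbb R))$, where $(\Phi^3)_{xx}=3\Phi^2\Phi_{xx}+6\Phi\Phi_x^2$. Furthermore $$\Phi(0)=0,\quad D_\varepsilon\Phi(0)(x,y)=\phi^*(y)\sin(k_*x),\quad \lambda(0)=\lambda_*,\quad \dot\lambda(0)=0,\quad \ddot\lambda(0)=-\frac32\,\frac{\int_{\mathbb R}\Gamma(y)\phi^*(y)^4\,dy}{\int_{\mathbb R}V_0(y)\phi^*(y)^2\,dy} .$$ -/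

import Mathlib

open MeasureTheory Set
open scoped ContDiff ENNReal Topology

noncomputable section

namespace TravelingWave

/-! ### The spaces `L²(ℝ)`, `H¹(ℝ)` and the evaluation at `0` -/

/-- The real Hilbert space `L²(ℝ)`. -/
abbrev L2 : Type := Lp ℝ 2 (volume : Measure ℝ)

/-- `L^∞(ℝ)`. -/
abbrev LInf : Type := Lp ℝ ∞ (volume : Measure ℝ)

/-- `v` is the weak (distributional) derivative of `u` on `ℝ`. -/
def IsWeakDeriv (u v : L2) : Prop :=
  ∀ ψ : ℝ → ℝ, ContDiff ℝ ∞ ψ → HasCompactSupport ψ →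
    ∫ y, u y * deriv ψ y = -∫ y, v y * ψ y

theorem integrable_L2_mul (u : L2) {f : ℝ → ℝ} (hf : MemLp f 2 volume) :
    Integrable (fun y => u y * f y) :=
  (Lp.memLp u).integrable_mul hf

theorem memLp_test {ψ : ℝ → ℝ} (h1 : ContDiff ℝ ∞ ψ) (h2 : HasCompactSupport ψ) :
    MemLp ψ 2 volume :=
  h1.continuous.memLp_of_hasCompactSupport h2

theorem memLp_deriv_test {ψ : ℝ → ℝ} (h1 : ContDiff ℝ ∞ ψ) (h2 : HasCompactSupport ψ) :
    MemLp (deriv ψ) 2 volume :=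
  (h1.continuous_deriv (by simp)).memLp_of_hasCompactSupport h2.deriv

theorem integral_mul_eq_inner (u : L2) {f : ℝ → ℝ} (hf : MemLp f 2 volume) :
    ∫ y, u y * f y = inner ℝ (hf.toLp f) u := by
  rw [L2.inner_def]
  apply integral_congr_ae
  filter_upwards [hf.coeFn_toLp] with y hy
  simp [hy]

theorem isWeakDeriv_iff (u v : L2) : IsWeakDeriv u v ↔
    ∀ (ψ : ℝ → ℝ) (h1 : ContDiff ℝ ∞ ψ) (h2 : HasCompactSupport ψ),
      inner ℝ ((memLp_deriv_test h1 h2).toLp _) u = -inner ℝ ((memLp_test h1 h2).toLp ψ) v := by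
  refine forall_congr' fun ψ => forall_congr' fun h1 => forall_congr' fun h2 => ?_
  rw [integral_mul_eq_inner u (memLp_deriv_test h1 h2), integral_mul_eq_inner v (memLp_test h1 h2)]

/-- The pairs `(φ, φ')` in `L²(ℝ) × L²(ℝ)` where `φ'` is the weak derivative of `φ`. -/
def h1Submodule : Submodule ℝ (WithLp 2 (L2 × L2)) where
  carrier := {p | IsWeakDeriv p.fst p.snd}
  zero_mem' := by
    simp only [mem_ofPred_eq, isWeakDeriv_iff]
    intro ψ h1 h2
    simp
  add_mem' := by
    intro p q hp hq
    simp only [mem_ofPred_eq, isWeakDeriv_iff] at hp hq ⊢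
    intro ψ h1 h2
    simp only [WithLp.add_fst, WithLp.add_snd, inner_add_right, hp ψ h1 h2, hq ψ h1 h2]
    ring
  smul_mem' := by
    intro c p hp
    simp only [mem_ofPred_eq, isWeakDeriv_iff] at hp ⊢
    intro ψ h1 h2
    simp only [WithLp.smul_fst, WithLp.smul_snd, inner_smul_right, hp ψ h1 h2]
    ring

/-- The Sobolev space `H¹(ℝ)`, as the space of the pairs `(φ, φ')` in `L²(ℝ) × L²(ℝ)` where `φ'` is
the weak derivative of `φ`. The `L²` norm on the product gives the usual norm
`(‖φ‖² + ‖φ'‖²)^(1/2)` of `H¹(ℝ)`. -/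
def H1 : Type := h1Submodule

instance : NormedAddCommGroup H1 := inferInstanceAs (NormedAddCommGroup h1Submodule)

instance : InnerProductSpace ℝ H1 := inferInstanceAs (InnerProductSpace ℝ h1Submodule)

/-- The inclusion of `H¹(ℝ)` in `L²(ℝ) × L²(ℝ)`, `φ ↦ (φ, φ')`. -/
def H1.incl : H1 →L[ℝ] WithLp 2 (L2 × L2) := h1Submodule.subtypeL

/-- The function `φ ∈ L²(ℝ)` underlying an element of `H¹(ℝ)` (the embedding `H¹(ℝ) ⊂ L²(ℝ)`). -/
def H1.fn : H1 →L[ℝ] L2 := (WithLp.fstL 2 ℝ L2 L2).comp H1.incl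

/-- The weak derivative `φ' ∈ L²(ℝ)` of an element `φ` of `H¹(ℝ)`. -/
def H1.der : H1 →L[ℝ] L2 := (WithLp.sndL 2 ℝ L2 L2).comp H1.incl

theorem H1.isWeakDeriv (φ : H1) : IsWeakDeriv (H1.fn φ) (H1.der φ) := φ.2

instance : CompleteSpace H1 := by
  have hc : IsClosed (h1Submodule : Set (WithLp 2 (L2 × L2))) := by
    have : (h1Submodule : Set (WithLp 2 (L2 × L2))) =
        ⋂ (ψ : ℝ → ℝ) (h1 : ContDiff ℝ ∞ ψ) (h2 : HasCompactSupport ψ),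
          {p | inner ℝ ((memLp_deriv_test h1 h2).toLp _) p.fst
            = -inner ℝ ((memLp_test h1 h2).toLp ψ) p.snd} := by
      ext p
      simp only [mem_iInter, mem_ofPred_eq]
      exact isWeakDeriv_iff p.fst p.snd
    rw [this]
    refine isClosed_iInter fun ψ => isClosed_iInter fun h1 => isClosed_iInter fun h2 => ?_
    refine isClosed_eq ?_ ?_
    · exact continuous_const.inner (WithLp.fstL 2 ℝ L2 L2).continuous
    · exact (continuous_const.inner (WithLp.sndL 2 ℝ L2 L2).continuous).neg
  exact hc.completeSpace_coe

theorem locallyIntegrable_L2 (v : L2) : LocallyIntegrable v volume :=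
  (Lp.memLp v).locallyIntegrable (by norm_num)

theorem intervalIntegrable_L2 (v : L2) (a b : ℝ) : IntervalIntegrable v volume a b :=
  intervalIntegrable_iff.2 (((locallyIntegrable_L2 v).integrableOn_isCompact isCompact_uIcc).mono_set
    uIoc_subset_uIcc)

theorem exists_subset_Ioo {ψ : ℝ → ℝ} (h : HasCompactSupport ψ) :
    ∃ R : ℝ, 0 < R ∧ ∀ y, y ∉ Ioo (-R) R → ψ y = 0 := by
  obtain ⟨R, hR, h'⟩ := h.isCompact.isBounded.subset_ball_lt 0 0
  refine ⟨R, hR, fun y hy => ?_⟩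
  by_contra hne
  apply hy
  have := h' (subset_tsupport ψ hne)
  simpa [Real.ball_eq_Ioo] using this

/-- The primitive of an `L²` function is weakly differentiable with the expected derivative. -/
theorem integral_primitive_mul_deriv (v : L2) {ψ : ℝ → ℝ} (h1 : ContDiff ℝ ∞ ψ)
    (h2 : HasCompactSupport ψ) :
    ∫ y, (∫ t in (0 : ℝ)..y, v t) * deriv ψ y = -∫ y, v y * ψ y := by
  obtain ⟨R, hR, hz⟩ := exists_subset_Ioo h2
  obtain ⟨R', hR', hz'⟩ := exists_subset_Ioo h2.deriv
  set S := max R R' with hS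
  have hSR : R ≤ S := le_max_left _ _
  have hSR' : R' ≤ S := le_max_right _ _
  have hz0 : ∀ y, y ∉ Ioo (-S) S → ψ y = 0 := fun y hy => hz y fun hy' =>
    hy ⟨by linarith [hy'.1], by linarith [hy'.2]⟩
  have hz1 : ∀ y, y ∉ Ioo (-S) S → deriv ψ y = 0 := fun y hy => hz' y fun hy' =>
    hy ⟨by linarith [hy'.1], by linarith [hy'.2]⟩
  have key : ∀ g : ℝ → ℝ, (∀ y, y ∉ Ioo (-S) S → g y = 0) → ∫ y, g y = ∫ y in (-S)..S, g y := by
    intro g hg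
    rw [intervalIntegral.integral_eq_integral_of_support_subset]
    intro y hy
    by_contra hne
    exact hy (hg y fun h => hne ⟨h.1, h.2.le⟩)
  rw [key _ fun y hy => by simp [hz1 y hy], key _ fun y hy => by simp [hz0 y hy]]
  have hF := (intervalIntegrable_L2 v (-S) S).absolutelyContinuousOnInterval_intervalIntegral
    (c := 0) (by rw [uIcc_of_le (by linarith)]; constructor <;> linarith)
  have hψ : AbsolutelyContinuousOnInterval ψ (-S) S :=
    (h1.of_le (by simp)).contDiffOn.absolutelyContinuousOnInterval
  rw [hF.integral_mul_deriv_eq_deriv_mul hψ, hz0 S (by simp), hz0 (-S) (by simp)]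
  simp only [mul_zero, sub_zero, zero_sub, neg_inj]
  apply intervalIntegral.integral_congr_ae
  filter_upwards [LocallyIntegrable.ae_hasDerivAt_integral (locallyIntegrable_L2 v)] with y hy _
  rw [(hy 0).deriv]

theorem continuous_primitive_L2 (v : L2) : Continuous fun y => ∫ t in (0 : ℝ)..y, v t :=
  intervalIntegral.continuous_primitive (fun a b => intervalIntegrable_L2 v a b) 0

/-- A function in `H¹(ℝ)` has a continuous representative, the primitive of its derivative. -/
theorem H1.exists_rep (φ : H1) : ∃ f : ℝ → ℝ, Continuous f ∧ H1.fn φ =ᵐ[volume] f ∧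
    ∀ a b, f b - f a = ∫ y in a..b, H1.der φ y := by
  set u := H1.fn φ with hu
  set v := H1.der φ with hv
  set F : ℝ → ℝ := fun y => ∫ t in (0 : ℝ)..y, v t with hF
  have hFc : Continuous F := continuous_primitive_L2 v
  set w : ℝ → ℝ := fun y => u y - F y with hw
  have hwl : LocallyIntegrable w volume := (locallyIntegrable_L2 u).sub hFc.locallyIntegrable
  have hint : ∀ g : ℝ → ℝ, Continuous g → HasCompactSupport g →
      Integrable (fun y => w y * g y) := fun g hg hg' => by
    simpa [mul_comm] using hwl.integrable_smul_left_of_hasCompactSupport hg hg'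
  -- `w` has vanishing weak derivative
  have h0 : ∀ ψ : ℝ → ℝ, ContDiff ℝ ∞ ψ → HasCompactSupport ψ →
      ∫ y, w y * deriv ψ y = 0 := by
    intro ψ h1 h2
    have hd : Continuous (deriv ψ) := h1.continuous_deriv (by simp)
    have e1 : Integrable (fun y => u y * deriv ψ y) := integrable_L2_mul u (memLp_deriv_test h1 h2)
    have e2 : Integrable (fun y => F y * deriv ψ y) :=
      (hFc.mul hd).integrable_of_hasCompactSupport h2.deriv.mul_left
    simp only [hw, sub_mul]
    rw [integral_sub e1 e2, integral_primitive_mul_deriv v h1 h2, H1.isWeakDeriv φ ψ h1 h2]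
    simp [hv]
  -- a normalized bump function
  let B : ContDiffBump (0 : ℝ) := ⟨1, 2, by norm_num, by norm_num⟩
  set ρ : ℝ → ℝ := B.normed volume with hρ
  have hρ1 : ContDiff ℝ ∞ ρ := B.contDiff_normed
  have hρ2 : HasCompactSupport ρ := B.hasCompactSupport_normed
  have hρ3 : ∫ y, ρ y = 1 := B.integral_normed
  set c : ℝ := ∫ y, w y * ρ y with hc
  have hwc : ∀ᵐ y, w y = c := by
    refine ae_eq_of_integral_contDiff_smul_eq (f' := fun _ => c) hwl
      (locallyIntegrable_const c) ?_
    intro g g1 g2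
    set m : ℝ := ∫ y, g y with hm
    set θ : ℝ → ℝ := fun y => g y - m * ρ y with hθ
    have θ1 : ContDiff ℝ ∞ θ := g1.sub (contDiff_const.mul hρ1)
    have θ2 : HasCompactSupport θ := g2.sub hρ2.mul_left
    have hgi : Integrable g := g1.continuous.integrable_of_hasCompactSupport g2
    have hρi : Integrable ρ := hρ1.continuous.integrable_of_hasCompactSupport hρ2
    have θ3 : ∫ y, θ y = 0 := by
      simp only [hθ]
      rw [integral_sub hgi (hρi.const_mul m), integral_const_mul, hρ3]
      simp [hm]
    obtain ⟨R, hR, hz⟩ := exists_subset_Ioo θ2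
    set ψ : ℝ → ℝ := fun y => ∫ t in (-R)..y, θ t with hψ
    have hd : ∀ y, HasDerivAt ψ (θ y) y := fun y =>
      intervalIntegral.integral_hasDerivAt_right
        (θ1.continuous.intervalIntegrable _ _) (θ1.continuous.stronglyMeasurableAtFilter _ _)
        θ1.continuous.continuousAt
    have hder : deriv ψ = θ := funext fun y => (hd y).deriv
    have ψ1 : ContDiff ℝ ∞ ψ := by
      rw [contDiff_infty_iff_deriv]
      exact ⟨fun y => (hd y).differentiableAt, hder ▸ θ1⟩
    have ψ2 : HasCompactSupport ψ := by
      refine HasCompactSupport.intro (isCompact_Icc (a := -R) (b := R)) fun y hy => ?_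
      have hcase : y < -R ∨ R < y := by
        by_contra hcon
        push Not at hcon
        exact hy ⟨hcon.1, hcon.2⟩
      rcases hcase with h | h
      · apply intervalIntegral.integral_zero_ae
        refine Filter.Eventually.of_forall fun t ht => hz t fun ht' => ?_
        rw [uIoc_of_ge h.le] at ht
        linarith [ht'.1, ht.2]
      · have : ψ y = ∫ t, θ t := by
          simp only [hψ]
          rw [intervalIntegral.integral_eq_integral_of_support_subset]
          intro t ht
          by_contra hne
          exact ht (hz t fun ht' => hne ⟨ht'.1, by linarith [ht'.2]⟩)
        rw [this, θ3]
    have := h0 ψ ψ1 ψ2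
    rw [hder] at this
    simp only [hθ, mul_sub] at this
    have e1 := hint g g1.continuous g2
    have e2 := hint ρ hρ1.continuous hρ2
    have e3 : (fun y => w y * (m * ρ y)) = fun y => m * (w y * ρ y) := by
      funext y; ring
    have e5 : ∫ y, w y * (m * ρ y) = m * c := by rw [e3, integral_const_mul]
    have e6 : Integrable (fun y => w y * (m * ρ y)) := by rw [e3]; exact e2.const_mul m
    rw [integral_sub e1 e6, e5] at this
    simp only [smul_eq_mul]
    rw [integral_mul_const, ← hm]
    have e4 : (fun y => g y * w y) = fun y => w y * g y := by
      funext y; ring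
    rw [e4]
    linarith
  refine ⟨fun y => c + F y, continuous_const.add hFc, ?_, fun a b => ?_⟩
  · filter_upwards [hwc] with y hy
    simp only [hw] at hy
    linarith
  · simp only [hF, add_sub_add_left_eq_sub]
    rw [intervalIntegral.integral_interval_sub_left (intervalIntegrable_L2 v _ _)
      (intervalIntegrable_L2 v _ _)]

/-- The continuous representative of `φ ∈ H¹(ℝ)`. -/
def H1.rep (φ : H1) : ℝ → ℝ := Classical.choose (H1.exists_rep φ)

theorem H1.continuous_rep (φ : H1) : Continuous (H1.rep φ) :=
  (Classical.choose_spec (H1.exists_rep φ)).1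

theorem H1.fn_ae_eq_rep (φ : H1) : H1.fn φ =ᵐ[volume] H1.rep φ :=
  (Classical.choose_spec (H1.exists_rep φ)).2.1

theorem H1.rep_sub_rep (φ : H1) (a b : ℝ) : H1.rep φ b - H1.rep φ a = ∫ y in a..b, H1.der φ y :=
  (Classical.choose_spec (H1.exists_rep φ)).2.2 a b

theorem H1.rep_eq (φ : H1) {f : ℝ → ℝ} (hf : Continuous f) (h : H1.fn φ =ᵐ[volume] f) :
    H1.rep φ = f :=
  Continuous.ae_eq_iff_eq volume (H1.continuous_rep φ) hf |>.1 ((H1.fn_ae_eq_rep φ).symm.trans h)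

theorem setIntegral_abs_le (u : L2) : ∫ y in Icc (0 : ℝ) 1, |u y| ≤ ‖u‖ := by
  have h := integral_mul_le_Lp_mul_Lq_of_nonneg (μ := volume.restrict (Icc (0 : ℝ) 1))
    (p := 2) (q := 2) Real.HolderConjugate.two_two
    (f := fun y => |u y|) (g := fun _ => (1 : ℝ))
    (Filter.Eventually.of_forall fun _ => abs_nonneg _)
    (Filter.Eventually.of_forall fun _ => zero_le_one)
    (by
      have := ((Lp.memLp u).restrict (Icc (0 : ℝ) 1)).abs
      rw [show ENNReal.ofReal 2 = 2 by simp]; exact this) (memLp_const 1)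
  simp only [mul_one, Real.one_rpow, integral_const, smul_eq_mul] at h
  refine h.trans ?_
  have hn : ‖u‖ = (∫ y, |u y| ^ (2 : ℝ)) ^ (1 / (2 : ℝ)) := by
    rw [← Real.sqrt_eq_rpow, norm_eq_sqrt_real_inner, L2.inner_def]
    congr 1
    apply integral_congr_ae
    filter_upwards with y
    simp [sq]
  have hi : Integrable (fun y => |u y| ^ (2 : ℝ)) := by
    have := (Lp.memLp u).integrable_sq
    refine this.congr ?_
    filter_upwards with y
    simp
  rw [hn]
  simp only [measureReal_restrict_apply_univ, Real.volume_real_Icc, sub_zero, max_eq_left zero_le_one,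
    Real.one_rpow, mul_one]
  exact Real.rpow_le_rpow (integral_nonneg fun y => by positivity)
    (setIntegral_le_integral hi (Filter.Eventually.of_forall fun y => by positivity)) (by norm_num)

/-- The point evaluation `φ ↦ φ(0)` on `H¹(ℝ)`, that is `δ₀ ∈ H⁻¹(ℝ)`, where `φ(0)` is the value
at `0` of the continuous representative of `φ`. -/
def delta0 : H1 →L[ℝ] ℝ :=
  LinearMap.mkContinuous
    { toFun := fun φ => H1.rep φ 0
      map_add' := fun φ ψ => by
        have : H1.rep (φ + ψ) = fun y => H1.rep φ y + H1.rep ψ y := by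
          refine H1.rep_eq _ ((H1.continuous_rep φ).add (H1.continuous_rep ψ)) ?_
          rw [map_add]
          filter_upwards [Lp.coeFn_add (H1.fn φ) (H1.fn ψ), (H1.fn_ae_eq_rep φ), (H1.fn_ae_eq_rep ψ)]
            with y h1 h2 h3
          rw [h1, Pi.add_apply, h2, h3]
        rw [this]
      map_smul' := fun c φ => by
        have : H1.rep (c • φ) = fun y => c * H1.rep φ y := by
          refine H1.rep_eq _ (continuous_const.mul (H1.continuous_rep φ)) ?_
          rw [map_smul]
          filter_upwards [Lp.coeFn_smul c (H1.fn φ), (H1.fn_ae_eq_rep φ)] with y h1 h2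
          rw [h1, Pi.smul_apply, h2, smul_eq_mul]
        rw [this]
        rfl }
    2
    (fun φ => by
      change |H1.rep φ 0| ≤ 2 * ‖φ‖
      have hfn : ‖H1.fn φ‖ ≤ ‖φ‖ := WithLp.norm_fst_le (x := φ.1)
      have hder : ‖H1.der φ‖ ≤ ‖φ‖ := WithLp.norm_snd_le (x := φ.1)
      have hI : IntegrableOn (fun y => |H1.der φ y|) (Icc (0 : ℝ) 1) :=
        ((locallyIntegrable_L2 (H1.der φ)).integrableOn_isCompact isCompact_Icc).abs
      have hpt : ∀ y ∈ Icc (0 : ℝ) 1, |H1.rep φ 0| ≤ |H1.rep φ y| + ‖φ‖ := by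
        intro y hy
        have h1 := (H1.rep_sub_rep φ) 0 y
        have h2 : |∫ t in (0 : ℝ)..y, H1.der φ t| ≤ ‖φ‖ := by
          rw [intervalIntegral.integral_of_le hy.1]
          refine (abs_integral_le_integral_abs).trans (le_trans ?_
            ((setIntegral_abs_le (H1.der φ)).trans hder))
          exact setIntegral_mono_set hI (Filter.Eventually.of_forall fun _ => abs_nonneg _)
            (Filter.Eventually.of_forall fun t ht => ⟨ht.1.le, ht.2.trans hy.2⟩)
        rw [← h1] at h2
        have h3 := abs_sub_abs_le_abs_sub (H1.rep φ 0) (H1.rep φ y)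
        rw [abs_sub_comm] at h3
        linarith
      have hrep : IntegrableOn (fun y => |H1.rep φ y|) (Icc (0 : ℝ) 1) :=
        ((H1.continuous_rep φ).abs).continuousOn.integrableOn_compact isCompact_Icc
      have hmono : ∫ _y in Icc (0 : ℝ) 1, |H1.rep φ 0| ≤ ∫ y in Icc (0 : ℝ) 1, (|H1.rep φ y| + ‖φ‖) :=
        setIntegral_mono_on (integrableOn_const (by simp))
          (hrep.add (integrableOn_const (by simp))) measurableSet_Icc hpt
      rw [integral_add hrep (integrableOn_const (by simp))] at hmono
      simp only [integral_const, measureReal_restrict_apply_univ, Real.volume_real_Icc, sub_zero,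
        max_eq_left zero_le_one, one_smul] at hmono
      have hlast : ∫ y in Icc (0 : ℝ) 1, |H1.rep φ y| ≤ ‖φ‖ := by
        refine le_trans (le_of_eq ?_) ((setIntegral_abs_le (H1.fn φ)).trans hfn)
        apply integral_congr_ae
        filter_upwards [ae_restrict_of_ae (H1.fn_ae_eq_rep φ)] with y hy
        rw [hy]
      linarith)

theorem delta0_apply (φ : H1) : delta0 φ = H1.rep φ 0 := rfl

/-! ### The operators `L_λ^k = -d²/dy² + k²(1 - λ V₀ - V₁)` -/

theorem integrable_LInf_mul (V : LInf) (c : ℝ) (f g : L2) :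
    Integrable (fun y => (1 - c * V y) * f y * g y) := by
  have h1 : Integrable (fun y => f y * g y) := integrable_L2_mul f (Lp.memLp g)
  have h2 : MemLp (fun y => 1 - c * V y) (⊤ : ℝ≥0∞) volume :=
    (memLp_top_const (1 : ℝ)).sub ((Lp.memLp V).const_mul c)
  have h3 := h1.bdd_mul h2.1 (ae_le_of_ae_lt (f := fun y => ‖1 - c * V y‖)
    (g := fun _ => (eLpNormEssSup (fun y => 1 - c * V y) volume).toReal + 1) ?_)
  · simpa only [mul_assoc] using h3
  · have h4 := ae_le_eLpNormEssSup (f := fun y => 1 - c * V y) (μ := volume)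
    have h5 : eLpNormEssSup (fun y => 1 - c * V y) volume ≠ (⊤ : ℝ≥0∞) := by
      simpa using h2.2.ne
    filter_upwards [h4] with y hy
    have := ENNReal.toReal_mono h5 hy
    simp only [toReal_enorm] at this
    linarith

/-- The bilinear form of `-d²/dy² + k²(1 - λ V₀ - V₁)` on `H¹(ℝ)`, for `V₀ ∈ L^∞(ℝ)` and a bounded
operator `V₁ : H¹(ℝ) → H⁻¹(ℝ)`. -/
def schrodingerForm (V0 : LInf) (V1 : H1 →L[ℝ] StrongDual ℝ H1) (k : ℕ) (lam : ℝ) (φ ψ : H1) : ℝ :=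
  (∫ y, H1.der φ y * H1.der ψ y) +
    (k : ℝ) ^ 2 * ((∫ y, (1 - lam * V0 y) * H1.fn φ y * H1.fn ψ y) - V1 φ ψ)

theorem schrodingerForm_add (V0 : LInf) (V1 : H1 →L[ℝ] StrongDual ℝ H1) (k : ℕ) (lam : ℝ)
    (φ χ ψ : H1) : schrodingerForm V0 V1 k lam (φ + χ) ψ =
      schrodingerForm V0 V1 k lam φ ψ + schrodingerForm V0 V1 k lam χ ψ := by
  have e1 : ∫ y, H1.der (φ + χ) y * H1.der ψ y =
      (∫ y, H1.der φ y * H1.der ψ y) + ∫ y, H1.der χ y * H1.der ψ y := by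
    rw [← integral_add (integrable_L2_mul _ (Lp.memLp _)) (integrable_L2_mul _ (Lp.memLp _)),
      map_add]
    apply integral_congr_ae
    filter_upwards [Lp.coeFn_add (H1.der φ) (H1.der χ)] with y hy
    rw [hy, Pi.add_apply, add_mul]
  have e2 : ∫ y, (1 - lam * V0 y) * H1.fn (φ + χ) y * H1.fn ψ y =
      (∫ y, (1 - lam * V0 y) * H1.fn φ y * H1.fn ψ y) +
        ∫ y, (1 - lam * V0 y) * H1.fn χ y * H1.fn ψ y := by
    rw [← integral_add (integrable_LInf_mul _ _ _ _) (integrable_LInf_mul _ _ _ _), map_add]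
    apply integral_congr_ae
    filter_upwards [Lp.coeFn_add (H1.fn φ) (H1.fn χ)] with y hy
    rw [hy, Pi.add_apply]
    ring
  rw [schrodingerForm, e1, e2, map_add, add_apply, schrodingerForm,
    schrodingerForm]
  ring

theorem schrodingerForm_smul (V0 : LInf) (V1 : H1 →L[ℝ] StrongDual ℝ H1) (k : ℕ) (lam : ℝ)
    (c : ℝ) (φ ψ : H1) : schrodingerForm V0 V1 k lam (c • φ) ψ =
      c * schrodingerForm V0 V1 k lam φ ψ := by
  have e1 : ∫ y, H1.der (c • φ) y * H1.der ψ y = c * ∫ y, H1.der φ y * H1.der ψ y := by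
    rw [← integral_const_mul, map_smul]
    apply integral_congr_ae
    filter_upwards [Lp.coeFn_smul c (H1.der φ)] with y hy
    rw [hy, Pi.smul_apply, smul_eq_mul, mul_assoc]
  have e2 : ∫ y, (1 - lam * V0 y) * H1.fn (c • φ) y * H1.fn ψ y =
      c * ∫ y, (1 - lam * V0 y) * H1.fn φ y * H1.fn ψ y := by
    rw [← integral_const_mul, map_smul]
    apply integral_congr_ae
    filter_upwards [Lp.coeFn_smul c (H1.fn φ)] with y hy
    rw [hy, Pi.smul_apply, smul_eq_mul]
    ring
  rw [schrodingerForm, e1, e2, map_smul, smul_apply, schrodingerForm,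
    smul_eq_mul]
  ring

/-- The graph of `L_λ^k`: the pairs `(φ, f) ∈ L²(ℝ) × L²(ℝ)` with `φ ∈ H¹(ℝ)` and
`-φ'' + k²(1 - λ V₀ - V₁) φ = f` in `H⁻¹(ℝ)`. -/
def schrodingerGraph (V0 : LInf) (V1 : H1 →L[ℝ] StrongDual ℝ H1) (k : ℕ) (lam : ℝ) :
    Submodule ℝ (L2 × L2) where
  carrier := {p | ∃ φ : H1, H1.fn φ = p.1 ∧
    ∀ ψ : H1, schrodingerForm V0 V1 k lam φ ψ = ∫ y, p.2 y * H1.fn ψ y}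
  zero_mem' := by
    refine ⟨0, by simp, fun ψ => ?_⟩
    have h1 := schrodingerForm_smul V0 V1 k lam 0 0 ψ
    rw [zero_smul, zero_mul] at h1
    rw [h1, integral_mul_eq_inner _ (Lp.memLp (H1.fn ψ))]
    simp
  add_mem' := by
    rintro p q ⟨φ, h1, h2⟩ ⟨χ, h3, h4⟩
    refine ⟨φ + χ, by rw [map_add, h1, h3]; rfl, fun ψ => ?_⟩
    rw [schrodingerForm_add, h2, h4, integral_mul_eq_inner _ (Lp.memLp (H1.fn ψ)),
      integral_mul_eq_inner _ (Lp.memLp (H1.fn ψ)), integral_mul_eq_inner _ (Lp.memLp (H1.fn ψ)),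
      Prod.snd_add, inner_add_right]
  smul_mem' := by
    rintro c p ⟨φ, h1, h2⟩
    refine ⟨c • φ, by rw [map_smul, h1]; rfl, fun ψ => ?_⟩
    rw [schrodingerForm_smul, h2, integral_mul_eq_inner _ (Lp.memLp (H1.fn ψ)),
      integral_mul_eq_inner _ (Lp.memLp (H1.fn ψ)), Prod.smul_snd, inner_smul_right]

/-- A test function as an element of `H¹(ℝ)`. -/
def testH1 (η : ℝ → ℝ) (h1 : ContDiff ℝ ∞ η) (h2 : HasCompactSupport η) : H1 :=
  ⟨WithLp.toLp 2 ((memLp_test h1 h2).toLp η, (memLp_deriv_test h1 h2).toLp _), by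
    change IsWeakDeriv ((memLp_test h1 h2).toLp η) ((memLp_deriv_test h1 h2).toLp _)
    intro ψ p1 p2
    have hη := h1.differentiable (by simp)
    have hψ := p1.differentiable (by simp)
    have cη : Continuous (deriv η) := h1.continuous_deriv (by simp)
    have cψ : Continuous (deriv ψ) := p1.continuous_deriv (by simp)
    have key := integral_mul_deriv_eq_deriv_mul_of_integrable (u := η) (v := ψ) (u' := deriv η)
      (v' := deriv ψ) (fun x _ => (hη x).hasDerivAt) (fun x _ => (hψ x).hasDerivAt)
      ((h1.continuous.mul cψ).integrable_of_hasCompactSupport h2.mul_right)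
      ((cη.mul p1.continuous).integrable_of_hasCompactSupport p2.mul_left)
      ((h1.continuous.mul p1.continuous).integrable_of_hasCompactSupport h2.mul_right)
    have k1 : ∫ y, (memLp_test h1 h2).toLp η y * deriv ψ y = ∫ y, η y * deriv ψ y := by
      apply integral_congr_ae
      filter_upwards [(memLp_test h1 h2).coeFn_toLp] with y hy
      rw [hy]
    have k2 : ∫ y, (memLp_deriv_test h1 h2).toLp _ y * ψ y = ∫ y, deriv η y * ψ y := by
      apply integral_congr_ae
      filter_upwards [(memLp_deriv_test h1 h2).coeFn_toLp] with y hy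
      rw [hy]
    exact k1.trans (key.trans (congrArg Neg.neg k2.symm))⟩

/-- The weak derivative is unique. -/
theorem H1.fn_injective : Function.Injective H1.fn := by
  rw [injective_iff_map_eq_zero]
  intro φ h
  have hd : H1.der φ = 0 := by
    rw [Lp.eq_zero_iff_ae_eq_zero]
    refine ae_eq_zero_of_integral_contDiff_smul_eq_zero (locallyIntegrable_L2 _) fun g g1 g2 => ?_
    have h3 := H1.isWeakDeriv φ g g1 g2
    rw [integral_mul_eq_inner _ (memLp_deriv_test g1 g2), h, inner_zero_right] at h3
    simp only [smul_eq_mul, mul_comm (g _)]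
    linarith
  apply Subtype.ext
  exact WithLp.ofLp_injective 2 (Prod.ext h hd)

/-- The graph of `L_λ^k` is single-valued. -/
theorem schrodingerGraph_functional (V0 : LInf) (V1 : H1 →L[ℝ] StrongDual ℝ H1) (k : ℕ)
    (lam : ℝ) (p : L2 × L2) (hp : p ∈ schrodingerGraph V0 V1 k lam) (h0 : p.1 = 0) : p.2 = 0 := by
  obtain ⟨φ, h1, h2⟩ := hp
  have hφ : φ = 0 := H1.fn_injective (by rw [h1, h0, map_zero])
  rw [Lp.eq_zero_iff_ae_eq_zero]
  refine ae_eq_zero_of_integral_contDiff_smul_eq_zero (locallyIntegrable_L2 _) fun g g1 g2 => ?_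
  have h3 := h2 (testH1 g g1 g2)
  have h4 := schrodingerForm_smul V0 V1 k lam 0 0 (testH1 g g1 g2)
  rw [zero_smul, zero_mul] at h4
  rw [hφ, h4] at h3
  rw [h3]
  apply integral_congr_ae
  filter_upwards [(memLp_test g1 g2).coeFn_toLp] with y hy
  change g y * p.2 y = p.2 y * (memLp_test g1 g2).toLp g y
  rw [hy, mul_comm]

/-- The operator `L_λ^k = -d²/dy² + k²(1 - λ V₀ - V₁)` in `L²(ℝ)`. Its domain consists of the
`φ ∈ H¹(ℝ)` for which the distribution `-φ'' + k²(1 - λ V₀ - V₁) φ ∈ H⁻¹(ℝ)` belongs to `L²(ℝ)`. -/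
def schrodingerOp (V0 : LInf) (V1 : H1 →L[ℝ] StrongDual ℝ H1) (k : ℕ) (lam : ℝ) : L2 →ₗ.[ℝ] L2 :=
  (schrodingerGraph V0 V1 k lam).toLinearPMap

theorem schrodingerOp_graph (V0 : LInf) (V1 : H1 →L[ℝ] StrongDual ℝ H1) (k : ℕ) (lam : ℝ) :
    (schrodingerOp V0 V1 k lam).graph = schrodingerGraph V0 V1 k lam :=
  Submodule.toLinearPMap_graph_eq _ (schrodingerGraph_functional V0 V1 k lam)

/-- The resolvent set `ρ(T) ⊂ ℂ` of an operator `T` in a real Hilbert space `H`, that is of its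
complexification. A pair `(u, v)` stands for `u + i v`, and `R` is the bounded inverse of `μ - T`. -/
def resolventSet {H : Type*} [NormedAddCommGroup H] [NormedSpace ℝ H] (T : H →ₗ.[ℝ] H) : Set ℂ :=
  {μ | ∃ R : H × H →L[ℝ] H × H,
    (∀ f g : H, ∃ u v : T.domain, R (f, g) = ((u : H), (v : H)) ∧
      μ.re • (u : H) - μ.im • (v : H) - T u = f ∧ μ.re • (v : H) + μ.im • (u : H) - T v = g) ∧
    ∀ u v : T.domain, R (μ.re • (u : H) - μ.im • (v : H) - T u,
      μ.re • (v : H) + μ.im • (u : H) - T v) = ((u : H), (v : H))}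

/-- `φ` belongs to the kernel of `L_λ^k`. -/
def InKernel (V0 : LInf) (V1 : H1 →L[ℝ] StrongDual ℝ H1) (k : ℕ) (lam : ℝ) (φ : H1) : Prop :=
  ∃ h : H1.fn φ ∈ (schrodingerOp V0 V1 k lam).domain, schrodingerOp V0 V1 k lam ⟨H1.fn φ, h⟩ = 0

/-- The hypotheses of the abstract bifurcation result on `V(λ, ·) = λ V₀ + V₁`. That `V₀ ∈ L^∞(ℝ)`
and that `V₁ : H¹(ℝ) → H⁻¹(ℝ)` is bounded is part of the types of `V0` and `V1`. Wavenumbers are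
positive integers. -/
structure BifurcationHypotheses (V0 : LInf) (V1 : H1 →L[ℝ] StrongDual ℝ H1) (kstar : ℕ)
    (lamstar : ℝ) (I : Set ℝ) : Prop where
  /-- `L_λ^k` is self-adjoint for all `k` and all real `λ` -/
  selfAdjoint : ∀ k : ℕ, 1 ≤ k → ∀ lam : ℝ, IsSelfAdjoint (schrodingerOp V0 V1 k lam)
  /-- `I` is an open interval -/
  isOpen : IsOpen I
  ordConnected : I.OrdConnected
  mem : lamstar ∈ I
  one_le : 1 ≤ kstar
  /-- zero is a simple eigenvalue of `L_{λ_*}^{k_*}` -/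
  simple : Module.finrank ℝ (LinearMap.ker (schrodingerOp V0 V1 kstar lamstar).toFun) = 1
  /-- zero is isolated in the spectrum of `L_{λ_*}^{k_*}` -/
  isolated : ∃ δ > 0, ∀ μ : ℂ, 0 < ‖μ‖ → ‖μ‖ < δ →
    μ ∈ resolventSet (schrodingerOp V0 V1 kstar lamstar)
  /-- `0 ∈ ρ(L_λ^k)` for all other `(k, λ)` -/
  nonresonant : ∀ k : ℕ, 1 ≤ k → ∀ lam ∈ I, (k, lam) ≠ (kstar, lamstar) →
    (0 : ℂ) ∈ resolventSet (schrodingerOp V0 V1 k lam)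
  /-- the uniform estimates for all large `k` -/
  estimates : ∃ C > 0, ∃ K : ℕ, ∀ k : ℕ, 1 ≤ k → K ≤ k → ∀ lam ∈ I, ∀ φ : H1,
    ∀ h : H1.fn φ ∈ (schrodingerOp V0 V1 k lam).domain,
      ‖H1.fn φ‖ ≤ C / (k : ℝ) ^ 2 * ‖schrodingerOp V0 V1 k lam ⟨H1.fn φ, h⟩‖ ∧
      ‖H1.der φ‖ ≤ C / (k : ℝ) * ‖schrodingerOp V0 V1 k lam ⟨H1.fn φ, h⟩‖
  /-- the transversality condition -/
  transversal : ∀ φ : H1, φ ≠ 0 → InKernel V0 V1 kstar lamstar φ →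
    ∫ y, V0 y * H1.fn φ y ^ 2 ≠ 0

/-! ### Traveling waves -/

/-- The measure on `(-π, π]`, the fundamental domain of the `2π`-periodic torus `𝕋`. -/
def circleMeasure : Measure ℝ := volume.restrict (Ioc (-Real.pi) Real.pi)

instance : IsFiniteMeasure circleMeasure := by
  unfold circleMeasure
  infer_instance

/-- `v` is the weak derivative of `u` on the torus `𝕋`, for functions with values in a Banach
space `E`; the test functions are the smooth `2π`-periodic functions. -/
def IsPeriodicWeakDeriv {E : Type*} [NormedAddCommGroup E] [NormedSpace ℝ E] (u v : ℝ → E) : Prop :=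
  ∀ η : ℝ → ℝ, ContDiff ℝ ∞ η → Function.Periodic η (2 * Real.pi) →
    ∫ x, deriv η x • u x ∂circleMeasure = -∫ x, η x • v x ∂circleMeasure

theorem integrable_test_smul {E : Type*} [NormedAddCommGroup E] [NormedSpace ℝ E] {η : ℝ → ℝ}
    (hη : Continuous η) {u : ℝ → E} (hu : MemLp u 2 circleMeasure) :
    Integrable (fun x => η x • u x) circleMeasure := by
  have h1 : Integrable u circleMeasure := hu.integrable (by norm_num)
  obtain ⟨C, hC⟩ := (isCompact_Icc (a := -Real.pi) (b := Real.pi)).exists_bound_of_continuousOn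
    hη.continuousOn
  refine h1.bdd_smul C hη.aestronglyMeasurable ?_
  unfold circleMeasure
  filter_upwards [ae_restrict_mem measurableSet_Ioc] with x hx
  exact hC x ⟨hx.1.le, hx.2⟩

theorem IsPeriodicWeakDeriv.zero {E : Type*} [NormedAddCommGroup E] [NormedSpace ℝ E] :
    IsPeriodicWeakDeriv (fun _ => (0 : E)) (fun _ => (0 : E)) := by
  intro η _ _
  simp

theorem IsPeriodicWeakDeriv.add {E : Type*} [NormedAddCommGroup E] [NormedSpace ℝ E]
    {u v u' v' : ℝ → E} (mu : MemLp u 2 circleMeasure) (mv : MemLp v 2 circleMeasure)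
    (mu' : MemLp u' 2 circleMeasure) (mv' : MemLp v' 2 circleMeasure)
    (h : IsPeriodicWeakDeriv u v) (h' : IsPeriodicWeakDeriv u' v') :
    IsPeriodicWeakDeriv (fun x => u x + u' x) (fun x => v x + v' x) := by
  intro η h1 h2
  have hd : Continuous (deriv η) := h1.continuous_deriv (by simp)
  simp only [smul_add]
  rw [integral_add (integrable_test_smul hd mu) (integrable_test_smul hd mu'),
    integral_add (integrable_test_smul h1.continuous mv) (integrable_test_smul h1.continuous mv'),
    h η h1 h2, h' η h1 h2, neg_add]

theorem IsPeriodicWeakDeriv.smul {E : Type*} [NormedAddCommGroup E] [NormedSpace ℝ E]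
    {u v : ℝ → E} (c : ℝ) (h : IsPeriodicWeakDeriv u v) :
    IsPeriodicWeakDeriv (fun x => c • u x) (fun x => c • v x) := by
  intro η h1 h2
  simp only [smul_comm _ c]
  rw [integral_smul, integral_smul, h η h1 h2, smul_neg]

theorem IsPeriodicWeakDeriv.congr {E : Type*} [NormedAddCommGroup E] [NormedSpace ℝ E]
    {u v u' v' : ℝ → E} (hu : u' =ᵐ[circleMeasure] u) (hv : v' =ᵐ[circleMeasure] v)
    (h : IsPeriodicWeakDeriv u v) : IsPeriodicWeakDeriv u' v' := by
  intro η h1 h2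
  rw [integral_congr_ae (hu.mono fun x hx => by simp only [hx] :
      (fun x => deriv η x • u' x) =ᵐ[circleMeasure] fun x => deriv η x • u x),
    integral_congr_ae (hv.mono fun x hx => by simp only [hx] :
      (fun x => η x • v' x) =ᵐ[circleMeasure] fun x => η x • v x)]
  exact h η h1 h2

/-- `L²(𝕋; H¹(ℝ))` -/
abbrev L2H1 : Type := Lp H1 2 circleMeasure

/-- `L²(𝕋; L²(ℝ))` -/
abbrev L2L2 : Type := Lp L2 2 circleMeasure

theorem memLp_fn (u : L2H1) : MemLp (fun x => H1.fn (u x)) 2 circleMeasure :=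
  H1.fn.comp_memLp' (Lp.memLp u)

/-- The space `H²(𝕋; L²(ℝ)) ∩ H¹(𝕋; H¹(ℝ))`, as the space of the triples `(Φ, Φ_x, Φ_xx)` in
`L²(𝕋; H¹(ℝ)) × L²(𝕋; H¹(ℝ)) × L²(𝕋; L²(ℝ))` of a function and its weak derivatives in `x`, with
the product norm. -/
def WaveSpace : Submodule ℝ (L2H1 × L2H1 × L2L2) where
  carrier := {p | IsPeriodicWeakDeriv p.1 p.2.1 ∧
    IsPeriodicWeakDeriv (fun x => H1.fn (p.2.1 x)) p.2.2}
  zero_mem' := by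
    refine ⟨.congr (Lp.coeFn_zero _ _ _) (Lp.coeFn_zero _ _ _) .zero,
      .congr ?_ (Lp.coeFn_zero _ _ _) .zero⟩
    filter_upwards [Lp.coeFn_zero H1 2 circleMeasure] with x hx
    change H1.fn ((0 : L2H1) x) = 0
    rw [hx, Pi.zero_apply, map_zero]
  add_mem' := by
    rintro p q ⟨h1, h2⟩ ⟨h3, h4⟩
    refine ⟨.congr (Lp.coeFn_add _ _) (Lp.coeFn_add _ _)
        (.add (Lp.memLp _) (Lp.memLp _) (Lp.memLp _) (Lp.memLp _) h1 h3),
      .congr ?_ (Lp.coeFn_add _ _) (.add (memLp_fn _) (Lp.memLp _) (memLp_fn _) (Lp.memLp _) h2 h4)⟩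
    filter_upwards [Lp.coeFn_add p.2.1 q.2.1] with x hx
    change H1.fn ((p.2.1 + q.2.1) x) = _
    rw [hx, Pi.add_apply, map_add]
  smul_mem' := by
    rintro c p ⟨h1, h2⟩
    refine ⟨.congr (Lp.coeFn_smul _ _) (Lp.coeFn_smul _ _) (.smul c h1),
      .congr ?_ (Lp.coeFn_smul _ _) (.smul c h2)⟩
    filter_upwards [Lp.coeFn_smul c p.2.1] with x hx
    change H1.fn ((c • p.2.1) x) = _
    rw [hx, Pi.smul_apply, map_smul]

/-- The function `Φ` underlying an element of `H²(𝕋; L²(ℝ)) ∩ H¹(𝕋; H¹(ℝ))`. -/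
def WaveSpace.fn (Φ : WaveSpace) : L2H1 := Φ.1.1

/-- The weak derivative `Φ_x`. -/
def WaveSpace.dx (Φ : WaveSpace) : L2H1 := Φ.1.2.1

/-- The weak derivative `Φ_xx`. -/
def WaveSpace.dxx (Φ : WaveSpace) : L2L2 := Φ.1.2.2

/-- `Φ` is a weak solution of
`-Φ_yy - (1 - λ V₀(y) - V₁(y)) Φ_xx + Γ(y) (Φ³)_xx = 0`, where
`(Φ³)_xx = 3 Φ² Φ_xx + 6 Φ Φ_x²`. The test functions `Ψ` run through `H¹(𝕋; H¹(ℝ))`, and `Ψx` is the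
weak derivative of `Ψ` in `x`. -/
def IsWeakSolution (V0 : LInf) (V1 : H1 →L[ℝ] StrongDual ℝ H1) (Γ : LInf) (lam : ℝ)
    (Φ : WaveSpace) : Prop :=
  ∀ Ψ Ψx : L2H1, IsPeriodicWeakDeriv Ψ Ψx →
    (∫ x, (∫ y, (H1.der (WaveSpace.fn Φ x) y * H1.der (Ψ x) y
        - (1 - lam * V0 y) * WaveSpace.dxx Φ x y * H1.fn (Ψ x) y)) ∂circleMeasure)
      - (∫ x, V1 (WaveSpace.dx Φ x) (Ψx x) ∂circleMeasure)
      + (∫ x, (∫ y, Γ y * (3 * H1.fn (WaveSpace.fn Φ x) y ^ 2 * WaveSpace.dxx Φ x y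
          + 6 * H1.fn (WaveSpace.fn Φ x) y * H1.fn (WaveSpace.dx Φ x) y ^ 2)
          * H1.fn (Ψ x) y) ∂circleMeasure) = 0

/-- The curve `ε ↦ (Φ(ε), λ(ε))`, `|ε| < ε₀`, is a smooth curve through `(0, λ_*)` of nontrivial
weak solutions, bifurcating in the direction `φ*(y) sin(k_* x)`. -/
structure IsBifurcatingBranch (V0 : LInf) (V1 : H1 →L[ℝ] StrongDual ℝ H1) (Γ : LInf) (kstar : ℕ)
    (lamstar : ℝ) (I : Set ℝ) (φstar : H1) (ε₀ : ℝ) (Φ : ℝ → WaveSpace) (lam : ℝ → ℝ) : Prop where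
  smooth_wave : ContDiffOn ℝ ∞ Φ (Ioo (-ε₀) ε₀)
  smooth_param : ContDiffOn ℝ ∞ lam (Ioo (-ε₀) ε₀)
  mem : ∀ ε ∈ Ioo (-ε₀) ε₀, lam ε ∈ I
  solution : ∀ ε ∈ Ioo (-ε₀) ε₀, IsWeakSolution V0 V1 Γ (lam ε) (Φ ε)
  nontrivial : ∀ ε ∈ Ioo (-ε₀) ε₀, ε ≠ 0 → Φ ε ≠ 0
  /-- `Φ(x, y) = ∑_k φ_k(y) sin(k x)` -/
  sine : ∀ ε ∈ Ioo (-ε₀) ε₀, ∃ φ : ℕ → H1, ∀ᵐ x ∂circleMeasure,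
    HasSum (fun k : ℕ => Real.sin (k * x) • φ k) (WaveSpace.fn (Φ ε) x)
  wave_zero : Φ 0 = 0
  /-- `D_ε Φ(0)(x, y) = φ*(y) sin(k_* x)` -/
  wave_deriv : ∀ᵐ x ∂circleMeasure, WaveSpace.fn (deriv Φ 0) x = Real.sin (kstar * x) • φstar
  param_zero : lam 0 = lamstar
  param_deriv : deriv lam 0 = 0
  param_deriv_two : iteratedDeriv 2 lam 0 =
    -(3 / 2) * ((∫ y, Γ y * H1.fn φstar y ^ 4) / ∫ y, V0 y * H1.fn φstar y ^ 2)

/-! ### The step potential with a delta -/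

theorem memLp_stepOutside (b : ℝ) :
    MemLp ({y : ℝ | b ≤ |y|}.indicator fun _ => (1 : ℝ)) ∞ volume :=
  (memLp_top_const (1 : ℝ)).indicator (measurableSet_le measurable_const measurable_id.abs)

/-- `V₀ = 1_{|y| ≥ b}` -/
def stepOutside (b : ℝ) : LInf := (memLp_stepOutside b).toLp _

/-- Multiplication by `1_{|y| < b}`, as a bounded operator `H¹(ℝ) → H⁻¹(ℝ)`. -/
def stepInside (b : ℝ) : H1 →L[ℝ] StrongDual ℝ H1 :=
  (innerSL ℝ).bilinearComp
    ((LpToLpRestrictCLM ℝ ℝ ℝ volume 2 {y : ℝ | |y| < b}).comp H1.fn)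
    ((LpToLpRestrictCLM ℝ ℝ ℝ volume 2 {y : ℝ | |y| < b}).comp H1.fn)

theorem stepInside_apply (b : ℝ) (φ ψ : H1) :
    stepInside b φ ψ = ∫ y in {y : ℝ | |y| < b}, H1.fn φ y * H1.fn ψ y := by
  change inner ℝ (LpToLpRestrictCLM ℝ ℝ ℝ volume 2 {y : ℝ | |y| < b} (H1.fn φ))
    (LpToLpRestrictCLM ℝ ℝ ℝ volume 2 {y : ℝ | |y| < b} (H1.fn ψ)) = _
  rw [L2.inner_def]
  apply integral_congr_ae
  filter_upwards [LpToLpRestrictCLM_coeFn ℝ {y : ℝ | |y| < b} (H1.fn φ),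
    LpToLpRestrictCLM_coeFn ℝ {y : ℝ | |y| < b} (H1.fn ψ)] with y h1 h2
  rw [h1, h2]
  simp [mul_comm]

/-- `V₁ = β 1_{|y| < b} + α δ₀`, as a bounded operator `H¹(ℝ) → H⁻¹(ℝ)`. -/
def stepDelta (b β α : ℝ) : H1 →L[ℝ] StrongDual ℝ H1 :=
  β • stepInside b + α • ContinuousLinearMap.smulRight delta0 delta0

theorem stepDelta_apply (b β α : ℝ) (φ ψ : H1) :
    stepDelta b β α φ ψ = β * (∫ y in {y : ℝ | |y| < b}, H1.fn φ y * H1.fn ψ y)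
      + α * (H1.rep φ 0 * H1.rep ψ 0) := by
  rw [← stepInside_apply, ← delta0_apply, ← delta0_apply]
  rfl

end TravelingWave

end

noncomputable section

namespace TravelingWave

/-! ### Elementary facts on `L²(ℝ)` and `H¹(ℝ)` -/

/-! The operator `L_λ^k` is a rank one perturbation of a coercive one. For `λ < 1` the form without
the delta, with potential `p = k²(1-β)` inside and `q = k²(1-λ)` outside, is positive definite and
has an explicit Green function `G` with pole at 0 (`exists_green`). With `κ = k²α`, the equation `Lφ
= f` says `φ = g + κφ(0)G`, where `g` solves the problem without delta. Evaluation at 0 gives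
`φ(0)(1 - κG(0)) = g(0)`, so `L` is invertible when `κG(0) ≠ 1`, and its kernel is the line of `G`
when `κG(0) = 1`.

Here `κG(0) = D_k(λ)/D_{k*}(λ*)`, with `D` the function `dispersion`. It increases strictly in `k`
by convexity of sinh, and decreases strictly in `√(1-λ)` because cosh² - sinh² = 1. Hence near `λ*`
the value 1 occurs only at `(k*, λ*)` (`Resonant.exists_interval`). Moreover `D_k` grows linearly in
`k`. Once `κG(0) ≥ 2`, the delta correction does not increase the coercive energy, so the coercive
bounds with constant of order `k²` survive (`IsGreen.estimate`). Transversality holds because `G` is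
a positive exponential for `|y| > b`.

For the branch, let `R_k` invert `L_{λ*}^k`, with `L + P` inverted instead at `k*`, `P` being the
projection on the kernel. A wave is sought as `Φ = ∑ sin(kx) R_k z_k` with `z` in `ℓ¹(ℕ; L²)`. The
bounds on `k²R_k` in `L²` and on `kR_k` into `H¹` absorb the two `x`-derivatives. Products of sines
only shift frequencies and `H¹` embeds in `L^∞`, so the cubic term is a bounded trilinear map `M` on
`ℓ¹` (`SmoothingFamily.cubicOp`). The equation at `λ* + σ` becomes `z - Kz = σVz + M(z,z,z)` in
`ℓ¹`, where `K` applies `P` to the entry at `k*` and `V` has entries `k²V₀R_k`.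

Putting `z = εy` and `τ = ε²` turns this into `y - Ky = σVy + τM(y,y,y)`. The implicit function
theorem solves it near `y = e`, the sequence with single entry `φ*`; the required invertibility is
transversality (`exists_branch`). Then `λ(ε) = λ* + σ(ε²)`, so `λ'(0) = 0` and `λ''(0) = 2σ'(0)`,
where `σ'(0)` comes from differentiating the solvability condition. -/

theorem inner_eq_integral (u v : L2) : inner ℝ u v = ∫ y, u y * v y := by
  rw [integral_mul_eq_inner u (Lp.memLp v), real_inner_comm, Lp.toLp_coeFn]

theorem H1.norm_fn_le (φ : H1) : ‖H1.fn φ‖ ≤ ‖φ‖ := WithLp.norm_fst_le (x := φ.1)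

theorem H1.norm_der_le (φ : H1) : ‖H1.der φ‖ ≤ ‖φ‖ := WithLp.norm_snd_le (x := φ.1)

theorem H1.norm_sq_eq (φ : H1) : ‖φ‖ ^ 2 = ‖H1.fn φ‖ ^ 2 + ‖H1.der φ‖ ^ 2 :=
  WithLp.prod_norm_sq_eq_of_L2 (φ.1)

theorem setIntegral_abs_le' (u : L2) (a : ℝ) : ∫ y in Icc a (a + 1), |u y| ≤ ‖u‖ := by
  have h := integral_mul_le_Lp_mul_Lq_of_nonneg (μ := volume.restrict (Icc a (a + 1)))
    (p := 2) (q := 2) Real.HolderConjugate.two_two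
    (f := fun y => |u y|) (g := fun _ => (1 : ℝ))
    (Filter.Eventually.of_forall fun _ => abs_nonneg _)
    (Filter.Eventually.of_forall fun _ => zero_le_one)
    (by
      have := ((Lp.memLp u).restrict (Icc a (a + 1))).abs
      rw [show ENNReal.ofReal 2 = 2 by simp]; exact this) (memLp_const 1)
  simp only [mul_one, Real.one_rpow, integral_const, smul_eq_mul] at h
  refine h.trans ?_
  have hn : ‖u‖ = (∫ y, |u y| ^ (2 : ℝ)) ^ (1 / (2 : ℝ)) := by
    rw [← Real.sqrt_eq_rpow, norm_eq_sqrt_real_inner, inner_eq_integral]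
    congr 1
    apply integral_congr_ae
    filter_upwards with y
    simp [sq]
  have hi : Integrable (fun y => |u y| ^ (2 : ℝ)) := by
    have := (Lp.memLp u).integrable_sq
    refine this.congr ?_
    filter_upwards with y
    simp
  rw [hn]
  simp only [measureReal_restrict_apply_univ, Real.volume_real_Icc, add_sub_cancel_left,
    max_eq_left zero_le_one, Real.one_rpow, mul_one]
  exact Real.rpow_le_rpow (integral_nonneg fun y => by positivity)
    (setIntegral_le_integral hi (Filter.Eventually.of_forall fun y => by positivity)) (by norm_num)

/-- Average `|φ(a)| ≤ |φ(y)| + ‖φ‖` over `y` in the unit interval `[a, a+1]`. Cauchy-Schwarz on this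
interval bounds both the average of `|φ|` and the oscillation. -/
theorem H1.abs_rep_le (φ : H1) (a : ℝ) : |H1.rep φ a| ≤ 2 * ‖φ‖ := by
  have hI : IntegrableOn (fun y => |H1.der φ y|) (Icc a (a + 1)) :=
    ((locallyIntegrable_L2 (H1.der φ)).integrableOn_isCompact isCompact_Icc).abs
  have hpt : ∀ y ∈ Icc a (a + 1), |H1.rep φ a| ≤ |H1.rep φ y| + ‖φ‖ := by
    intro y hy
    have h1 := (H1.rep_sub_rep φ) a y
    have h2 : |∫ t in a..y, H1.der φ t| ≤ ‖φ‖ := by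
      rw [intervalIntegral.integral_of_le hy.1]
      refine (abs_integral_le_integral_abs).trans (le_trans ?_
        ((setIntegral_abs_le' (H1.der φ) a).trans φ.norm_der_le))
      exact setIntegral_mono_set hI (Filter.Eventually.of_forall fun _ => abs_nonneg _)
        (Filter.Eventually.of_forall fun t ht => ⟨ht.1.le, ht.2.trans hy.2⟩)
    rw [← h1] at h2
    have h3 := abs_sub_abs_le_abs_sub (H1.rep φ a) (H1.rep φ y)
    rw [abs_sub_comm] at h3
    linarith
  have hrep : IntegrableOn (fun y => |H1.rep φ y|) (Icc a (a + 1)) :=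
    ((H1.continuous_rep φ).abs).continuousOn.integrableOn_compact isCompact_Icc
  have hmono : ∫ _y in Icc a (a + 1), |H1.rep φ a| ≤
      ∫ y in Icc a (a + 1), (|H1.rep φ y| + ‖φ‖) :=
    setIntegral_mono_on (integrableOn_const (by simp))
      (hrep.add (integrableOn_const (by simp))) measurableSet_Icc hpt
  rw [integral_add hrep (integrableOn_const (by simp))] at hmono
  simp only [integral_const, measureReal_restrict_apply_univ, Real.volume_real_Icc,
    add_sub_cancel_left, max_eq_left zero_le_one, one_smul] at hmono
  have hlast : ∫ y in Icc a (a + 1), |H1.rep φ y| ≤ ‖φ‖ := by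
    refine le_trans (le_of_eq ?_) ((setIntegral_abs_le' (H1.fn φ) a).trans φ.norm_fn_le)
    apply integral_congr_ae
    filter_upwards [ae_restrict_of_ae (H1.fn_ae_eq_rep φ)] with y hy
    rw [hy]
  linarith

theorem H1.memLp_top (φ : H1) : MemLp (H1.fn φ) ∞ volume :=
  memLp_top_of_bound (Lp.aestronglyMeasurable _) (2 * ‖φ‖) <| by
    filter_upwards [H1.fn_ae_eq_rep φ] with y hy
    rw [hy]
    exact H1.abs_rep_le φ y

/-- The embedding `H¹(ℝ) ⊂ L^∞(ℝ)`. -/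
def H1.toLInf : H1 →L[ℝ] LInf :=
  LinearMap.mkContinuous
    { toFun := fun φ => φ.memLp_top.toLp _
      map_add' := fun φ ψ => by
        rw [← MemLp.toLp_add]
        apply MemLp.toLp_congr
        rw [map_add]
        exact Lp.coeFn_add _ _
      map_smul' := fun c φ => by
        rw [RingHom.id_apply, ← MemLp.toLp_const_smul]
        apply MemLp.toLp_congr
        rw [map_smul]
        exact Lp.coeFn_smul _ _ }
    2
    (fun φ => by
      change ‖φ.memLp_top.toLp _‖ ≤ _
      rw [Lp.norm_toLp, eLpNorm_exponent_top]
      refine ENNReal.toReal_le_of_le_ofReal (by positivity) (eLpNormEssSup_le_of_ae_bound ?_)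
      filter_upwards [H1.fn_ae_eq_rep φ] with y hy
      rw [hy]
      exact H1.abs_rep_le φ y)

theorem H1.coeFn_toLInf (φ : H1) : H1.toLInf φ =ᵐ[volume] H1.fn φ := φ.memLp_top.coeFn_toLp

theorem H1.norm_toLInf_le (φ : H1) : ‖H1.toLInf φ‖ ≤ 2 * ‖φ‖ :=
  (H1.toLInf.le_opNorm φ).trans
    (mul_le_mul_of_nonneg_right (LinearMap.mkContinuous_norm_le _ (by norm_num) _) (norm_nonneg _))

/-- Multiplication of `L²` functions by bounded functions. -/
def mulL : LInf →L[ℝ] L2 →L[ℝ] L2 := (ContinuousLinearMap.mul ℝ ℝ).holderL volume ∞ 2 2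

theorem coeFn_mulL (V : LInf) (f : L2) : mulL V f =ᵐ[volume] fun y => V y * f y :=
  (ContinuousLinearMap.mul ℝ ℝ).coeFn_holder V f

theorem norm_mulL_le (V : LInf) (f : L2) : ‖mulL V f‖ ≤ ‖V‖ * ‖f‖ := by
  refine ((ContinuousLinearMap.mul ℝ ℝ).norm_holder_apply_apply_le V f).trans ?_
  rw [mul_assoc]
  exact mul_le_of_le_one_left (by positivity) (ContinuousLinearMap.opNorm_mul_le ℝ ℝ)

theorem inner_mulL (V : LInf) (f g : L2) : inner ℝ (mulL V f) g = ∫ y, V y * f y * g y := by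
  rw [inner_eq_integral]
  apply integral_congr_ae
  filter_upwards [coeFn_mulL V f] with y hy
  rw [hy]

theorem inner_mulL_comm (V : LInf) (f g : L2) : inner ℝ (mulL V f) g = inner ℝ f (mulL V g) := by
  rw [real_inner_comm (mulL V g), inner_mulL, inner_mulL]
  congr 1 with y
  ring

/-! ### The orthogonal projection onto functions supported in `|y| ≥ b`, and the quadratic forms -/

theorem coeFn_stepOutside (b : ℝ) :
    stepOutside b =ᵐ[volume] {y : ℝ | b ≤ |y|}.indicator fun _ => (1 : ℝ) :=
  (memLp_stepOutside b).coeFn_toLp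

/-- Multiplication by `1_{|y| ≥ b}`. -/
def outer (b : ℝ) : L2 →L[ℝ] L2 := mulL (stepOutside b)

theorem outer_outer (b : ℝ) (f : L2) : outer b (outer b f) = outer b f := by
  apply Lp.ext
  filter_upwards [coeFn_mulL (stepOutside b) (outer b f), coeFn_mulL (stepOutside b) f,
    coeFn_stepOutside b] with y h1 h2 h3
  change mulL (stepOutside b) (outer b f) y = mulL (stepOutside b) f y
  rw [h1]
  change _ * mulL (stepOutside b) f y = _
  rw [h2, h3]
  by_cases hy : y ∈ {y : ℝ | b ≤ |y|} <;> simp [hy]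

theorem inner_outer_comm (b : ℝ) (f g : L2) : inner ℝ (outer b f) g = inner ℝ f (outer b g) :=
  inner_mulL_comm _ f g

theorem inner_outer_self (b : ℝ) (f : L2) : inner ℝ (outer b f) f = ‖outer b f‖ ^ 2 := by
  rw [← real_inner_self_eq_norm_sq, inner_outer_comm b f (outer b f), outer_outer,
    ← inner_outer_comm]

theorem norm_sub_outer_sq (b : ℝ) (f : L2) :
    ‖f - outer b f‖ ^ 2 = ‖f‖ ^ 2 - ‖outer b f‖ ^ 2 := by
  rw [norm_sub_sq_real, real_inner_comm, inner_outer_self]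
  ring

theorem stepInside_eq_inner (b : ℝ) (φ ψ : H1) :
    stepInside b φ ψ = inner ℝ (H1.fn φ - outer b (H1.fn φ)) (H1.fn ψ) := by
  have hm : MeasurableSet {y : ℝ | |y| < b} := measurableSet_lt measurable_id.abs measurable_const
  rw [stepInside_apply, ← integral_indicator hm, inner_eq_integral]
  apply integral_congr_ae
  filter_upwards [Lp.coeFn_sub (H1.fn φ) (outer b (H1.fn φ)), coeFn_mulL (stepOutside b) (H1.fn φ),
    coeFn_stepOutside b] with y h1 h2 h3
  rw [h1, Pi.sub_apply]
  change _ = (_ - mulL (stepOutside b) (H1.fn φ) y) * _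
  rw [h2, h3]
  by_cases hy : b ≤ |y|
  · simp [indicator, hy]
  · simp [indicator, hy, lt_of_not_ge hy]

theorem stepDelta_eq (b β α : ℝ) (φ ψ : H1) : stepDelta b β α φ ψ =
    β * inner ℝ (H1.fn φ - outer b (H1.fn φ)) (H1.fn ψ) + α * (delta0 φ * delta0 ψ) := by
  rw [← stepInside_eq_inner]
  rfl

/-- The bilinear form `∫ φ'ψ' + p ∫_{|y|<b} φψ + q ∫_{|y|≥b} φψ - κ φ(0)ψ(0)`. -/
def stepForm (b p q κ : ℝ) (φ ψ : H1) : ℝ :=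
  inner ℝ (H1.der φ) (H1.der ψ) + p * inner ℝ (H1.fn φ - outer b (H1.fn φ)) (H1.fn ψ)
    + q * inner ℝ (outer b (H1.fn φ)) (H1.fn ψ) - κ * (delta0 φ * delta0 ψ)

/-- Since `1_{|y|<b} = 1 - 1_{|y|≥b}`, the dependence on `k`, `λ`, `β` and `α` reduces to three
constants, two for the potential and one for the delta. -/
theorem schrodingerForm_eq_stepForm (b β α : ℝ) (k : ℕ) (lam : ℝ) (φ ψ : H1) :
    schrodingerForm (stepOutside b) (stepDelta b β α) k lam φ ψ =
      stepForm b (k ^ 2 * (1 - β)) (k ^ 2 * (1 - lam)) (k ^ 2 * α) φ ψ := by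
  have h : ∫ y, (1 - lam * stepOutside b y) * H1.fn φ y * H1.fn ψ y =
      inner ℝ (H1.fn φ - lam • outer b (H1.fn φ)) (H1.fn ψ) := by
    rw [inner_eq_integral]
    apply integral_congr_ae
    filter_upwards [Lp.coeFn_sub (H1.fn φ) (lam • outer b (H1.fn φ)),
      Lp.coeFn_smul lam (outer b (H1.fn φ)), coeFn_mulL (stepOutside b) (H1.fn φ)] with y h1 h2 h3
    rw [h1, Pi.sub_apply, h2, Pi.smul_apply]
    change _ = (_ - lam • mulL (stepOutside b) (H1.fn φ) y) * _
    rw [h3, smul_eq_mul]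
    ring
  rw [schrodingerForm, h, stepDelta_eq, stepForm, inner_eq_integral (H1.der φ)]
  simp only [inner_sub_left, inner_smul_left, RCLike.conj_to_real]
  ring

theorem stepForm_comm (b p q κ : ℝ) (φ ψ : H1) :
    stepForm b p q κ φ ψ = stepForm b p q κ ψ φ := by
  simp only [stepForm, inner_sub_left]
  rw [real_inner_comm, real_inner_comm (H1.fn ψ), inner_outer_comm, real_inner_comm _ (H1.fn φ)]
  ring

theorem stepForm_add (b p q κ : ℝ) (φ χ ψ : H1) :
    stepForm b p q κ (φ + χ) ψ = stepForm b p q κ φ ψ + stepForm b p q κ χ ψ := by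
  simp only [stepForm, inner_sub_left, map_add, inner_add_left]
  ring

theorem stepForm_smul (b p q κ c : ℝ) (φ ψ : H1) :
    stepForm b p q κ (c • φ) ψ = c * stepForm b p q κ φ ψ := by
  simp only [stepForm, inner_sub_left, map_smul, inner_smul_left, RCLike.conj_to_real, smul_eq_mul]
  ring

theorem stepForm_sub (b p q κ : ℝ) (φ χ ψ : H1) :
    stepForm b p q κ (φ - χ) ψ = stepForm b p q κ φ ψ - stepForm b p q κ χ ψ := by
  rw [sub_eq_add_neg, stepForm_add, ← neg_one_smul ℝ χ, stepForm_smul]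
  ring

theorem stepForm_shift (b p q κ c : ℝ) (φ ψ : H1) :
    stepForm b (p + c) (q + c) κ φ ψ =
      stepForm b p q κ φ ψ + c * inner ℝ (H1.fn φ) (H1.fn ψ) := by
  simp only [stepForm, inner_sub_left]
  ring

theorem stepForm_delta (b p q κ : ℝ) (φ ψ : H1) :
    stepForm b p q κ φ ψ = stepForm b p q 0 φ ψ - κ * (delta0 φ * delta0 ψ) := by
  simp only [stepForm]
  ring

theorem stepForm_self (b p q : ℝ) (φ : H1) : stepForm b p q 0 φ φ =
    ‖H1.der φ‖ ^ 2 + p * ‖H1.fn φ - outer b (H1.fn φ)‖ ^ 2 + q * ‖outer b (H1.fn φ)‖ ^ 2 := by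
  rw [norm_sub_outer_sq]
  simp only [stepForm, inner_sub_left, inner_outer_self, real_inner_self_eq_norm_sq]
  ring

/-- The inner and outer parts of `φ` are orthogonal, so their squared norms add up to `‖φ‖²`. For `m
> 0` this is the coercivity behind Lax-Milgram and the large wavenumber estimates. -/
theorem le_stepForm_self (b : ℝ) {p q m : ℝ} (hp : m ≤ p) (hq : m ≤ q) (φ : H1) :
    ‖H1.der φ‖ ^ 2 + m * ‖H1.fn φ‖ ^ 2 ≤ stepForm b p q 0 φ φ := by
  have h1 : m * ‖H1.fn φ - outer b (H1.fn φ)‖ ^ 2 ≤ p * ‖H1.fn φ - outer b (H1.fn φ)‖ ^ 2 := by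
    gcongr
  have h2 : m * ‖outer b (H1.fn φ)‖ ^ 2 ≤ q * ‖outer b (H1.fn φ)‖ ^ 2 := by gcongr
  have h3 := norm_sub_outer_sq b (H1.fn φ)
  have h4 : m * ‖H1.fn φ - outer b (H1.fn φ)‖ ^ 2 + m * ‖outer b (H1.fn φ)‖ ^ 2 =
      m * ‖H1.fn φ‖ ^ 2 := by
    rw [h3]
    ring
  rw [stepForm_self]
  linarith

/-! ### The fundamental solution of `-φ'' + (p 1_{|y|<b} + q 1_{|y|≥b}) φ` -/

/-- `f` is a continuous function in `H¹(ℝ)`, bounded by `C`, with derivative `f'`. -/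
structure IsSobolevPair (f f' : ℝ → ℝ) (C : ℝ) : Prop where
  continuous : Continuous f
  memLp : MemLp f 2 volume
  memLp_deriv : MemLp f' 2 volume
  bound : ∀ y, |f y| ≤ C
  sub_eq : ∀ a b, f b - f a = ∫ y in a..b, f' y

theorem H1.isSobolevPair (φ : H1) : IsSobolevPair (H1.rep φ) (H1.der φ) (2 * ‖φ‖) where
  continuous := φ.continuous_rep
  memLp := (Lp.memLp (H1.fn φ)).ae_eq φ.fn_ae_eq_rep
  memLp_deriv := Lp.memLp _
  bound := φ.abs_rep_le
  sub_eq := φ.rep_sub_rep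

theorem IsSobolevPair.comp_neg {f f' : ℝ → ℝ} {C : ℝ} (h : IsSobolevPair f f' C) :
    IsSobolevPair (fun y => f (-y)) (fun y => -f' (-y)) C where
  continuous := h.continuous.comp continuous_neg
  memLp := h.memLp.comp_measurePreserving (Measure.measurePreserving_neg volume)
  memLp_deriv := (h.memLp_deriv.comp_measurePreserving (Measure.measurePreserving_neg volume)).neg
  bound := fun y => h.bound (-y)
  sub_eq := fun a b => by
    rw [intervalIntegral.integral_neg, intervalIntegral.integral_comp_neg, h.sub_eq (-a) (-b),
      intervalIntegral.integral_symm]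

theorem IsSobolevPair.intervalIntegrable {f f' : ℝ → ℝ} {C : ℝ} (h : IsSobolevPair f f' C)
    (a b : ℝ) : IntervalIntegrable f' volume a b :=
  intervalIntegrable_iff.2 (((h.memLp_deriv.locallyIntegrable
    (by norm_num)).integrableOn_isCompact isCompact_uIcc).mono_set uIoc_subset_uIcc)

/-- As `f'` is only square integrable, `f` is merely absolutely continuous; this still suffices for
the product rule. -/
theorem IsSobolevPair.integral_by_parts {f f' : ℝ → ℝ} {C : ℝ} (h : IsSobolevPair f f' C)
    {u : ℝ → ℝ} (hu : ContDiff ℝ 1 u) (a c : ℝ) :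
    ∫ y in a..c, (u y * f' y + deriv u y * f y) = u c * f c - u a * f a := by
  have hF := (h.intervalIntegrable a c).absolutelyContinuousOnInterval_intervalIntegral
    (c := a) left_mem_uIcc
  have hf : AbsolutelyContinuousOnInterval f a c := by
    have h1 : AbsolutelyContinuousOnInterval (fun _ : ℝ => f a) a c :=
      (contDiff_const (n := 1)).contDiffOn.absolutelyContinuousOnInterval
    have h2 := h1.add hF
    have h3 : ((fun _ : ℝ => f a) + fun x => ∫ t in a..x, f' t) = f := by
      funext x
      have := h.sub_eq a x
      simp only [Pi.add_apply]
      linarith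
    rwa [h3] at h2
  have hu' : AbsolutelyContinuousOnInterval u a c := hu.contDiffOn.absolutelyContinuousOnInterval
  have hd : ∀ᵐ y, deriv f y = f' y := by
    have hl : LocallyIntegrable f' volume := h.memLp_deriv.locallyIntegrable (by norm_num)
    filter_upwards [LocallyIntegrable.ae_hasDerivAt_integral hl] with y hy
    have h3 : f = fun x => f 0 + ∫ t in (0 : ℝ)..x, f' t := by
      funext x
      have := h.sub_eq 0 x
      linarith
    rw [h3]
    exact ((hy 0).const_add _).deriv
  have key := hu'.integral_mul_deriv_eq_deriv_mul hf
  have e1 : ∫ y in a..c, u y * f' y = ∫ y in a..c, u y * deriv f y := by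
    apply intervalIntegral.integral_congr_ae
    filter_upwards [hd] with y hy _
    rw [hy]
  have i1 : IntervalIntegrable (fun y => u y * f' y) volume a c :=
    (h.intervalIntegrable a c).continuousOn_mul hu.continuous.continuousOn
  have i2 : IntervalIntegrable (fun y => deriv u y * f y) volume a c :=
    ((hu.continuous_deriv le_rfl).mul h.continuous).intervalIntegrable _ _
  rw [intervalIntegral.integral_add i1 i2, e1, key]
  ring

/-- The even-extension profile with interior part `u` and exterior part `A e^{-s(t-b)}`. -/
def glue (b s A : ℝ) (u : ℝ → ℝ) (t : ℝ) : ℝ := if t < b then u t else A * Real.exp (-s * (t - b))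

theorem measurable_glue (b s A : ℝ) {u : ℝ → ℝ} (hu : Continuous u) : Measurable (glue b s A u) :=
  Measurable.ite measurableSet_Iio hu.measurable (by fun_prop)

theorem exists_glue_le (b s A : ℝ) (hb : 0 < b) (hs : 0 < s) {u : ℝ → ℝ} (hu : Continuous u) :
    ∃ M, 0 ≤ M ∧ ∀ t, 0 ≤ t → |glue b s A u t| ≤ M * Real.exp (-s * t) := by
  obtain ⟨M, hM⟩ := (isCompact_Icc (a := (0 : ℝ)) (b := b)).exists_bound_of_continuousOn
    hu.continuousOn
  have hM0 : 0 ≤ M := (norm_nonneg _).trans (hM 0 ⟨le_rfl, hb.le⟩)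
  -- The factor `e^{sb}` compensates `e^{-st} ≥ e^{-sb}` on the interior and restores the shift in
  -- `e^{-s(t-b)}` on the exterior.
  refine ⟨(M + |A|) * Real.exp (s * b), by positivity, fun t ht => ?_⟩
  rw [mul_assoc, ← Real.exp_add]
  unfold glue
  split_ifs with h
  · have h1 := hM t ⟨ht, h.le⟩
    rw [Real.norm_eq_abs] at h1
    have h2 : 1 ≤ Real.exp (s * b + -s * t) := Real.one_le_exp (by nlinarith)
    nlinarith [abs_nonneg A]
  · rw [abs_mul, abs_of_pos (Real.exp_pos _), show s * b + -s * t = -s * (t - b) by ring]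
    gcongr
    linarith

theorem memLp_exp_neg_abs {s : ℝ} (hs : 0 < s) :
    MemLp (fun y : ℝ => Real.exp (-s * |y|)) 2 volume := by
  have hm : AEStronglyMeasurable (fun y : ℝ => Real.exp (-s * |y|)) volume := by
    apply Continuous.aestronglyMeasurable
    fun_prop
  rw [memLp_two_iff_integrable_sq hm]
  have h1 : IntegrableOn (fun y : ℝ => Real.exp (-s * |y|) ^ 2) (Ioi 0) := by
    refine (integrableOn_exp_mul_Ioi (a := -(2 * s)) (by linarith) 0).congr_fun ?_ measurableSet_Ioi
    intro y hy
    have : |y| = y := abs_of_pos hy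
    simp only [this]
    rw [sq, ← Real.exp_add]
    congr 1
    ring
  have h2 : IntegrableOn (fun y : ℝ => Real.exp (-s * |y|) ^ 2) (Iic 0) := by
    rw [← (Measure.measurePreserving_neg (volume : Measure ℝ)).integrableOn_comp_preimage
      (Homeomorph.neg ℝ).measurableEmbedding, neg_preimage, neg_Iic, neg_zero,
      integrableOn_Ici_iff_integrableOn_Ioi]
    simpa [Function.comp_def] using h1
  rw [← integrableOn_univ, ← Iic_union_Ioi (a := (0 : ℝ))]
  exact h2.union h1

/-- The extension of a profile on the half line, even for `σ = 1` and odd for `σ = -1`. -/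
def extend (σ : ℝ) (γ : ℝ → ℝ) (y : ℝ) : ℝ := if 0 < y then γ y else σ * γ (-y)

theorem memLp_extend_glue (b s A σ : ℝ) (hb : 0 < b) (hs : 0 < s) {u : ℝ → ℝ}
    (hu : Continuous u) : MemLp (extend σ (glue b s A u)) 2 volume := by
  obtain ⟨M, hM0, hM⟩ := exists_glue_le b s A hb hs hu
  refine ((memLp_exp_neg_abs hs).const_mul ((1 + |σ|) * M)).mono ?_ (.of_forall fun y => ?_)
  · have h1 := measurable_glue b s A hu
    exact (Measurable.ite measurableSet_Ioi h1
      ((h1.comp measurable_neg).const_mul σ)).aestronglyMeasurable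
  · rw [Real.norm_eq_abs, Real.norm_eq_abs, abs_of_nonneg (a := _ * _) (by positivity)]
    unfold extend
    split_ifs with h
    · have h1 := hM y h.le
      rw [abs_of_pos h]
      refine h1.trans ?_
      have h2 : 0 ≤ |σ| * (M * Real.exp (-s * y)) := by positivity
      nlinarith
    · have h1 := hM (-y) (by linarith)
      rw [abs_mul, abs_of_nonpos (not_lt.1 h)]
      have h2 : 0 ≤ M * Real.exp (-s * -y) := by positivity
      have h3 : |σ| * |glue b s A u (-y)| ≤ |σ| * (M * Real.exp (-s * -y)) := by gcongr
      nlinarith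

theorem memLp_glue (b s A : ℝ) (hb : 0 < b) (hs : 0 < s) {u : ℝ → ℝ}
    (hu : Continuous u) : MemLp (glue b s A u) 2 (volume.restrict (Ioi 0)) := by
  refine ((memLp_extend_glue b s A 1 hb hs hu).restrict (Ioi 0)).ae_eq ?_
  filter_upwards [ae_restrict_mem measurableSet_Ioi] with y hy
  exact if_pos hy

/-- The integrand is the derivative of a product on each side of `b`. The boundary terms at `b`
cancel because the two pieces agree there, and the one at infinity vanishes because `f` is bounded
and the exponential decays. Only the term at 0 remains. -/
theorem IsSobolevPair.integral_glue {f f' : ℝ → ℝ} {C : ℝ} (h : IsSobolevPair f f' C)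
    {b s A : ℝ} (hb : 0 < b) (hs : 0 < s) {u : ℝ → ℝ} (hu : ContDiff ℝ 1 u) (hA : u b = A) :
    ∫ t in Ioi 0, (glue b s A u t * f' t + glue b s (-s * A) (deriv u) t * f t) =
      -(u 0 * f 0) := by
  have hint : IntegrableOn
      (fun t => glue b s A u t * f' t + glue b s (-s * A) (deriv u) t * f t) (Ioi 0) :=
    ((memLp_glue b s A hb hs hu.continuous).integrable_mul (h.memLp_deriv.restrict _)).add
      ((memLp_glue b s (-s * A) hb hs (hu.continuous_deriv le_rfl)).integrable_mul
        (h.memLp.restrict _))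
  have hlim := intervalIntegral_tendsto_integral_Ioi 0 hint Filter.tendsto_id
  set v : ℝ → ℝ := fun t => A * Real.exp (-s * (t - b)) with hv
  have hvd : ∀ t, HasDerivAt v (-s * A * Real.exp (-s * (t - b))) t := by
    intro t
    have h1 : HasDerivAt (fun t => -s * (t - b)) (-s) t := by
      simpa using ((hasDerivAt_id t).sub_const b).const_mul (-s)
    have := (h1.exp).const_mul A
    convert! this using 1
    ring
  have hvc : ContDiff ℝ 1 v := by fun_prop
  have hval : ∀ R, b ≤ R → ∫ t in (0 : ℝ)..R,
      (glue b s A u t * f' t + glue b s (-s * A) (deriv u) t * f t) = v R * f R - u 0 * f 0 := by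
    intro R hR
    have hi : ∀ x y : ℝ, 0 ≤ x → x ≤ y → IntervalIntegrable
        (fun t => glue b s A u t * f' t + glue b s (-s * A) (deriv u) t * f t) volume x y := by
      intro x y hx hxy
      rw [intervalIntegrable_iff_integrableOn_Ioc_of_le hxy]
      exact hint.mono_set fun t ht => hx.trans_lt ht.1
    rw [← intervalIntegral.integral_add_adjacent_intervals (hi 0 b le_rfl hb.le) (hi b R hb.le hR)]
    have e1 : ∫ t in (0 : ℝ)..b,
        (glue b s A u t * f' t + glue b s (-s * A) (deriv u) t * f t) =
        ∫ t in (0 : ℝ)..b, (u t * f' t + deriv u t * f t) := by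
      rw [intervalIntegral.integral_of_le hb.le, intervalIntegral.integral_of_le hb.le,
        integral_Ioc_eq_integral_Ioo, integral_Ioc_eq_integral_Ioo]
      apply setIntegral_congr_fun measurableSet_Ioo
      intro t ht
      simp only [glue, if_pos ht.2]
    have e2 : ∫ t in b..R,
        (glue b s A u t * f' t + glue b s (-s * A) (deriv u) t * f t) =
        ∫ t in b..R, (v t * f' t + deriv v t * f t) := by
      rw [intervalIntegral.integral_of_le hR, intervalIntegral.integral_of_le hR]
      apply setIntegral_congr_fun measurableSet_Ioc
      intro t ht
      simp only [glue, if_neg (not_lt.2 ht.1.le), (hvd t).deriv]; rfl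
    rw [e1, e2, h.integral_by_parts hu, h.integral_by_parts hvc, hA]
    simp [hv]
  have hlim2 : Filter.Tendsto (fun R => v R * f R - u 0 * f 0) Filter.atTop
      (𝓝 (0 - u 0 * f 0)) := by
    refine Filter.Tendsto.sub_const ?_ _
    have hv0 : Filter.Tendsto v Filter.atTop (𝓝 0) := by
      have h1 : Filter.Tendsto (fun t : ℝ => -s * (t - b)) Filter.atTop Filter.atBot :=
        Filter.Tendsto.const_mul_atTop_of_neg (by linarith)
          (Filter.tendsto_atTop_add_const_right _ (-b) Filter.tendsto_id)
      simpa [hv, Function.comp_def] using (Real.tendsto_exp_atBot.comp h1).const_mul A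
    refine squeeze_zero_norm (a := fun t => |v t| * C) (fun t => ?_) ?_
    · rw [norm_mul, Real.norm_eq_abs, Real.norm_eq_abs]
      gcongr
      exact h.bound t
    · simpa using hv0.abs.mul_const C
  have := tendsto_nhds_unique hlim (hlim2.congr' ?_)
  · rw [this]; ring
  · filter_upwards [Filter.eventually_ge_atTop b] with R hR
    exact (hval R hR).symm

/-- Splitting an integral over the line into two integrals over the half line. -/
theorem integral_eq_Ioi_add_Ioi {F : ℝ → ℝ} (hF : Integrable F) :
    ∫ y, F y = (∫ y in Ioi 0, F y) + ∫ y in Ioi 0, F (-y) := by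
  rw [← intervalIntegral.integral_Iic_add_Ioi (b := 0) hF.integrableOn hF.integrableOn, add_comm]
  congr 1
  rw [integral_comp_neg_Ioi, neg_zero]

/-- Reflection turns the left half line into the right one, with a second boundary term at 0. For `σ
= 1` the two cancel and the identity is a weak derivative; for `σ = -1` they add up and produce the
delta. -/
theorem IsSobolevPair.integral_extend {f f' : ℝ → ℝ} {C : ℝ} (h : IsSobolevPair f f' C)
    {b s A : ℝ} (hb : 0 < b) (hs : 0 < s) {u : ℝ → ℝ} (hu : ContDiff ℝ 1 u) (hA : u b = A)
    (σ : ℝ) :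
    ∫ y, (extend σ (glue b s A u) y * f' y +
        extend (-σ) (glue b s (-s * A) (deriv u)) y * f y) = (σ - 1) * (u 0 * f 0) := by
  have i1 := (memLp_extend_glue b s A σ hb hs hu.continuous).integrable_mul h.memLp_deriv
  have i2 := (memLp_extend_glue b s (-s * A) (-σ) hb hs
    (hu.continuous_deriv le_rfl)).integrable_mul h.memLp
  have i3 : Integrable fun y => extend σ (glue b s A u) y * f' y +
      extend (-σ) (glue b s (-s * A) (deriv u)) y * f y := i1.add i2
  rw [integral_eq_Ioi_add_Ioi i3]
  have e1 : ∫ y in Ioi 0, (extend σ (glue b s A u) y * f' y +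
        extend (-σ) (glue b s (-s * A) (deriv u)) y * f y) = -(u 0 * f 0) := by
    rw [← h.integral_glue hb hs hu hA]
    apply setIntegral_congr_fun measurableSet_Ioi
    intro t ht
    simp only [extend, if_pos (show (0 : ℝ) < t from ht)]
  have e2 : ∫ y in Ioi 0, (extend σ (glue b s A u) (-y) * f' (-y) +
        extend (-σ) (glue b s (-s * A) (deriv u)) (-y) * f (-y)) = σ * (u 0 * f 0) := by
    have h1 := h.comp_neg.integral_glue hb hs hu hA
    rw [neg_zero] at h1
    rw [← neg_neg (u 0 * f 0), ← h1, ← integral_neg, ← integral_const_mul]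
    apply setIntegral_congr_fun measurableSet_Ioi
    intro t ht
    have ht' : ¬ (0 : ℝ) < -t := by
      have : (0 : ℝ) < t := ht
      linarith
    simp only [extend, if_neg ht', neg_neg]
    ring
  rw [e1, e2]
  ring

/-- The interior part of the fundamental solution. -/
def innerProfile (b r s t : ℝ) : ℝ := Real.cosh (r * (b - t)) + s / r * Real.sinh (r * (b - t))

theorem contDiff_innerProfile (b r s : ℝ) : ContDiff ℝ ∞ (innerProfile b r s) := by
  unfold innerProfile
  have h : ContDiff ℝ ∞ fun t : ℝ => r * (b - t) := by fun_prop
  exact (Real.contDiff_cosh.comp h).add (contDiff_const.mul (Real.contDiff_sinh.comp h))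

theorem deriv_innerProfile (b s : ℝ) {r : ℝ} (hr : 0 < r) : deriv (innerProfile b r s) =
    fun t => -(r * Real.sinh (r * (b - t)) + s * Real.cosh (r * (b - t))) := by
  funext t
  have h : HasDerivAt (fun t : ℝ => r * (b - t)) (-r) t := by
    simpa using ((hasDerivAt_id t).const_sub b).const_mul r
  have h2 := h.cosh.add (h.sinh.const_mul (s / r))
  refine (h2.congr_deriv ?_).deriv
  field_simp
  ring

theorem deriv_deriv_innerProfile (b s : ℝ) {r : ℝ} (hr : 0 < r) :
    deriv (deriv (innerProfile b r s)) = fun t => r ^ 2 * innerProfile b r s t := by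
  rw [deriv_innerProfile b s hr]
  funext t
  have h : HasDerivAt (fun t : ℝ => r * (b - t)) (-r) t := by
    simpa using ((hasDerivAt_id t).const_sub b).const_mul r
  have h2 := ((h.sinh.const_mul r).add (h.cosh.const_mul s)).neg
  refine (h2.congr_deriv ?_).deriv
  unfold innerProfile
  field_simp
  ring

/-- The value at zero of the fundamental solution (up to normalization). -/
def greenValue (b r s : ℝ) : ℝ :=
  (r * Real.cosh (r * b) + s * Real.sinh (r * b)) /
    (2 * r * (r * Real.sinh (r * b) + s * Real.cosh (r * b)))

theorem green_denom_pos {b r s : ℝ} (hb : 0 < b) (hr : 0 < r) (hs : 0 < s) :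
    0 < r * Real.sinh (r * b) + s * Real.cosh (r * b) := by
  have h1 : 0 < Real.sinh (r * b) := Real.sinh_pos_iff.2 (by positivity)
  have h2 := Real.cosh_pos (r * b)
  positivity

/-- The fundamental solution of `-φ'' + (r² 1_{|y|<b} + s² 1_{|y|≥b}) φ`. -/
theorem exists_green {b r s : ℝ} (hb : 0 < b) (hr : 0 < r) (hs : 0 < s) :
    ∃ G : H1, (∀ ψ : H1, stepForm b (r ^ 2) (s ^ 2) 0 G ψ = delta0 ψ) ∧
      delta0 G = greenValue b r s ∧ outer b (H1.fn G) ≠ 0 := by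
  set u := innerProfile b r s with hu
  -- The profile has value 1 and slope `-s` at `b`, like `e^{-s(t-b)}`. Value and derivative are
  -- therefore continuous across `|y| = b`, and no point source arises there.
  have hub : u b = 1 := by simp [hu, innerProfile]
  have hu1 : ContDiff ℝ 1 u := (contDiff_innerProfile b r s).of_le (by simp)
  have hu2 : ContDiff ℝ 1 (deriv u) :=
    ((contDiff_infty_iff_deriv.1 (contDiff_innerProfile b r s)).2).of_le (by simp)
  have hdub : deriv u b = -s * 1 := by simp [hu, deriv_innerProfile b s hr]
  set g := extend 1 (glue b s 1 u) with hg
  set g1 := extend (-1) (glue b s (-s * 1) (deriv u)) with hg1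
  have mg : MemLp g 2 volume := memLp_extend_glue b s 1 1 hb hs hu1.continuous
  have mg1 : MemLp g1 2 volume := memLp_extend_glue b s (-s * 1) (-1) hb hs hu2.continuous
  have hgc : Continuous g := by
    have h1 : g = fun y => glue b s 1 u |y| := by
      funext y
      simp only [hg, extend]
      split_ifs with h
      · rw [abs_of_pos h]
      · rw [abs_of_nonpos (not_lt.1 h), one_mul]
    have h2 : Continuous (glue b s 1 u) := by
      have h3 : Continuous fun t => 1 * Real.exp (-s * (t - b)) := by fun_prop
      refine (Continuous.if_le h3 hu1.continuous (continuous_const (y := b)) continuous_id ?_).congr ?_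
      · rintro t rfl
        simp [hub]
      · intro t
        simp only [glue, id]
        split_ifs with h4 h5 h5
        · linarith
        · rfl
        · rfl
        · linarith
    rw [h1]
    exact h2.comp continuous_abs
  have hweak : IsWeakDeriv (mg.toLp g) (mg1.toLp g1) := by
    intro ψ h1 h2
    have hs0 := (testH1 ψ h1 h2).isSobolevPair
    have hrep : H1.rep (testH1 ψ h1 h2) = ψ :=
      H1.rep_eq _ h1.continuous (memLp_test h1 h2).coeFn_toLp
    have hder : H1.der (testH1 ψ h1 h2) =ᵐ[volume] deriv ψ := (memLp_deriv_test h1 h2).coeFn_toLp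
    -- The even extension has no jump at 0, so the boundary factor `σ - 1` vanishes.
    have key := hs0.integral_extend hb hs hu1 hub 1
    rw [hrep] at key
    rw [integral_congr_ae (g := fun y => g y * deriv ψ y + g1 y * ψ y)] at key
    · have i1 : Integrable fun y => g y * deriv ψ y := mg.integrable_mul (memLp_deriv_test h1 h2)
      have i2 : Integrable fun y => g1 y * ψ y := mg1.integrable_mul (memLp_test h1 h2)
      rw [integral_add i1 i2] at key
      have e1 : ∫ y, mg.toLp g y * deriv ψ y = ∫ y, g y * deriv ψ y := by
        apply integral_congr_ae
        filter_upwards [mg.coeFn_toLp] with y hy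
        rw [hy]
      have e2 : ∫ y, mg1.toLp g1 y * ψ y = ∫ y, g1 y * ψ y := by
        apply integral_congr_ae
        filter_upwards [mg1.coeFn_toLp] with y hy
        rw [hy]
      rw [e1, e2]
      linarith
    · filter_upwards [hder] with y hy
      rw [hy]
  let G0 : H1 := ⟨WithLp.toLp 2 (mg.toLp g, mg1.toLp g1), hweak⟩
  have hfn : H1.fn G0 =ᵐ[volume] g := mg.coeFn_toLp
  have hder : H1.der G0 =ᵐ[volume] g1 := mg1.coeFn_toLp
  set D := r * Real.sinh (r * b) + s * Real.cosh (r * b) with hD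
  have hDpos : 0 < D := green_denom_pos hb hr hs
  have hform : ∀ ψ : H1, stepForm b (r ^ 2) (s ^ 2) 0 G0 ψ = 2 * D * delta0 ψ := by
    intro ψ
    -- The same identity one derivative higher: the derivative is odd, so its jump at 0 contributes
    -- `-2u'(0)ψ(0) = 2Dψ(0)`.
    have key := ψ.isSobolevPair.integral_extend hb hs hu2 hdub (-1)
    have e0 : deriv u 0 = -D := by simp [hu, deriv_innerProfile b s hr, hD]
    rw [e0, neg_neg, deriv_deriv_innerProfile b s hr] at key
    rw [delta0_apply]
    have e1 : (-1 - 1) * (-D * H1.rep ψ 0) = 2 * D * H1.rep ψ 0 := by ring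
    rw [e1] at key
    rw [← key]
    have e2 : stepForm b (r ^ 2) (s ^ 2) 0 G0 ψ = inner ℝ (H1.der G0) (H1.der ψ) +
        inner ℝ (r ^ 2 • (H1.fn G0 - outer b (H1.fn G0)) + s ^ 2 • outer b (H1.fn G0))
          (H1.fn ψ) := by
      simp only [stepForm, inner_add_left, inner_smul_left, RCLike.conj_to_real]
      ring
    rw [e2, inner_eq_integral, inner_eq_integral,
      ← integral_add (integrable_L2_mul _ (Lp.memLp _)) (integrable_L2_mul _ (Lp.memLp _))]
    apply integral_congr_ae
    filter_upwards [hder, hfn, ψ.fn_ae_eq_rep, coeFn_stepOutside b,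
      coeFn_mulL (stepOutside b) (H1.fn G0), Lp.coeFn_sub (H1.fn G0) (outer b (H1.fn G0)),
      Lp.coeFn_add (r ^ 2 • (H1.fn G0 - outer b (H1.fn G0))) (s ^ 2 • outer b (H1.fn G0)),
      Lp.coeFn_smul (r ^ 2) (H1.fn G0 - outer b (H1.fn G0)),
      Lp.coeFn_smul (s ^ 2) (outer b (H1.fn G0))] with y h1 h2 h3 h4 h5 h6 h7 h8 h9
    have h5' : outer b (H1.fn G0) y = stepOutside b y * H1.fn G0 y := h5
    rw [h7, Pi.add_apply, h8, h9, Pi.smul_apply, Pi.smul_apply, h6, Pi.sub_apply, h5', h1, h2, h3,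
      h4]
    congr 2
    simp only [hg, extend, glue, smul_eq_mul, one_mul, indicator, mem_ofPred_eq]
    rcases lt_or_ge 0 y with hy | hy
    · simp only [if_pos hy, abs_of_pos hy]
      by_cases hyb : y < b
      · simp [hyb, not_le.2 hyb, hu]
      · simp [hyb, not_lt.1 hyb]
        ring
    · simp only [if_neg (not_lt.2 hy), abs_of_nonpos hy]
      by_cases hyb : -y < b
      · simp [hyb, not_le.2 hyb, hu]
      · simp [hyb, not_lt.1 hyb]
        ring
  have hval : delta0 G0 = u 0 := by
    rw [delta0_apply, H1.rep_eq G0 hgc hfn]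
    simp [hg, extend, glue, hb]
  refine ⟨(2 * D)⁻¹ • G0, fun ψ => ?_, ?_, ?_⟩
  · rw [stepForm_smul, hform]
    field_simp
  · rw [map_smul, hval, hu, innerProfile, greenValue, smul_eq_mul, sub_zero]
    field_simp
    rw [hD]
    ring
  · rw [map_smul, map_smul]
    refine smul_ne_zero (by positivity) fun h0 => ?_
    rw [Lp.eq_zero_iff_ae_eq_zero] at h0
    -- Beyond `b` the unnormalized solution is an exponential without zeros, so if its outer part
    -- vanished, the half line `(b, ∞)` would be a null set.
    have h1 : ∀ᵐ y, ¬ b < y := by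
      filter_upwards [h0, coeFn_mulL (stepOutside b) (H1.fn G0), coeFn_stepOutside b, hfn]
        with y h1 h2 h3 h4 hy
      have h2' : outer b (H1.fn G0) y = stepOutside b y * H1.fn G0 y := h2
      rw [h2', h3, h4] at h1
      have hy0 : 0 < y := hb.trans hy
      simp [hg, extend, glue, hy0, hy.le, not_lt.2 hy.le, abs_of_pos] at h1
    have h2 : volume (Ioi b) = 0 := by
      rw [ae_iff] at h1
      simpa [Ioi] using h1
    simp at h2

/-! ### Lax-Milgram and rank one perturbations -/

/-- The form `∫ φ'ψ' + p ∫_{|y|<b} φψ + q ∫_{|y|≥b} φψ` as a bounded bilinear form. -/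
def stepBilin (b p q : ℝ) : H1 →L[ℝ] H1 →L[ℝ] ℝ :=
  (innerSL ℝ).bilinearComp H1.der H1.der
    + p • (innerSL ℝ).bilinearComp (H1.fn - (outer b).comp H1.fn) H1.fn
    + q • (innerSL ℝ).bilinearComp ((outer b).comp H1.fn) H1.fn

theorem stepBilin_apply (b p q : ℝ) (φ ψ : H1) :
    stepBilin b p q φ ψ = stepForm b p q 0 φ ψ := by
  simp [stepBilin, stepForm, inner_sub_left]

theorem isCoercive_stepBilin (b : ℝ) {p q : ℝ} (hp : 0 < p) (hq : 0 < q) :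
    IsCoercive (stepBilin b p q) := by
  set m := min p q with hm
  have hm0 : 0 < m := lt_min hp hq
  refine ⟨min 1 m, by positivity, fun φ => ?_⟩
  rw [stepBilin_apply]
  refine le_trans ?_ (le_stepForm_self b (min_le_left p q) (min_le_right p q) φ)
  rw [mul_assoc, ← sq, H1.norm_sq_eq, mul_add]
  have h1 : min 1 m * ‖H1.fn φ‖ ^ 2 ≤ m * ‖H1.fn φ‖ ^ 2 := by gcongr; exact min_le_right _ _
  have h2 : min 1 m * ‖H1.der φ‖ ^ 2 ≤ 1 * ‖H1.der φ‖ ^ 2 := by gcongr; exact min_le_left _ _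
  linarith

/-- The functional `ψ ↦ ∫ fψ` is represented in `H¹` by the adjoint of the embedding `H¹ ⊂ L²`, to
which the inverse of the Lax-Milgram operator applies. -/
theorem exists_laxMilgram (b : ℝ) {p q : ℝ} (hp : 0 < p) (hq : 0 < q) :
    ∃ T : L2 →L[ℝ] H1, ∀ f ψ, stepForm b p q 0 (T f) ψ = inner ℝ f (H1.fn ψ) := by
  set A := (isCoercive_stepBilin b hp hq).continuousLinearEquivOfBilin with hA
  refine ⟨(A.symm : H1 →L[ℝ] H1).comp (ContinuousLinearMap.adjoint H1.fn), fun f ψ => ?_⟩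
  rw [← stepBilin_apply, ← IsCoercive.continuousLinearEquivOfBilin_apply
    (isCoercive_stepBilin b hp hq), ← hA]
  simp [ContinuousLinearMap.adjoint_inner_left]

theorem eq_zero_of_stepForm_self {b p q : ℝ} (hp : 0 < p) (hq : 0 < q) {φ : H1}
    (h : stepForm b p q 0 φ φ = 0) : φ = 0 := by
  have h1 := le_stepForm_self b (min_le_left p q) (min_le_right p q) φ
  have hm0 : 0 < min p q := lt_min hp hq
  have h2 : ‖H1.fn φ‖ ^ 2 = 0 := by
    by_contra hne
    have : 0 < ‖H1.fn φ‖ ^ 2 := lt_of_le_of_ne (by positivity) (Ne.symm hne)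
    have := mul_pos hm0 this
    nlinarith [sq_nonneg ‖H1.der φ‖]
  apply H1.fn_injective
  rw [map_zero]
  simpa using h2

/-- `G` is the fundamental solution of `-φ'' + (p 1_{|y|<b} + q 1_{|y|≥b}) φ`. -/
def IsGreen (b p q : ℝ) (G : H1) : Prop := ∀ ψ : H1, stepForm b p q 0 G ψ = delta0 ψ

/-- Moved to the right-hand side, the delta term is a source `κφ(0)δ₀`, and `G` is the response to
`δ₀`. Uniqueness for the coercive form does the rest. -/
theorem IsGreen.eq_add {b p q κ : ℝ} (hp : 0 < p) (hq : 0 < q) {G : H1} (hG : IsGreen b p q G)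
    {φ g : H1} {f : L2} (hφ : ∀ ψ, stepForm b p q κ φ ψ = inner ℝ f (H1.fn ψ))
    (hg : ∀ ψ, stepForm b p q 0 g ψ = inner ℝ f (H1.fn ψ)) : φ = g + (κ * delta0 φ) • G := by
  have h : ∀ ψ, stepForm b p q 0 (φ - (g + (κ * delta0 φ) • G)) ψ = 0 := by
    intro ψ
    rw [stepForm_sub, stepForm_add, stepForm_smul, hG ψ, hg ψ, ← hφ ψ, stepForm_delta b p q κ]
    ring
  exact sub_eq_zero.1 (eq_zero_of_stepForm_self hp hq (h _))

theorem IsGreen.eq_smul_of_ker {b p q κ : ℝ} (hp : 0 < p) (hq : 0 < q) {G : H1}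
    (hG : IsGreen b p q G) {φ : H1} (hφ : ∀ ψ, stepForm b p q κ φ ψ = 0) :
    φ = (κ * delta0 φ) • G := by
  have := hG.eq_add hp hq (φ := φ) (g := 0) (f := 0) (κ := κ) (by simpa using hφ) fun ψ => by
    simp [stepForm]
  simpa using this

/-- A kernel element equals `κφ(0)G`. Evaluation at 0 gives `φ(0)(1 - κG(0)) = 0`. -/
theorem IsGreen.eq_zero_of_ker {b p q κ : ℝ} (hp : 0 < p) (hq : 0 < q) {G : H1}
    (hG : IsGreen b p q G) (hκ : κ * delta0 G ≠ 1) {φ : H1}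
    (hφ : ∀ ψ, stepForm b p q κ φ ψ = 0) : φ = 0 := by
  have h1 := hG.eq_smul_of_ker hp hq hφ
  have h2 := congrArg delta0 h1
  rw [map_smul, smul_eq_mul] at h2
  have h3 : delta0 φ * (1 - κ * delta0 G) = 0 := by linarith
  rcases mul_eq_zero.1 h3 with h | h
  · rw [h1, h]
    simp
  · exact absurd (by linarith) hκ

theorem IsGreen.stepForm_eq_zero {b p q κ : ℝ} {G : H1} (hG : IsGreen b p q G)
    (hκ : κ * delta0 G = 1) (ψ : H1) : stepForm b p q κ G ψ = 0 := by
  rw [stepForm_delta, hG ψ, ← mul_assoc, hκ]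
  ring

/-- Evaluating `φ = g + κφ(0)G` at 0 gives `φ(0) = g(0)/(1 - κG(0))`; substituting this back is the
rank one correction of the coercive inverse. -/
theorem IsGreen.exists_inverse {b p q κ : ℝ} (hp : 0 < p) (hq : 0 < q) {G : H1}
    (hG : IsGreen b p q G) (hκ : κ * delta0 G ≠ 1) :
    ∃ S : L2 →L[ℝ] H1, ∀ f ψ, stepForm b p q κ (S f) ψ = inner ℝ f (H1.fn ψ) := by
  obtain ⟨T, hT⟩ := exists_laxMilgram b hp hq
  refine ⟨T + ((κ / (1 - κ * delta0 G)) • delta0.comp T).smulRight G, fun f ψ => ?_⟩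
  have hne : 1 - κ * delta0 G ≠ 0 := fun h => hκ (by linarith)
  simp only [add_apply, ContinuousLinearMap.smulRight_apply, smul_apply,
    ContinuousLinearMap.comp_apply, smul_eq_mul]
  rw [stepForm_delta, stepForm_add, stepForm_smul, hT, hG ψ, map_add, map_smul, smul_eq_mul]
  field_simp
  ring

/-- When the form is positive and `c > 0`, the left side is nonnegative, so `G(0)` drops strictly
when `c` is added to the potential. A resonance `κG(0) = 1` is thus destroyed by a further shift. -/
theorem IsGreen.delta0_sub {b p q c : ℝ} {G G' : H1}
    (hG : IsGreen b p q G) (hG' : IsGreen b (p + c) (q + c) G') :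
    stepForm b p q 0 (G' - G) (G' - G) = delta0 G - delta0 G' - c * ‖H1.fn G'‖ ^ 2 := by
  have h1 := hG' G'
  rw [stepForm_shift, real_inner_self_eq_norm_sq] at h1
  rw [stepForm_sub, stepForm_comm b p q 0 G', stepForm_sub, hG (G' - G), map_sub]
  rw [stepForm_comm b p q 0 G G', stepForm_comm b p q 0 G' G, hG G']
  linarith

theorem exists_isGreen {b p q : ℝ} (hb : 0 < b) (hp : 0 < p) (hq : 0 < q) :
    ∃ G : H1, IsGreen b p q G ∧ delta0 G = greenValue b (√p) (√q) ∧ outer b (H1.fn G) ≠ 0 := by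
  have h := exists_green hb (Real.sqrt_pos.2 hp) (Real.sqrt_pos.2 hq)
  rwa [Real.sq_sqrt hp.le, Real.sq_sqrt hq.le] at h

/-- Some shift of the operator is invertible. -/
theorem exists_shift {b : ℝ} (hb : 0 < b) (p q κ : ℝ) : ∃ c : ℝ, ∃ S : L2 →L[ℝ] H1,
    (∀ f ψ, stepForm b (p + c) (q + c) κ (S f) ψ = inner ℝ f (H1.fn ψ)) ∧
    ∀ φ, (∀ ψ, stepForm b (p + c) (q + c) κ φ ψ = 0) → φ = 0 := by
  -- This shift makes both constants positive whatever their signs. If it happens to be resonant, `c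
  -- + 1` is not.
  set c := 1 + |p| + |q| with hc
  have hp : 0 < p + c := by linarith [neg_abs_le p, abs_nonneg q]
  have hq : 0 < q + c := by linarith [neg_abs_le q, abs_nonneg p]
  have hp' : 0 < p + (c + 1) := by linarith
  have hq' : 0 < q + (c + 1) := by linarith
  obtain ⟨G, hG, -, -⟩ := exists_isGreen hb hp hq
  obtain ⟨G', hG', -, hne⟩ := exists_isGreen hb hp' hq'
  by_cases hκ : κ * delta0 G = 1
  · refine ⟨c + 1, ?_⟩
    have hκ' : κ * delta0 G' ≠ 1 := by
      intro h
      have hκ0 : κ ≠ 0 := by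
        rintro rfl
        simp at h
      have h1 : delta0 G = delta0 G' := mul_left_cancel₀ hκ0 (hκ.trans h.symm)
      have hG'' : IsGreen b (p + c + 1) (q + c + 1) G' := by
        rwa [add_assoc p, add_assoc q]
      have h2 := hG.delta0_sub hG''
      have h3 := le_stepForm_self b (min_le_left (p + c) (q + c)) (min_le_right _ _) (G' - G)
      have h4 : 0 < min (p + c) (q + c) := lt_min hp hq
      have h5 : 0 < ‖H1.fn G'‖ := by
        rw [norm_pos_iff]
        intro h0
        rw [h0, map_zero] at hne
        exact hne rfl
      have h6 : 0 ≤ min (p + c) (q + c) * ‖H1.fn (G' - G)‖ ^ 2 := by positivity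
      nlinarith [sq_nonneg ‖H1.der (G' - G)‖, sq_pos_of_pos h5]
    obtain ⟨S, hS⟩ := hG'.exists_inverse hp' hq' hκ'
    exact ⟨S, hS, fun φ hφ => hG'.eq_zero_of_ker hp' hq' hκ' hφ⟩
  · obtain ⟨S, hS⟩ := hG.exists_inverse hp hq hκ
    exact ⟨c, S, hS, fun φ hφ => hG.eq_zero_of_ker hp hq hκ hφ⟩

/-- The a priori estimate in the strongly attractive regime. -/
theorem IsGreen.estimate {b p q κ m : ℝ} (hm : 0 < m) (hp : m ≤ p) (hq : m ≤ q) {G : H1}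
    (hG : IsGreen b p q G) (hκ0 : 0 ≤ κ) (hκ : 2 ≤ κ * delta0 G) {φ : H1} {f : L2}
    (hφ : ∀ ψ, stepForm b p q κ φ ψ = inner ℝ f (H1.fn ψ)) :
    ‖H1.fn φ‖ ≤ ‖f‖ / m ∧ ‖H1.der φ‖ ≤ ‖f‖ / √m := by
  have hp0 : 0 < p := hm.trans_le hp
  have hq0 : 0 < q := hm.trans_le hq
  obtain ⟨T, hT⟩ := exists_laxMilgram b hp0 hq0
  set g := T f with hg
  have e1 := hG.eq_add hp0 hq0 hφ (hT f)
  rw [← hg] at e1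
  set t := κ * delta0 φ with ht
  have e2 : delta0 φ = delta0 g + t * delta0 G := by
    conv_lhs => rw [e1]
    rw [map_add, map_smul, smul_eq_mul]
  have e3 : stepForm b p q 0 φ φ = stepForm b p q 0 g g + 2 * t * delta0 g + t ^ 2 * delta0 G := by
    conv_lhs => rw [e1]
    rw [stepForm_add, stepForm_smul, hG (g + t • G), stepForm_comm b p q 0 g (g + t • G),
      stepForm_add, stepForm_smul, hG g, map_add, map_smul, smul_eq_mul]
    ring
  have e4 : t = κ * delta0 g + κ * delta0 G * t := by
    have h1 : t = κ * (delta0 g + t * delta0 G) := by rw [← e2]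
    linarith
  -- The energy gained by adding `tG` to `g` is not positive. By `e4`, `κg(0) = t(1 - κG(0))`, so
  -- `κ` times this gain equals `t²(2 - κG(0))`; this is where the threshold 2 comes from.
  have e5 : 2 * t * delta0 g + t ^ 2 * delta0 G ≤ 0 := by
    have hκpos : 0 < κ := lt_of_le_of_ne hκ0 fun h => by rw [← h] at hκ; norm_num at hκ
    have h1 : κ * (2 * t * delta0 g + t ^ 2 * delta0 G) = t ^ 2 * (2 - κ * delta0 G) := by
      have h2 : κ * delta0 g = t - κ * delta0 G * t := by linarith
      calc κ * (2 * t * delta0 g + t ^ 2 * delta0 G)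
          = 2 * t * (κ * delta0 g) + t ^ 2 * (κ * delta0 G) := by ring
        _ = t ^ 2 * (2 - κ * delta0 G) := by rw [h2]; ring
    have h3 : t ^ 2 * (2 - κ * delta0 G) ≤ 0 :=
      mul_nonpos_of_nonneg_of_nonpos (sq_nonneg _) (by linarith)
    by_contra hcon
    have := mul_pos hκpos (not_le.1 hcon)
    linarith
  have e6 : stepForm b p q 0 g g ≤ ‖f‖ * ‖H1.fn g‖ := by
    rw [hT f g]
    exact real_inner_le_norm _ _
  have e7 := le_stepForm_self b hp hq g
  have e8 : m * ‖H1.fn g‖ ≤ ‖f‖ := by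
    rcases eq_or_lt_of_le (norm_nonneg (H1.fn g)) with h | h
    · rw [← h]
      simp
    · refine le_of_mul_le_mul_right ?_ h
      nlinarith [sq_nonneg ‖H1.der g‖]
  have e9 : stepForm b p q 0 φ φ ≤ ‖f‖ ^ 2 / m := by
    rw [le_div_iff₀ hm]
    have : ‖f‖ * ‖H1.fn g‖ * m ≤ ‖f‖ ^ 2 := by nlinarith [norm_nonneg f]
    nlinarith
  have e10 := le_stepForm_self b hp hq φ
  constructor
  · rw [le_div_iff₀ hm]
    refine le_of_sq_le_sq ?_ (norm_nonneg f)
    rw [le_div_iff₀ hm] at e9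
    nlinarith [sq_nonneg ‖H1.der φ‖]
  · refine le_of_sq_le_sq ?_ (by positivity)
    rw [div_pow, Real.sq_sqrt hm.le]
    have : 0 ≤ m * ‖H1.fn φ‖ ^ 2 := by positivity
    linarith

/-- The orthogonal projection of `L²` onto the line spanned by `g`. -/
def lineProj (g : L2) : L2 →L[ℝ] L2 := ((‖g‖ ^ 2)⁻¹ • innerSL ℝ g).smulRight g

theorem lineProj_apply (g f : L2) : lineProj g f = ((‖g‖ ^ 2)⁻¹ * inner ℝ g f) • g := rfl

theorem inner_lineProj {g : L2} (hg : g ≠ 0) (f : L2) : inner ℝ g (lineProj g f) = inner ℝ g f := by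
  have : ‖g‖ ≠ 0 := norm_ne_zero_iff.2 hg
  rw [lineProj_apply, inner_smul_right, real_inner_self_eq_norm_sq]
  field_simp

theorem lineProj_self {g : L2} (hg : g ≠ 0) : lineProj g g = g := by
  have : ‖g‖ ≠ 0 := norm_ne_zero_iff.2 hg
  rw [lineProj_apply, real_inner_self_eq_norm_sq, inv_mul_cancel₀ (by positivity), one_smul]

theorem lineProj_eq_of_inner_eq {g f f' : L2} (h : inner ℝ g f = inner ℝ g f') :
    lineProj g f = lineProj g f' := by
  rw [lineProj_apply, lineProj_apply, h]

/-- The inverse of `L + P` in the resonant case, where `P` is the projection on the kernel. -/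
theorem IsGreen.exists_bordered_inverse {b p q κ : ℝ} (hp : 0 < p) (hq : 0 < q) {G : H1}
    (hG : IsGreen b p q G) (hκ : κ * delta0 G = 1) :
    ∃ R : L2 →L[ℝ] H1,
      (∀ f ψ, stepForm b p q κ (R f) ψ = inner ℝ (f - lineProj (H1.fn G) f) (H1.fn ψ)) ∧
      (∀ f, lineProj (H1.fn G) (H1.fn (R f)) = lineProj (H1.fn G) f) ∧ R (H1.fn G) = G := by
  obtain ⟨T, hT⟩ := exists_laxMilgram b hp hq
  have hG0 : H1.fn G ≠ 0 := by
    intro h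
    have : G = 0 := H1.fn_injective (by rw [h, map_zero])
    rw [this, map_zero, mul_zero] at hκ
    norm_num at hκ
  have hn : ‖H1.fn G‖ ≠ 0 := norm_ne_zero_iff.2 hG0
  set P := lineProj (H1.fn G) with hP
  set Q : L2 →L[ℝ] L2 := ContinuousLinearMap.id ℝ L2 - P with hQ
  have hQa : ∀ f, Q f = f - P f := fun f => rfl
  set U : L2 →L[ℝ] H1 := T.comp Q with hU
  -- The coefficient of the kernel direction, fixed by requiring that `Rf` and `f` have the same
  -- projection on `G`.
  set c : L2 →L[ℝ] ℝ := (‖H1.fn G‖ ^ 2)⁻¹ • (innerSL ℝ (H1.fn G)).comp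
    (ContinuousLinearMap.id ℝ L2 - H1.fn.comp U) with hc
  have hca : ∀ f, c f = (‖H1.fn G‖ ^ 2)⁻¹ * inner ℝ (H1.fn G) (f - H1.fn (U f)) := fun f => rfl
  -- In the coercive form, pairing with `G` is evaluation at 0, while the source `Qf` is orthogonal
  -- to `G`. Hence `TQf` vanishes at 0, and the delta does not act on it.
  have hδ : ∀ f, delta0 (U f) = 0 := by
    intro f
    rw [← hG (U f), stepForm_comm]
    change stepForm b p q 0 (T (Q f)) G = 0
    rw [hT, hQa, inner_sub_left, real_inner_comm, real_inner_comm _ (P f), hP,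
      inner_lineProj hG0, sub_self]
  refine ⟨U + c.smulRight G, fun f ψ => ?_, fun f => ?_, ?_⟩
  · simp only [add_apply, ContinuousLinearMap.smulRight_apply]
    rw [stepForm_add, stepForm_smul, hG.stepForm_eq_zero hκ, mul_zero, add_zero, stepForm_delta,
      hδ, ← hQa]
    change stepForm b p q 0 (T (Q f)) ψ - _ = _
    rw [hT]
    ring
  · apply lineProj_eq_of_inner_eq
    simp only [add_apply, ContinuousLinearMap.smulRight_apply, map_add, map_smul, inner_add_right,
      inner_smul_right, real_inner_self_eq_norm_sq, hca, inner_sub_right]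
    field_simp
    ring
  · have h1 : U (H1.fn G) = 0 := by
      change T (Q (H1.fn G)) = 0
      rw [hQa, hP, lineProj_self hG0, sub_self, map_zero]
    simp only [add_apply, ContinuousLinearMap.smulRight_apply, hca, h1, map_zero, sub_zero,
      real_inner_self_eq_norm_sq, zero_add]
    rw [inv_mul_cancel₀ (by positivity), one_smul]

/-! ### Self-adjointness and resolvents of unbounded operators -/

section Abstract

variable {H : Type*} [NormedAddCommGroup H]

/-- The hypotheses say that `T + c` has the bounded symmetric inverse `R`, so `T` inherits
self-adjointness from `R`. -/
theorem isSelfAdjoint_of_shifted_inverse [InnerProductSpace ℝ H] [CompleteSpace H]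
    {T : H →ₗ.[ℝ] H} (c : ℝ) (R : H →L[ℝ] H)
    (h1 : ∀ f, (R f, f - c • R f) ∈ T.graph) (h2 : ∀ p ∈ T.graph, R (p.2 + c • p.1) = p.1)
    (hs : ∀ f g, inner ℝ (R f) g = inner ℝ f (R g)) : IsSelfAdjoint T := by
  have hinj : ∀ f, R f = 0 → f = 0 := by
    intro f hf
    have := T.graph_fst_eq_zero_snd (h1 f) hf
    simpa [hf] using this
  have hd : Dense (T.domain : Set H) := by
    rw [Submodule.dense_iff_topologicalClosure_eq_top,
      Submodule.topologicalClosure_eq_top_iff, Submodule.eq_bot_iff]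
    intro g hg
    apply hinj
    -- Testing orthogonality to the domain with `R(Rg)` gives `‖Rg‖² = 0` by symmetry.
    have h3 : R (R g) ∈ T.domain := LinearPMap.mem_domain_of_mem_graph (h1 (R g))
    have h4 := (Submodule.mem_orthogonal _ g).1 hg _ h3
    rw [hs] at h4
    exact inner_self_eq_zero.1 h4
  rw [LinearPMap.isSelfAdjoint_def]
  apply LinearPMap.eq_of_eq_graph
  rw [LinearPMap.adjoint_graph_eq_graph_adjoint hd]
  ext ⟨x, y⟩
  rw [Submodule.mem_adjoint_iff]
  constructor
  · intro h
    -- The adjoint relation on the graph points `(Rf, f - cRf)`, with `f` arbitrary, identifies `x`.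
    have h3 : x = R (y + c • x) := by
      rw [← sub_eq_zero]
      refine ext_inner_left ℝ fun f => ?_
      have h4 := h _ _ (h1 f)
      simp only [inner_sub_left, inner_smul_left, RCLike.conj_to_real] at h4
      rw [inner_zero_right, inner_sub_right, ← hs, inner_add_right, inner_smul_right]
      linarith
    have h4 := h1 (y + c • x)
    rw [← h3] at h4
    simpa using h4
  · intro h a d had
    have h3 := h2 _ had
    have h4 := h2 _ h
    simp only at h3 h4 ⊢
    have h5 := hs (d + c • a) (y + c • x)
    rw [h3, h4, inner_add_left, inner_add_right, inner_smul_left, inner_smul_right,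
      RCLike.conj_to_real] at h5
    linarith

variable [NormedSpace ℝ H]

theorem apply_eq_of_mem_graph {T : H →ₗ.[ℝ] H} {u f : H} (h : (u, f) ∈ T.graph) :
    ∃ hu : u ∈ T.domain, T ⟨u, hu⟩ = f := by
  obtain ⟨v, hv, hf⟩ := LinearPMap.mem_graph_iff _ |>.1 h
  simp only at hv hf
  subst hv
  exact ⟨v.2, hf⟩

/-- A bounded right inverse of an injective map is also a left inverse: `h1` gives the former and
`h2` the injectivity. -/
theorem mem_resolventSet_of_graph {T : H →ₗ.[ℝ] H} {μ : ℂ} (R : H × H →L[ℝ] H × H)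
    (h1 : ∀ f g, ((R (f, g)).1, μ.re • (R (f, g)).1 - μ.im • (R (f, g)).2 - f) ∈ T.graph ∧
      ((R (f, g)).2, μ.re • (R (f, g)).2 + μ.im • (R (f, g)).1 - g) ∈ T.graph)
    (h2 : ∀ u v u' v', (u, u') ∈ T.graph → (v, v') ∈ T.graph →
      μ.re • u - μ.im • v - u' = 0 → μ.re • v + μ.im • u - v' = 0 → u = 0 ∧ v = 0) :
    μ ∈ resolventSet T := by
  have h3 : ∀ f g : H, ∃ u v : T.domain, R (f, g) = ((u : H), (v : H)) ∧
      μ.re • (u : H) - μ.im • (v : H) - T u = f ∧ μ.re • (v : H) + μ.im • (u : H) - T v = g := by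
    intro f g
    obtain ⟨hu, eu⟩ := apply_eq_of_mem_graph (h1 f g).1
    obtain ⟨hv, ev⟩ := apply_eq_of_mem_graph (h1 f g).2
    refine ⟨⟨_, hu⟩, ⟨_, hv⟩, rfl, ?_, ?_⟩
    · rw [eu]; abel
    · rw [ev]; abel
  refine ⟨R, h3, fun u v => ?_⟩
  obtain ⟨u', v', e1, e2, e3⟩ := h3 (μ.re • (u : H) - μ.im • (v : H) - T u)
    (μ.re • (v : H) + μ.im • (u : H) - T v)
  rw [e1]
  have h4 := h2 _ _ _ _ (T.mem_graph (u' - u)) (T.mem_graph (v' - v))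
    (by
      rw [T.map_sub, ← sub_eq_zero.2 e2]
      push_cast
      module)
    (by
      rw [T.map_sub, ← sub_eq_zero.2 e3]
      push_cast
      module)
  push_cast at h4
  rw [sub_eq_zero.1 h4.1, sub_eq_zero.1 h4.2]

theorem zero_mem_resolventSet {T : H →ₗ.[ℝ] H} (R : H →L[ℝ] H)
    (h1 : ∀ f, (R f, f) ∈ T.graph) (h2 : ∀ u, (u, (0 : H)) ∈ T.graph → u = 0) :
    (0 : ℂ) ∈ resolventSet T := by
  refine mem_resolventSet_of_graph (-(R.prodMap R)) (fun f g => ?_) fun u v u' v' hu hv e1 e2 => ?_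
  · constructor
    · have := T.graph.neg_mem (h1 f)
      simpa using this
    · have := T.graph.neg_mem (h1 g)
      simpa using this
  · simp only [Complex.zero_re, Complex.zero_im, zero_smul, sub_zero, zero_sub, neg_eq_zero,
      add_zero] at e1 e2
    subst e1 e2
    exact ⟨h2 _ hu, h2 _ hv⟩

/-- Multiplication by a complex number on the complexification `H × H`. -/
def complexSmul (μ : ℂ) : H × H →L[ℝ] H × H :=
  (μ.re • ContinuousLinearMap.fst ℝ H H - μ.im • ContinuousLinearMap.snd ℝ H H).prod
    (μ.re • ContinuousLinearMap.snd ℝ H H + μ.im • ContinuousLinearMap.fst ℝ H H)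

theorem complexSmul_apply (μ : ℂ) (p : H × H) :
    complexSmul μ p = (μ.re • p.1 - μ.im • p.2, μ.re • p.2 + μ.im • p.1) := rfl

theorem complexSmul_mul (μ ν : ℂ) (p : H × H) :
    complexSmul μ (complexSmul ν p) = complexSmul (μ * ν) p := by
  simp only [complexSmul_apply, Complex.mul_re, Complex.mul_im]
  ext <;> module

theorem complexSmul_one (p : H × H) : complexSmul 1 p = p := by
  simp [complexSmul_apply]

theorem norm_complexSmul_le (μ : ℂ) : ‖(complexSmul μ : H × H →L[ℝ] H × H)‖ ≤ 2 * ‖μ‖ := by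
  refine ContinuousLinearMap.opNorm_le_bound _ (by positivity) fun p => ?_
  have h1 := Complex.abs_re_le_norm μ
  have h2 := Complex.abs_im_le_norm μ
  have h3 := norm_fst_le p
  have h4 := norm_snd_le p
  have key : ∀ (x y : ℝ) (a c : H), |x| ≤ ‖μ‖ → |y| ≤ ‖μ‖ → ‖a‖ ≤ ‖p‖ → ‖c‖ ≤ ‖p‖ →
      ‖x • a‖ + ‖y • c‖ ≤ 2 * ‖μ‖ * ‖p‖ := by
    intro x y a c hx hy ha hc
    rw [norm_smul, norm_smul, Real.norm_eq_abs, Real.norm_eq_abs]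
    have e1 : |x| * ‖a‖ ≤ ‖μ‖ * ‖p‖ := by gcongr
    have e2 : |y| * ‖c‖ ≤ ‖μ‖ * ‖p‖ := by gcongr
    linarith
  rw [complexSmul_apply, Prod.norm_def]
  refine max_le ((norm_sub_le _ _).trans ?_) ((norm_add_le _ _).trans ?_)
  · exact key _ _ _ _ h1 h2 h3 h4
  · exact key _ _ _ _ h1 h2 h4 h3

/-- If zero is an eigenvalue and `T + P` is boundedly invertible for a projection `P` onto the
kernel that commutes with `T`, then zero is isolated in the spectrum. -/
theorem exists_punctured_resolventSet [CompleteSpace H] {T : H →ₗ.[ℝ] H} (R P : H →L[ℝ] H)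
    (hR : ∀ f, (R f, f - P f) ∈ T.graph) (hRP : ∀ p ∈ T.graph, R (p.2 + P p.1) = p.1)
    (hPR : ∀ f, P (R f) = P f) (hPP : ∀ f, P (P f) = P f) (hP : ∀ f, (P f, (0 : H)) ∈ T.graph)
    (hPT : ∀ p ∈ T.graph, P p.2 = 0) :
    ∃ δ > 0, ∀ μ : ℂ, 0 < ‖μ‖ → ‖μ‖ < δ → μ ∈ resolventSet T := by
  set R2 : H × H →L[ℝ] H × H := R.prodMap R with hR2
  set P2 : H × H →L[ℝ] H × H := P.prodMap P with hP2
  have hcommP : ∀ (μ : ℂ) p, P2 (complexSmul μ p) = complexSmul μ (P2 p) := by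
    intro μ p
    simp [hP2, complexSmul_apply]
  have hPR2 : ∀ p, P2 (R2 p) = P2 p := fun p => Prod.ext (hPR p.1) (hPR p.2)
  have hPP2 : ∀ p, P2 (P2 p) = P2 p := fun p => Prod.ext (hPP p.1) (hPP p.2)
  -- Multiplication by `μ` has norm at most `2‖μ‖` in the maximum norm of the product, so this
  -- radius gives `‖μR‖ ≤ 1/2`. It is at most 1/4, which also excludes `μ = 1`.
  refine ⟨(4 * (‖R2‖ + 1))⁻¹, by positivity, fun μ hμ0 hμ => ?_⟩
  have hμne : μ ≠ 0 := norm_pos_iff.1 hμ0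
  have hμ1 : μ - 1 ≠ 0 := by
    intro h
    rw [sub_eq_zero] at h
    rw [h, norm_one, lt_inv_comm₀ one_pos (by positivity)] at hμ
    linarith [norm_nonneg R2]
  set A : H × H →L[ℝ] H × H := R2.comp (complexSmul μ) with hA
  have hAn : ‖A‖ < 1 := by
    calc ‖A‖ ≤ ‖R2‖ * ‖(complexSmul μ : H × H →L[ℝ] H × H)‖ :=
          ContinuousLinearMap.opNorm_comp_le _ _
      _ ≤ ‖R2‖ * (2 * ‖μ‖) := by gcongr; exact norm_complexSmul_le μ
      _ ≤ (‖R2‖ + 1) * (2 * (4 * (‖R2‖ + 1))⁻¹) := by gcongr; linarith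
      _ < 1 := by
        rw [mul_inv]
        field_simp
        norm_num
  set W : (H × H →L[ℝ] H × H)ˣ := Units.oneSub A hAn with hW
  have hW1 : ∀ p, ((W⁻¹ : (H × H →L[ℝ] H × H)ˣ) : H × H →L[ℝ] H × H) p -
      A (((W⁻¹ : (H × H →L[ℝ] H × H)ˣ) : H × H →L[ℝ] H × H) p) = p := by
    intro p
    have h := congrArg (fun B : H × H →L[ℝ] H × H => B p) W.mul_inv
    simpa [hW, mul_apply_eq_comp] using h
  have hW2 : ∀ p, p = A p → p = 0 := by
    intro p hp
    have h := congrArg (fun B : H × H →L[ℝ] H × H => B p) W.inv_mul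
    simp only [mul_apply_eq_comp, one_apply_eq_self] at h
    have h3 : (W : H × H →L[ℝ] H × H) p = 0 := by
      simp [hW, ← hp]
    rw [h3, map_zero] at h
    exact h.symm
  set Winv := ((W⁻¹ : (H × H →L[ℝ] H × H)ˣ) : H × H →L[ℝ] H × H) with hWinv
  have hRgraph : ∀ p : H × H, ((R2 p).1, (p - P2 p).1) ∈ T.graph ∧
      ((R2 p).2, (p - P2 p).2) ∈ T.graph := fun p => ⟨hR p.1, hR p.2⟩
  have hPgraph : ∀ p : H × H, ((P2 p).1, (0 : H)) ∈ T.graph ∧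
      ((P2 p).2, (0 : H)) ∈ T.graph := fun p => ⟨hP p.1, hP p.2⟩
  have hfix : ∀ p, P2 p = complexSmul μ (P2 p) → P2 p = 0 := by
    intro p hp
    have h1 : complexSmul (μ - 1) (P2 p) = 0 := by
      have : complexSmul (μ - 1) (P2 p) = complexSmul μ (P2 p) - P2 p := by
        simp only [complexSmul_apply, Complex.sub_re, Complex.sub_im, Complex.one_re,
          Complex.one_im]
        ext
        · simp only [Prod.fst_sub]; module
        · simp only [Prod.snd_sub]; module
      rw [this, ← hp, sub_self]
    have h2 := complexSmul_mul (μ - 1)⁻¹ (μ - 1) (P2 p)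
    rw [h1, inv_mul_cancel₀ hμ1, complexSmul_one, map_zero] at h2
    exact h2.symm
  -- The resolvent is `μ⁻¹P - (1 - μR)⁻¹R(1 - P)`: division by `μ` on the kernel, and a Neumann
  -- series on its complement.
  refine mem_resolventSet_of_graph ((complexSmul μ⁻¹).comp P2 -
    Winv.comp (R2.comp (ContinuousLinearMap.id ℝ _ - P2))) (fun f g => ?_)
    fun u v u' v' hu hv e1 e2 => ?_
  · set F : H × H := (f, g) with hF
    set w := Winv (R2 (F - P2 F)) with hw
    have e0 : w = R2 (complexSmul μ w + (F - P2 F)) := by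
      have := hW1 (R2 (F - P2 F))
      rw [← hw] at this
      rw [map_add, ← this]
      simp [hA]
    -- From `PR = P` and the equation for `w` one gets `Pw = μPw`, and `μ ≠ 1`.
    have e1 : P2 w = 0 := by
      apply hfix
      conv_lhs => rw [e0]
      rw [hPR2, map_add, map_sub, hPP2, sub_self, add_zero, hcommP]
    set q := complexSmul μ w + (F - P2 F) with hq
    have e2 : P2 q = 0 := by rw [← hPR2, ← e0, e1]
    have e3 := hRgraph q
    rw [← e0, e2, sub_zero] at e3
    have e4 := hPgraph (complexSmul μ⁻¹ F)
    rw [hcommP] at e4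
    have e5 : ((complexSmul μ⁻¹).comp P2 -
        Winv.comp (R2.comp (ContinuousLinearMap.id ℝ (H × H) - P2))) F = complexSmul μ⁻¹ (P2 F) - w := rfl
    have e6 : complexSmul μ (complexSmul μ⁻¹ (P2 F) - w) - F = -q := by
      rw [map_sub, complexSmul_mul, mul_inv_cancel₀ hμne, complexSmul_one, hq]
      abel
    rw [e5]
    have e7 := congrArg Prod.fst e6
    have e8 := congrArg Prod.snd e6
    simp only [complexSmul_apply μ, Prod.fst_sub, Prod.snd_sub, Prod.fst_neg, Prod.snd_neg] at e7 e8
    refine ⟨?_, ?_⟩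
    · have := T.graph.sub_mem e4.1 e3.1
      simp only [Prod.fst_sub, Prod.snd_sub]
      rw [e7]
      simpa using this
    · have := T.graph.sub_mem e4.2 e3.2
      simp only [Prod.fst_sub, Prod.snd_sub]
      rw [e8]
      simpa using this
  · set p : H × H := (u, v) with hp
    have e3 : complexSmul μ p = (u', v') := by
      rw [complexSmul_apply]
      exact Prod.ext (sub_eq_zero.1 e1) (sub_eq_zero.1 e2)
    have e4 : complexSmul μ (P2 p) = 0 := by
      rw [← hcommP, e3]
      exact Prod.ext (hPT _ hu) (hPT _ hv)
    have e5 : P2 p = 0 := by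
      have h2 := complexSmul_mul μ⁻¹ μ (P2 p)
      rw [e4, inv_mul_cancel₀ hμne, complexSmul_one, map_zero] at h2
      exact h2.symm
    have e6 : p = A p := by
      have h1 : R2 ((u', v') + P2 p) = p := Prod.ext (hRP _ hu) (hRP _ hv)
      rw [e5, add_zero, ← e3] at h1
      exact h1.symm
    have := hW2 p e6
    rw [hp, Prod.mk_eq_zero] at this
    exact this

end Abstract

/-! ### The operators with step potential -/

section Step

variable {b β α lam : ℝ} {k : ℕ}

theorem mem_schrodingerOp_graph {φ : H1} {f : L2} :
    (H1.fn φ, f) ∈ (schrodingerOp (stepOutside b) (stepDelta b β α) k lam).graph ↔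
      ∀ ψ, stepForm b (k ^ 2 * (1 - β)) (k ^ 2 * (1 - lam)) (k ^ 2 * α) φ ψ =
        inner ℝ f (H1.fn ψ) := by
  rw [schrodingerOp_graph]
  simp only [← schrodingerForm_eq_stepForm, inner_eq_integral]
  constructor
  · rintro ⟨χ, h1, h2⟩
    rwa [← H1.fn_injective h1]
  · intro h
    exact ⟨φ, rfl, h⟩

theorem exists_of_mem_schrodingerOp_graph {p : L2 × L2}
    (h : p ∈ (schrodingerOp (stepOutside b) (stepDelta b β α) k lam).graph) :
    ∃ φ : H1, H1.fn φ = p.1 ∧ ∀ ψ, stepForm b (k ^ 2 * (1 - β)) (k ^ 2 * (1 - lam)) (k ^ 2 * α) φ ψ =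
        inner ℝ p.2 (H1.fn ψ) := by
  have h' := h
  rw [schrodingerOp_graph] at h'
  obtain ⟨φ, h1, -⟩ := h'
  refine ⟨φ, h1, mem_schrodingerOp_graph.1 ?_⟩
  rwa [h1]

theorem inKernel_iff {φ : H1} : InKernel (stepOutside b) (stepDelta b β α) k lam φ ↔
    ∀ ψ, stepForm b (k ^ 2 * (1 - β)) (k ^ 2 * (1 - lam)) (k ^ 2 * α) φ ψ = 0 := by
  have h := mem_schrodingerOp_graph (b := b) (β := β) (α := α) (lam := lam) (k := k) (φ := φ)
    (f := 0)
  simp only [inner_zero_left] at h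
  rw [← h]
  constructor
  · rintro ⟨h1, h2⟩
    have := LinearPMap.mem_graph _ (⟨H1.fn φ, h1⟩ :
      (schrodingerOp (stepOutside b) (stepDelta b β α) k lam).domain)
    rwa [h2] at this
  · exact apply_eq_of_mem_graph

theorem isSelfAdjoint_schrodingerOp (hb : 0 < b) (β α lam : ℝ) (k : ℕ) :
    IsSelfAdjoint (schrodingerOp (stepOutside b) (stepDelta b β α) k lam) := by
  obtain ⟨c, S, hS, hS0⟩ := exists_shift hb (k ^ 2 * (1 - β)) (k ^ 2 * (1 - lam)) (k ^ 2 * α)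
  refine isSelfAdjoint_of_shifted_inverse c (H1.fn.comp S) (fun f => ?_) (fun p hp => ?_)
    fun f g => ?_
  · refine (mem_schrodingerOp_graph (φ := S f)).2 fun ψ => ?_
    have := hS f ψ
    rw [stepForm_shift] at this
    rw [inner_sub_left, inner_smul_left, RCLike.conj_to_real, ContinuousLinearMap.comp_apply]
    linarith
  · obtain ⟨φ, h1, h2⟩ := exists_of_mem_schrodingerOp_graph hp
    have h3 : S (p.2 + c • p.1) = φ := by
      rw [← sub_eq_zero]
      refine hS0 _ fun ψ => ?_
      rw [stepForm_sub, hS, stepForm_shift, h2, h1, inner_add_left, inner_smul_left,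
        RCLike.conj_to_real]
      ring
    rw [ContinuousLinearMap.comp_apply, h3, h1]
  · simp only [ContinuousLinearMap.comp_apply]
    rw [← hS f (S g), stepForm_comm, hS, real_inner_comm]

end Step

/-! ### The dispersion relation -/

/-- sinh is convex on the half line and vanishes at 0, so its graph lies below the chord from 0 to
`u`. -/
theorem mul_sinh_le {u v : ℝ} (hv : 0 ≤ v) (hvu : v ≤ u) :
    u * Real.sinh v ≤ v * Real.sinh u := by
  have hconv : ConvexOn ℝ (Ici 0) Real.sinh := by
    refine MonotoneOn.convexOn_of_deriv (convex_Ici 0) Real.continuous_sinh.continuousOn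
      Real.differentiable_sinh.differentiableOn ?_
    rw [Real.deriv_sinh, interior_Ici]
    intro x hx y hy hxy
    rw [Real.cosh_le_cosh, abs_of_pos hx, abs_of_pos hy]
    exact hxy
  rcases eq_or_lt_of_le (hv.trans hvu) with h | h
  · have hv0 : v = 0 := le_antisymm (hvu.trans h.ge) hv
    rw [hv0]
    simp
  · have h1 := hconv.2 (mem_Ici.2 h.le) (mem_Ici.2 (le_refl (0 : ℝ))) (div_nonneg hv h.le)
      (sub_nonneg.2 (div_le_one_of_le₀ hvu h.le)) (add_sub_cancel (v / u) 1)
    simp only [smul_eq_mul, mul_zero, add_zero, Real.sinh_zero] at h1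
    rw [div_mul_cancel₀ _ h.ne', div_mul_eq_mul_div, le_div_iff₀ h] at h1
    linarith

/-- The quantity that determines the value at zero of the fundamental solution. -/
def dispersion (b μ ν x : ℝ) : ℝ :=
  x * ((μ * Real.cosh (x * μ * b) + ν * Real.sinh (x * μ * b)) /
    (μ * Real.sinh (x * μ * b) + ν * Real.cosh (x * μ * b)))

section Dispersion

variable {b μ ν x : ℝ}

theorem dispersion_denom_pos (hb : 0 < b) (hμ : 0 < μ) (hν : 0 < ν) (hx : 0 ≤ x) :
    0 < μ * Real.sinh (x * μ * b) + ν * Real.cosh (x * μ * b) := by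
  have h1 : 0 ≤ Real.sinh (x * μ * b) := Real.sinh_nonneg_iff.2 (by positivity)
  have h2 := Real.cosh_pos (x * μ * b)
  positivity

theorem dispersion_pos (hb : 0 < b) (hμ : 0 < μ) (hν : 0 < ν) (hx : 0 < x) :
    0 < dispersion b μ ν x := by
  have h1 : 0 ≤ Real.sinh (x * μ * b) := Real.sinh_nonneg_iff.2 (by positivity)
  have h2 := Real.cosh_pos (x * μ * b)
  have h3 := dispersion_denom_pos hb hμ hν hx.le
  unfold dispersion
  positivity

/-- After cross-multiplication the inequality splits into the coefficients of `μ²`, `ν²` and `μν`.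
The first is `x tanh(yμb) ≤ y tanh(xμb)`, the only one that needs convexity; strictness comes from
the third. -/
theorem dispersion_lt_dispersion (hb : 0 < b) (hμ : 0 < μ) (hν : 0 < ν) {y : ℝ} (hx : 0 ≤ x)
    (hxy : x < y) : dispersion b μ ν x < dispersion b μ ν y := by
  have hy : 0 ≤ y := hx.trans hxy.le
  unfold dispersion
  rw [← mul_div_assoc, ← mul_div_assoc, div_lt_div_iff₀ (dispersion_denom_pos hb hμ hν hx)
    (dispersion_denom_pos hb hμ hν hy)]
  have hc : 0 < μ * b := by positivity
  have h1 := mul_sinh_le (u := (y + x) * (μ * b)) (v := (y - x) * (μ * b))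
    (mul_nonneg (by linarith) hc.le) (by gcongr; linarith)
  have e1 : (y + x) * (μ * b) = y * μ * b + x * μ * b := by ring
  have e2 : (y - x) * (μ * b) = y * μ * b - x * μ * b := by ring
  have h2 : 0 ≤ Real.sinh ((y - x) * (μ * b)) :=
    Real.sinh_nonneg_iff.2 (mul_nonneg (by linarith) hc.le)
  have h3 : (y + x) * Real.sinh ((y - x) * (μ * b)) ≤ (y - x) * Real.sinh ((y + x) * (μ * b)) := by
    refine le_of_mul_le_mul_right ?_ hc
    linarith
  rw [e2, Real.sinh_sub] at h2
  rw [e1, e2, Real.sinh_sub, Real.sinh_add] at h3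
  have p1 := Real.cosh_pos (x * μ * b)
  have p2 := Real.cosh_pos (y * μ * b)
  have p3 : 0 ≤ Real.sinh (x * μ * b) := Real.sinh_nonneg_iff.2 (by positivity)
  have p4 : 0 ≤ Real.sinh (y * μ * b) := Real.sinh_nonneg_iff.2 (by positivity)
  set Cx := Real.cosh (x * μ * b)
  set Cy := Real.cosh (y * μ * b)
  set Sx := Real.sinh (x * μ * b)
  set Sy := Real.sinh (y * μ * b)
  -- The addition formulas turn the convexity inequality `h3`, written at the sum and the difference
  -- of the arguments, into this one.
  have q1 : x * (Sy * Cx) ≤ y * (Sx * Cy) := by linarith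
  have q2 : x * (Sx * Cy) ≤ y * (Sy * Cx) := by
    have : Sx * Cy ≤ Sy * Cx := by linarith
    have h0 : 0 ≤ Sx * Cy := by positivity
    nlinarith
  have q3 : x * (Cx * Cy + Sx * Sy) < y * (Cx * Cy + Sx * Sy) := by
    have : 0 < Cx * Cy + Sx * Sy := by positivity
    nlinarith
  have r1 := mul_le_mul_of_nonneg_left q1 (sq_nonneg μ)
  have r2 := mul_le_mul_of_nonneg_left q2 (sq_nonneg ν)
  have r3 := mul_lt_mul_of_pos_left q3 (mul_pos hμ hν)
  calc x * (μ * Cx + ν * Sx) * (μ * Sy + ν * Cy)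
      = μ ^ 2 * (x * (Sy * Cx)) + ν ^ 2 * (x * (Sx * Cy)) +
        μ * ν * (x * (Cx * Cy + Sx * Sy)) := by ring
    _ < μ ^ 2 * (y * (Sx * Cy)) + ν ^ 2 * (y * (Sy * Cx)) +
        μ * ν * (y * (Cx * Cy + Sx * Sy)) := by linarith
    _ = y * (μ * Cy + ν * Sy) * (μ * Sx + ν * Cx) := by ring

theorem dispersion_le_dispersion (hb : 0 < b) (hμ : 0 < μ) (hν : 0 < ν) {y : ℝ} (hx : 0 ≤ x)
    (hxy : x ≤ y) : dispersion b μ ν x ≤ dispersion b μ ν y := by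
  rcases eq_or_lt_of_le hxy with h | h
  · rw [h]
  · exact (dispersion_lt_dispersion hb hμ hν hx h).le

/-- The cross-multiplied difference is `μ(ν' - ν)(cosh² - sinh²)`. -/
theorem dispersion_anti (hb : 0 < b) (hμ : 0 < μ) (hν : 0 < ν) {ν' : ℝ} (hν' : ν < ν')
    (hx : 0 < x) : dispersion b μ ν' x < dispersion b μ ν x := by
  unfold dispersion
  refine mul_lt_mul_of_pos_left ?_ hx
  rw [div_lt_div_iff₀ (dispersion_denom_pos hb hμ (hν.trans hν') hx.le)
    (dispersion_denom_pos hb hμ hν hx.le)]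
  have h1 := Real.cosh_sq (x * μ * b)
  have h2 : 0 < μ * (ν' - ν) := mul_pos hμ (by linarith)
  nlinarith

/-- Linear growth in the wavenumber, with a slope that stays away from 0 as long as `ν` is bounded.
It brings `κG(0)` above 2 uniformly in `λ`. -/
theorem le_dispersion (hb : 0 < b) (hμ : 0 < μ) (hν : 0 < ν) (hx : 0 < x) :
    x * (μ / (μ + ν)) ≤ dispersion b μ ν x := by
  unfold dispersion
  refine mul_le_mul_of_nonneg_left ?_ hx.le
  rw [div_le_div_iff₀ (by positivity) (dispersion_denom_pos hb hμ hν hx.le)]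
  have h1 : 0 ≤ Real.sinh (x * μ * b) := Real.sinh_nonneg_iff.2 (by positivity)
  have h3 := (Real.sinh_lt_cosh (x * μ * b)).le
  have h4 : 0 ≤ ν * ν * Real.sinh (x * μ * b) := by positivity
  have h5 := mul_le_mul_of_nonneg_left h3 (mul_pos hμ hμ).le
  have h6 : 0 ≤ μ * ν * Real.sinh (x * μ * b) := by positivity
  nlinarith

theorem continuousAt_dispersion (hb : 0 < b) (hμ : 0 < μ) (hν : 0 < ν) (hx : 0 ≤ x) :
    ContinuousAt (fun ν => dispersion b μ ν x) ν := by
  unfold dispersion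
  refine continuousAt_const.mul (ContinuousAt.div ?_ ?_ (dispersion_denom_pos hb hμ hν hx).ne')
  · fun_prop
  · fun_prop

/-- By homogeneity one power of the wavenumber cancels in `G(0)`, so `κG(0)` is a multiple of `D`
that does not depend on the wavenumber. -/
theorem greenValue_eq_dispersion (hb : 0 < b) (hμ : 0 < μ) (hν : 0 < ν) (hx : 0 < x) (α : ℝ) :
    x ^ 2 * α * greenValue b (x * μ) (x * ν) = α / (2 * μ) * dispersion b μ ν x := by
  have h := dispersion_denom_pos hb hμ hν hx.le
  have h' : x * μ * Real.sinh (x * μ * b) + x * ν * Real.cosh (x * μ * b) =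
    x * (μ * Real.sinh (x * μ * b) + ν * Real.cosh (x * μ * b)) := by ring
  unfold dispersion greenValue
  rw [h']
  field_simp

end Dispersion

/-- The hypotheses on the parameters of the step potential. -/
structure Resonant (b β α lamstar : ℝ) (kstar : ℕ) : Prop where
  b_pos : 0 < b
  β_lt : β < 1
  lam_lt : lamstar < 1
  one_le : 1 ≤ kstar
  α_eq : α = 2 * √(1 - β) / dispersion b (√(1 - β)) (√(1 - lamstar)) kstar

namespace Resonant

variable {b β α lamstar : ℝ} {kstar : ℕ}

theorem μ_pos (h : Resonant b β α lamstar kstar) : 0 < √(1 - β) :=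
  Real.sqrt_pos.2 (by linarith [h.β_lt])

theorem kstar_pos (h : Resonant b β α lamstar kstar) : (0 : ℝ) < kstar := by
  exact_mod_cast h.one_le

theorem critical_pos (h : Resonant b β α lamstar kstar) :
    0 < dispersion b (√(1 - β)) (√(1 - lamstar)) kstar :=
  dispersion_pos h.b_pos h.μ_pos (Real.sqrt_pos.2 (by linarith [h.lam_lt])) h.kstar_pos

theorem α_pos (h : Resonant b β α lamstar kstar) : 0 < α := by
  rw [h.α_eq]
  have := h.critical_pos
  have := h.μ_pos
  positivity

/-- The fundamental solution for the wavenumber `k`. -/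
theorem exists_isGreen (h : Resonant b β α lamstar kstar) {k : ℕ} (hk : 1 ≤ k) {lam : ℝ}
    (hl : lam < 1) : ∃ G : H1, IsGreen b (k ^ 2 * (1 - β)) (k ^ 2 * (1 - lam)) G ∧
      k ^ 2 * α * delta0 G = dispersion b (√(1 - β)) (√(1 - lam)) k /
        dispersion b (√(1 - β)) (√(1 - lamstar)) kstar ∧ outer b (H1.fn G) ≠ 0 := by
  have hk0 : (0 : ℝ) < k := by exact_mod_cast hk
  have hp : 0 < (k : ℝ) ^ 2 * (1 - β) := mul_pos (by positivity) (by linarith [h.β_lt])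
  have hq : 0 < (k : ℝ) ^ 2 * (1 - lam) := mul_pos (by positivity) (by linarith)
  obtain ⟨G, hG, h1, h2⟩ := TravelingWave.exists_isGreen h.b_pos hp hq
  refine ⟨G, hG, ?_, h2⟩
  have e : ∀ t, √((k : ℝ) ^ 2 * t) = k * √t := fun t => by
    rw [Real.sqrt_mul (by positivity), Real.sqrt_sq hk0.le]
  have hμ := h.μ_pos
  rw [h1, e, e, greenValue_eq_dispersion h.b_pos h.μ_pos (Real.sqrt_pos.2 (by linarith)) hk0,
    h.α_eq]
  have := h.critical_pos
  field_simp

theorem exists_critical (h : Resonant b β α lamstar kstar) :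
    ∃ G : H1, IsGreen b (kstar ^ 2 * (1 - β)) (kstar ^ 2 * (1 - lamstar)) G ∧
      kstar ^ 2 * α * delta0 G = 1 ∧ outer b (H1.fn G) ≠ 0 := by
  obtain ⟨G, hG, h1, h2⟩ := h.exists_isGreen h.one_le h.lam_lt
  exact ⟨G, hG, by rw [h1, div_self h.critical_pos.ne'], h2⟩

theorem p_pos (h : Resonant b β α lamstar kstar) {k : ℕ} (hk : 1 ≤ k) :
    0 < (k : ℝ) ^ 2 * (1 - β) := by
  have hk0 : (0 : ℝ) < k := by exact_mod_cast hk
  exact mul_pos (by positivity) (by linarith [h.β_lt])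

theorem q_pos {k : ℕ} (hk : 1 ≤ k) {lam : ℝ} (hl : lam < 1) :
    0 < (k : ℝ) ^ 2 * (1 - lam) := by
  have hk0 : (0 : ℝ) < k := by exact_mod_cast hk
  exact mul_pos (by positivity) (by linarith)

/-- A neighborhood of `lamstar` on which resonances are excluded. -/
theorem exists_interval (h : Resonant b β α lamstar kstar) : ∃ δ > 0, ∀ lam ∈ Ioo (lamstar - δ)
    (lamstar + δ), (1 - lamstar) / 2 < 1 - lam ∧ 1 - lam < 2 - lamstar ∧
      ∀ k : ℕ, 1 ≤ k → (k, lam) ≠ (kstar, lamstar) →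
        dispersion b (√(1 - β)) (√(1 - lam)) k ≠
          dispersion b (√(1 - β)) (√(1 - lamstar)) kstar := by
  have hν : 0 < √(1 - lamstar) := Real.sqrt_pos.2 (by linarith [h.lam_lt])
  have hsq : ContinuousAt (fun lam : ℝ => √(1 - lam)) lamstar := by fun_prop
  have hk1 : (0 : ℝ) ≤ kstar - 1 := by
    have : (1 : ℝ) ≤ kstar := by exact_mod_cast h.one_le
    linarith
  have hc : ∀ x : ℝ, 0 ≤ x →
      ContinuousAt (fun lam => dispersion b (√(1 - β)) (√(1 - lam)) x) lamstar := fun x hx =>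
    ContinuousAt.comp (f := fun lam : ℝ => √(1 - lam))
      (continuousAt_dispersion h.b_pos h.μ_pos hν hx) hsq
  -- Continuity in `λ` is needed only at the neighbours `k* - 1` and `k* + 1`; monotonicity in the
  -- wavenumber covers all the others. At `k*` itself strict monotonicity in `λ` decides.
  have e1 := (hc _ hk1).eventually_lt_const
    (dispersion_lt_dispersion h.b_pos h.μ_pos hν hk1 (by linarith : (kstar : ℝ) - 1 < kstar))
  have e2 := (hc (kstar + 1) (by positivity)).eventually_const_lt
    (dispersion_lt_dispersion h.b_pos h.μ_pos hν h.kstar_pos.le (lt_add_one (kstar : ℝ)))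
  -- These two bounds keep `1 - λ` between positive constants, as the uniform estimates require.
  have e3 : ∀ᶠ lam in 𝓝 lamstar, lam < (1 + lamstar) / 2 :=
    eventually_lt_nhds (by linarith [h.lam_lt])
  have e4 : ∀ᶠ lam in 𝓝 lamstar, lamstar - 1 < lam := eventually_gt_nhds (by linarith)
  obtain ⟨δ, hδ, H⟩ := Metric.eventually_nhds_iff_ball.1 (e1.and (e2.and (e3.and e4)))
  rw [Real.ball_eq_Ioo] at H
  refine ⟨δ, hδ, fun lam hlam => ?_⟩
  obtain ⟨a1, a2, a3, a4⟩ := H lam hlam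
  refine ⟨by linarith, by linarith, fun k hk hne => ?_⟩
  have hν' : 0 < √(1 - lam) := Real.sqrt_pos.2 (by linarith [h.lam_lt])
  rcases lt_trichotomy k kstar with hlt | rfl | hgt
  · refine ne_of_lt (lt_of_le_of_lt (dispersion_le_dispersion h.b_pos h.μ_pos hν'
      (by positivity) ?_) a1)
    have : (k : ℝ) + 1 ≤ kstar := by exact_mod_cast hlt
    linarith
  · have hl : lam ≠ lamstar := fun h => hne (by rw [h])
    rcases lt_or_gt_of_ne hl with hl | hl
    · exact (dispersion_anti h.b_pos h.μ_pos hν (Real.sqrt_lt_sqrt (by linarith [h.lam_lt])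
        (by linarith)) h.kstar_pos).ne
    · exact (dispersion_anti h.b_pos h.μ_pos hν' (Real.sqrt_lt_sqrt (by linarith [h.lam_lt])
        (by linarith)) h.kstar_pos).ne'
  · refine ne_of_gt (lt_of_lt_of_le a2 (dispersion_le_dispersion h.b_pos h.μ_pos hν'
      (by positivity) ?_))
    exact_mod_cast hgt

/-- The estimates for large wavenumbers. -/
theorem exists_estimate (h : Resonant b β α lamstar kstar) : ∃ C > 0, ∃ K : ℕ, ∀ k : ℕ, 1 ≤ k →
    K ≤ k → ∀ lam, (1 - lamstar) / 2 < 1 - lam → 1 - lam < 2 - lamstar → ∀ (φ : H1) (f : L2),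
      (∀ ψ, stepForm b (k ^ 2 * (1 - β)) (k ^ 2 * (1 - lam)) (k ^ 2 * α) φ ψ =
        inner ℝ f (H1.fn ψ)) →
      ‖H1.fn φ‖ ≤ C / (k : ℝ) ^ 2 * ‖f‖ ∧ ‖H1.der φ‖ ≤ C / (k : ℝ) * ‖f‖ := by
  set μ := √(1 - β) with hμ
  set D := dispersion b μ (√(1 - lamstar)) kstar with hD
  have hD0 : 0 < D := h.critical_pos
  have hμ0 : 0 < μ := h.μ_pos
  set N := √(2 - lamstar) with hN
  set m := min (1 - β) ((1 - lamstar) / 2) with hm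
  have hm0 : 0 < m := lt_min (by linarith [h.β_lt]) (by linarith [h.lam_lt])
  -- The choice gives `kμ/(μ + N) ≥ 2D` for `k ≥ K`, that is `κG(0) ≥ 2`, since `√(1-λ) ≤ N`.
  obtain ⟨K, hK⟩ := exists_nat_ge (2 * D * ((μ + N) / μ))
  refine ⟨1 / m + 1 / √m, by positivity, K, fun k hk hKk lam h1 h2 φ f hφ => ?_⟩
  have hk0 : (0 : ℝ) < k := by exact_mod_cast hk
  obtain ⟨G, hG, hGv, -⟩ := h.exists_isGreen hk (lam := lam) (by linarith [h.lam_lt])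
  have hν : 0 < √(1 - lam) := Real.sqrt_pos.2 (by linarith [h.lam_lt])
  have hlarge : 2 ≤ k ^ 2 * α * delta0 G := by
    rw [hGv, le_div_iff₀ hD0]
    refine le_trans ?_ (le_dispersion h.b_pos hμ0 hν hk0)
    have h3 : 2 * D * ((μ + N) / μ) ≤ k := hK.trans (by exact_mod_cast hKk)
    have h4 : μ / (μ + N) ≤ μ / (μ + √(1 - lam)) := by
      gcongr
      exact Real.sqrt_le_sqrt h2.le
    calc 2 * D = 2 * D * ((μ + N) / μ) * (μ / (μ + N)) := by
          have : 0 < μ + N := by positivity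
          field_simp
      _ ≤ k * (μ / (μ + √(1 - lam))) := by gcongr
  have hα := h.α_pos
  have hest := hG.estimate (m := k ^ 2 * m) (by positivity)
    (by gcongr; exact min_le_left _ _) (by gcongr; exact (min_le_right _ _).trans h1.le)
    (by positivity) hlarge hφ
  constructor
  · refine hest.1.trans ?_
    have h5 : (0 : ℝ) ≤ 1 / √m := by positivity
    calc ‖f‖ / (k ^ 2 * m) = (1 / m) / k ^ 2 * ‖f‖ := by field_simp
      _ ≤ _ := by gcongr; linarith
  · refine hest.2.trans ?_
    rw [Real.sqrt_mul (by positivity), Real.sqrt_sq hk0.le]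
    have h5 : (0 : ℝ) ≤ 1 / m := by positivity
    calc ‖f‖ / (k * √m) = (1 / √m) / k * ‖f‖ := by field_simp
      _ ≤ _ := by gcongr; linarith

theorem exists_bifurcationHypotheses (h : Resonant b β α lamstar kstar) :
    ∃ I : Set ℝ, BifurcationHypotheses (stepOutside b) (stepDelta b β α) kstar lamstar I := by
  obtain ⟨δ, hδ, hI⟩ := h.exists_interval
  obtain ⟨C, hC, K, hK⟩ := h.exists_estimate
  obtain ⟨G, hG, hκ, hne⟩ := h.exists_critical
  have hp := h.p_pos h.one_le
  have hq := q_pos h.one_le h.lam_lt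
  have hG0 : H1.fn G ≠ 0 := fun h0 => hne (by rw [h0, map_zero])
  have hker := hG.stepForm_eq_zero hκ
  have hkerG : ∀ c : ℝ, (H1.fn (c • G), (0 : L2)) ∈
      (schrodingerOp (stepOutside b) (stepDelta b β α) kstar lamstar).graph := fun c => by
    refine mem_schrodingerOp_graph.2 fun ψ => ?_
    rw [stepForm_smul, hker, mul_zero, inner_zero_left]
  obtain ⟨R, hR1, hR2, hR3⟩ := hG.exists_bordered_inverse hp hq hκ
  refine ⟨Ioo (lamstar - δ) (lamstar + δ), ?_⟩
  refine
    { selfAdjoint := fun k _ lam => isSelfAdjoint_schrodingerOp h.b_pos β α lam k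
      isOpen := isOpen_Ioo
      ordConnected := ordConnected_Ioo
      mem := ⟨by linarith, by linarith⟩
      one_le := h.one_le
      simple := ?_
      isolated := ?_
      nonresonant := ?_
      estimates := ?_
      transversal := ?_ }
  · obtain ⟨hdom, hT⟩ := apply_eq_of_mem_graph (hkerG 1)
    rw [finrank_eq_one_iff']
    refine ⟨⟨⟨_, hdom⟩, LinearMap.mem_ker.2 hT⟩, ?_, ?_⟩
    · intro h0
      have h1 := congrArg (fun x => ((x : (schrodingerOp (stepOutside b)
        (stepDelta b β α) kstar lamstar).domain) : L2)) (congrArg Subtype.val h0)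
      simp only [one_smul] at h1
      exact hG0 h1
    · rintro ⟨w, hw⟩
      have h1 := LinearPMap.mem_graph _ w
      rw [show (schrodingerOp (stepOutside b) (stepDelta b β α) kstar lamstar) w = 0 from
        LinearMap.mem_ker.1 hw] at h1
      obtain ⟨φ, h2, h3⟩ := exists_of_mem_schrodingerOp_graph h1
      simp only [inner_zero_left] at h3
      refine ⟨kstar ^ 2 * α * delta0 φ, Subtype.ext (Subtype.ext ?_)⟩
      simp only at h2
      rw [← h2]
      conv_rhs => rw [hG.eq_smul_of_ker hp hq h3, map_smul]
      simp only [one_smul]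
      rfl
  · refine exists_punctured_resolventSet (H1.fn.comp R) (lineProj (H1.fn G)) (fun f => ?_)
      (fun p hp' => ?_) hR2 (fun f => ?_) (fun f => ?_) fun p hp' => ?_
    · exact (mem_schrodingerOp_graph (φ := R f)).2 (hR1 f)
    · obtain ⟨φ, h1, h2⟩ := exists_of_mem_schrodingerOp_graph hp'
      -- By symmetry of the form, the range of `L` is orthogonal to its kernel.
      have h3 : inner ℝ (H1.fn G) p.2 = 0 := by
        rw [real_inner_comm, ← h2 G, stepForm_comm, hker]
      have h4 : ∀ ψ, stepForm b (kstar ^ 2 * (1 - β)) (kstar ^ 2 * (1 - lamstar))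
          (kstar ^ 2 * α) (R (p.2 + lineProj (H1.fn G) p.1) - φ) ψ = 0 := by
        intro ψ
        have e1 : lineProj (H1.fn G) (p.2 + lineProj (H1.fn G) p.1) = lineProj (H1.fn G) p.1 := by
          apply lineProj_eq_of_inner_eq
          rw [inner_add_right, h3, inner_lineProj hG0, zero_add]
        rw [stepForm_sub, hR1, h2, e1, add_sub_cancel_right, sub_self]
      have h5 := hG.eq_smul_of_ker hp hq h4
      set c := (kstar : ℝ) ^ 2 * α * delta0 (R (p.2 + lineProj (H1.fn G) p.1) - φ)
      have h6 : inner ℝ (H1.fn G) (H1.fn (R (p.2 + lineProj (H1.fn G) p.1) - φ)) = 0 := by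
        rw [map_sub, inner_sub_right, ← inner_lineProj hG0 (H1.fn (R _)), hR2,
          inner_lineProj hG0, inner_add_right, h3, inner_lineProj hG0, h1]
        ring
      rw [h5, map_smul, inner_smul_right, real_inner_self_eq_norm_sq] at h6
      have h7 : c = 0 := by
        rcases mul_eq_zero.1 h6 with h | h
        · exact h
        · exact absurd h (by
            have := norm_pos_iff.2 hG0
            positivity)
      rw [h7, zero_smul, sub_eq_zero] at h5
      rw [ContinuousLinearMap.comp_apply, h5, h1]
    · exact lineProj_eq_of_inner_eq (inner_lineProj hG0 f)
    · rw [lineProj_apply, ← map_smul]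
      exact hkerG _
    · obtain ⟨φ, h1, h2⟩ := exists_of_mem_schrodingerOp_graph hp'
      rw [lineProj_apply, real_inner_comm, ← h2 G, stepForm_comm, hker, mul_zero, zero_smul]
  · intro k hk lam hlam hne'
    obtain ⟨a1, a2, a3⟩ := hI lam hlam
    have hl : lam < 1 := by linarith [h.lam_lt]
    obtain ⟨G', hG', hv, -⟩ := h.exists_isGreen hk hl
    have hκ' : k ^ 2 * α * delta0 G' ≠ 1 := by
      rw [hv, Ne, div_eq_one_iff_eq h.critical_pos.ne']
      exact a3 k hk hne'
    obtain ⟨S, hS⟩ := hG'.exists_inverse (h.p_pos hk) (q_pos hk hl) hκ'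
    refine zero_mem_resolventSet (H1.fn.comp S) (fun f => ?_) fun u hu => ?_
    · exact (mem_schrodingerOp_graph (φ := S f)).2 (hS f)
    · obtain ⟨φ, h1, h2⟩ := exists_of_mem_schrodingerOp_graph hu
      simp only [inner_zero_left] at h1 h2
      rw [← h1, hG'.eq_zero_of_ker (h.p_pos hk) (q_pos hk hl) hκ' h2, map_zero]
  · refine ⟨C, hC, K, fun k hk hKk lam hlam φ hφ => ?_⟩
    obtain ⟨a1, a2, -⟩ := hI lam hlam
    exact hK k hk hKk lam a1 a2 φ _ (mem_schrodingerOp_graph.1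
      (LinearPMap.mem_graph _ ⟨H1.fn φ, hφ⟩))
  · intro φ hφ hk
    have h1 := hG.eq_smul_of_ker hp hq (inKernel_iff.1 hk)
    set c := (kstar : ℝ) ^ 2 * α * delta0 φ
    have hc : c ≠ 0 := fun h0 => hφ (by rw [h1, h0, zero_smul])
    -- The transversality integral is the squared norm of the outer part, which is nonzero for every
    -- nonzero multiple of `G`.
    have h2 : ∫ y, stepOutside b y * H1.fn φ y ^ 2 = ‖outer b (H1.fn φ)‖ ^ 2 := by
      rw [← inner_outer_self]
      simp only [outer]
      rw [inner_mulL]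
      simp only [sq, mul_assoc]
    rw [h2, h1, map_smul, map_smul]
    have : c • outer b (H1.fn G) ≠ 0 := smul_ne_zero hc hne
    have := norm_pos_iff.2 this
    positivity

/-- Uniformly bounded inverses of `L^k` at `lamstar`, bordered for the critical wavenumber. -/
theorem exists_inverses (h : Resonant b β α lamstar kstar) {φstar : H1} (hφ : φstar ≠ 0)
    (hker : InKernel (stepOutside b) (stepDelta b β α) kstar lamstar φstar) :
    ∃ (R : ℕ → L2 →L[ℝ] H1) (C : ℝ), 0 ≤ C ∧ R 0 = 0 ∧
      (∀ k, 1 ≤ k → k ≠ kstar → ∀ f ψ, stepForm b (k ^ 2 * (1 - β)) (k ^ 2 * (1 - lamstar))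
        (k ^ 2 * α) (R k f) ψ = inner ℝ f (H1.fn ψ)) ∧
      (∀ f ψ, stepForm b (kstar ^ 2 * (1 - β)) (kstar ^ 2 * (1 - lamstar)) (kstar ^ 2 * α)
        (R kstar f) ψ = inner ℝ (f - lineProj (H1.fn φstar) f) (H1.fn ψ)) ∧
      R kstar (H1.fn φstar) = φstar ∧
      (∀ (k : ℕ) f, (k : ℝ) ^ 2 * ‖H1.fn (R k f)‖ ≤ C * ‖f‖) ∧
      ∀ (k : ℕ) f, (k : ℝ) * ‖R k f‖ ≤ C * ‖f‖ := by
  obtain ⟨δ, hδ, hI⟩ := h.exists_interval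
  obtain ⟨C, hC, K, hK⟩ := h.exists_estimate
  obtain ⟨G, hG, hκ, -⟩ := h.exists_critical
  have hp := h.p_pos h.one_le
  have hq := q_pos h.one_le h.lam_lt
  obtain ⟨Rs, hR1, hR2, hR3⟩ := hG.exists_bordered_inverse hp hq hκ
  have h1 := hG.eq_smul_of_ker hp hq (inKernel_iff.1 hker)
  set c := (kstar : ℝ) ^ 2 * α * delta0 φstar
  have hc : c ≠ 0 := fun h0 => hφ (by rw [h1, h0, zero_smul])
  -- `φ*` is a nonzero multiple of `G`, and the projection on a line does not depend on the spanning
  -- vector.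
  have hproj : lineProj (H1.fn φstar) = lineProj (H1.fn G) := by
    ext1 f
    rw [h1, map_smul, lineProj_apply, lineProj_apply, norm_smul, inner_smul_left, smul_smul,
      RCLike.conj_to_real, mul_pow, Real.norm_eq_abs, sq_abs, mul_inv]
    congr 1
    field_simp
  have hmem : lamstar ∈ Ioo (lamstar - δ) (lamstar + δ) := ⟨by linarith, by linarith⟩
  obtain ⟨a1, a2, a3⟩ := hI lamstar hmem
  have hex : ∀ k : ℕ, ∃ S : L2 →L[ℝ] H1, 1 ≤ k → k ≠ kstar → ∀ f ψ,
      stepForm b (k ^ 2 * (1 - β)) (k ^ 2 * (1 - lamstar)) (k ^ 2 * α) (S f) ψ =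
        inner ℝ f (H1.fn ψ) := by
    intro k
    by_cases hk : 1 ≤ k ∧ k ≠ kstar
    · obtain ⟨G', hG', hv, -⟩ := h.exists_isGreen hk.1 h.lam_lt
      obtain ⟨S, hS⟩ := hG'.exists_inverse (κ := k ^ 2 * α) (h.p_pos hk.1) (q_pos hk.1 h.lam_lt)
        (by
          rw [hv, Ne, div_eq_one_iff_eq h.critical_pos.ne']
          exact a3 k hk.1 fun h => hk.2 (Prod.ext_iff.1 h).1)
      exact ⟨S, fun _ _ => hS⟩
    · exact ⟨0, fun h1 h2 => absurd ⟨h1, h2⟩ hk⟩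
  choose S hS using hex
  -- The value 0 at `k = 0` is a convention: the sine of frequency 0 vanishes, and the weighted
  -- bounds say nothing there.
  set R : ℕ → L2 →L[ℝ] H1 := fun k => if k = 0 then 0 else if k = kstar then Rs else S k with hR
  have hR0 : R 0 = 0 := by simp [hR]
  have hks : kstar ≠ 0 := by have := h.one_le; omega
  have hRs : R kstar = Rs := by simp [hR, hks]
  have hRk : ∀ k, 1 ≤ k → k ≠ kstar → R k = S k := fun k h1 h2 => by
    simp [hR, h2, show k ≠ 0 by omega]
  -- From `M` on the uniform estimates apply and `k*` is excluded. Below `M` a finite sum of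
  -- operator norms is a bound.
  set M := K + kstar + 1 with hM
  set C' := ∑ k ∈ Finset.range M, (k : ℝ) ^ 2 * ‖R k‖ with hC'
  have hC'0 : 0 ≤ C' := Finset.sum_nonneg fun k _ => by positivity
  have hsmall : ∀ k < M, (k : ℝ) ^ 2 * ‖R k‖ ≤ C' := fun k hk =>
    Finset.single_le_sum (f := fun k : ℕ => (k : ℝ) ^ 2 * ‖R k‖) (fun k _ => by positivity)
      (Finset.mem_range.2 hk)
  have hlarge : ∀ k, M ≤ k → ∀ f, ‖H1.fn (R k f)‖ ≤ C / (k : ℝ) ^ 2 * ‖f‖ ∧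
      ‖H1.der (R k f)‖ ≤ C / (k : ℝ) * ‖f‖ := by
    intro k hk f
    have hk1 : 1 ≤ k := by omega
    rw [hRk k hk1 (by omega)]
    exact hK k hk1 (by omega) lamstar a1 a2 _ f (hS k hk1 (by omega) f)
  have hbound : ∀ (k : ℕ) f, k < M → (k : ℝ) ^ 2 * ‖R k f‖ ≤ C' * ‖f‖ := by
    intro k f hk
    calc (k : ℝ) ^ 2 * ‖R k f‖ ≤ (k : ℝ) ^ 2 * (‖R k‖ * ‖f‖) := by
          gcongr
          exact (R k).le_opNorm f
      _ = (k : ℝ) ^ 2 * ‖R k‖ * ‖f‖ := by ring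
      _ ≤ C' * ‖f‖ := by gcongr; exact hsmall k hk
  refine ⟨R, C' + 2 * C, by positivity, hR0, fun k h1 h2 => ?_, ?_, ?_, fun k f => ?_,
    fun k f => ?_⟩
  · rw [hRk k h1 h2]
    exact hS k h1 h2
  · rw [hRs, hproj]
    exact hR1
  · rw [hRs, h1, map_smul, map_smul, hR3]
  · rcases lt_or_ge k M with hk | hk
    · have h2 : (k : ℝ) ^ 2 * ‖H1.fn (R k f)‖ ≤ (k : ℝ) ^ 2 * ‖R k f‖ := by
        gcongr
        exact H1.norm_fn_le _
      have h3 := hbound k f hk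
      have h4 : 0 ≤ 2 * C * ‖f‖ := by positivity
      linarith
    · have h2 := (hlarge k hk f).1
      have hk0 : (0 : ℝ) < k := by exact_mod_cast (show 0 < k by omega)
      calc (k : ℝ) ^ 2 * ‖H1.fn (R k f)‖ ≤ (k : ℝ) ^ 2 * (C / (k : ℝ) ^ 2 * ‖f‖) := by gcongr
        _ = C * ‖f‖ := by field_simp
        _ ≤ (C' + 2 * C) * ‖f‖ := by gcongr; linarith
  · rcases Nat.eq_zero_or_pos k with rfl | hkpos
    · simp only [Nat.cast_zero, zero_mul]
      positivity
    have hk1 : (1 : ℝ) ≤ k := by exact_mod_cast hkpos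
    rcases lt_or_ge k M with hk | hk
    · have h2 : (k : ℝ) * ‖R k f‖ ≤ (k : ℝ) ^ 2 * ‖R k f‖ := by
        gcongr
        nlinarith
      have h3 := hbound k f hk
      have h4 : 0 ≤ 2 * C * ‖f‖ := by positivity
      linarith
    · obtain ⟨h2, h3⟩ := hlarge k hk f
      have h4 : ‖R k f‖ ≤ ‖H1.fn (R k f)‖ + ‖H1.der (R k f)‖ := by
        refine le_of_sq_le_sq ?_ (by positivity)
        rw [H1.norm_sq_eq]
        nlinarith [norm_nonneg (H1.fn (R k f)), norm_nonneg (H1.der (R k f))]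
      have h5 : C / (k : ℝ) ^ 2 * ‖f‖ ≤ C / (k : ℝ) * ‖f‖ := by
        gcongr
        nlinarith
      calc (k : ℝ) * ‖R k f‖ ≤ k * (C / k * ‖f‖ + C / k * ‖f‖) := by gcongr; linarith
        _ = 2 * C * ‖f‖ := by field_simp; ring
        _ ≤ (C' + 2 * C) * ‖f‖ := by gcongr; linarith

end Resonant

/-! ### Multilinear maps on `ℓ¹` -/

/-- The absolutely summable sequences in `E`. -/
abbrev Ell1 (E : Type*) [NormedAddCommGroup E] : Type _ := lp (fun _ : ℕ => E) 1

namespace Ell1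

set_option maxSynthPendingDepth 3

variable {E F G : Type*} [NormedAddCommGroup E] [NormedSpace ℝ E]
  [NormedAddCommGroup F] [NormedSpace ℝ F] [NormedAddCommGroup G] [NormedSpace ℝ G]

omit [NormedSpace ℝ E] in
theorem hasSum_norm (z : Ell1 E) : HasSum (fun k => ‖z k‖) ‖z‖ := by
  simpa using lp.hasSum_norm (p := 1) (by simp) z

/-- The sequence with the single entry `a` at `k`. -/
def single (k : ℕ) : E →L[ℝ] Ell1 E :=
  lp.singleContinuousLinearMap ℝ (fun _ : ℕ => E) 1 k

theorem single_def (k : ℕ) (a : E) : single k a = lp.single (E := fun _ : ℕ => E) 1 k a :=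
  lp.singleContinuousLinearMap_apply ..

theorem norm_single (k : ℕ) (a : E) : ‖single k a‖ = ‖a‖ := by
  rw [single_def]
  exact lp.norm_single (E := fun _ : ℕ => E) (p := 1) (by simp) k a

theorem single_apply_self (k : ℕ) (a : E) : (single k a : Ell1 E) k = a := by
  rw [single_def]
  exact lp.single_apply_self (E := fun _ : ℕ => E) 1 k a

theorem single_apply_ne {k n : ℕ} (h : n ≠ k) (a : E) : (single k a : Ell1 E) n = 0 := by
  rw [single_def]
  exact lp.single_apply_ne (E := fun _ : ℕ => E) 1 k a h

theorem hasSum_single (z : Ell1 E) : HasSum (fun k => single k (z k)) z := by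
  simp only [single_def]
  exact lp.hasSum_single (E := fun _ : ℕ => E) (p := 1) (by simp) z

/-- Every sequence in `ℓ¹` is the sum of its single entries. Through this lemma, identities between
bounded operators need to be checked on one frequency at a time only. -/
theorem ext_single {A B : Ell1 E →L[ℝ] F} (h : ∀ k a, A (single k a) = B (single k a)) :
    A = B := by
  ext1 z
  have h1 := (hasSum_single z).mapL A
  have h2 := (hasSum_single z).mapL B
  simp only [h] at h1
  exact h1.unique h2

/-- The evaluation at `n`. -/
def eval (n : ℕ) : Ell1 E →L[ℝ] E := lp.evalCLM ℝ (fun _ : ℕ => E) 1 n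

theorem summable_family [CompleteSpace F] {T : ℕ → E →L[ℝ] F} {C : ℝ}
    (h : ∀ k a, ‖T k a‖ ≤ C * ‖a‖) (z : Ell1 E) : Summable fun k => T k (z k) :=
  Summable.of_norm_bounded ((hasSum_norm z).mul_left C).summable fun k => h k (z k)

/-- A uniformly bounded family of operators induces an operator on `ℓ¹`. -/
def lift [CompleteSpace F] (T : ℕ → E →L[ℝ] F) (C : ℝ) (h : ∀ k a, ‖T k a‖ ≤ C * ‖a‖) :
    Ell1 E →L[ℝ] F :=
  LinearMap.mkContinuous
    { toFun := fun z => ∑' k, T k (z k)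
      map_add' := fun z w => by
        rw [← (summable_family h z).tsum_add (summable_family h w)]
        simp
      map_smul' := fun c z => by
        rw [RingHom.id_apply, ← (summable_family h z).tsum_const_smul c]
        simp } C
    fun z => tsum_of_norm_bounded ((hasSum_norm z).mul_left C) fun k => h k (z k)

theorem hasSum_lift [CompleteSpace F] {T : ℕ → E →L[ℝ] F} {C : ℝ}
    (h : ∀ k a, ‖T k a‖ ≤ C * ‖a‖) (z : Ell1 E) : HasSum (fun k => T k (z k)) (lift T C h z) :=
  (summable_family h z).hasSum

theorem lift_single [CompleteSpace F] {T : ℕ → E →L[ℝ] F} {C : ℝ}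
    (h : ∀ k a, ‖T k a‖ ≤ C * ‖a‖) (k : ℕ) (a : E) : lift T C h (single k a) = T k a := by
  refine (hasSum_lift h (single k a)).unique ?_
  convert! hasSum_ite_eq k (T k a) using 2 with n
  split_ifs with hn
  · rw [hn, single_apply_self]
  · rw [single_apply_ne hn, map_zero]

theorem norm_lift_le [CompleteSpace F] {T : ℕ → E →L[ℝ] F} {C : ℝ} (hC : 0 ≤ C)
    (h : ∀ k a, ‖T k a‖ ≤ C * ‖a‖) : ‖lift T C h‖ ≤ C :=
  LinearMap.mkContinuous_norm_le _ hC _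

/-- Moving the last argument of a trilinear map to the front. -/
def rotate {E₁ E₂ E₃ : Type*} [NormedAddCommGroup E₁] [NormedSpace ℝ E₁] [NormedAddCommGroup E₂]
    [NormedSpace ℝ E₂] [NormedAddCommGroup E₃] [NormedSpace ℝ E₃]
    (X : E₁ →L[ℝ] E₂ →L[ℝ] E₃ →L[ℝ] F) : E₃ →L[ℝ] E₁ →L[ℝ] E₂ →L[ℝ] F :=
  (((ContinuousLinearMap.flipₗᵢ ℝ E₂ E₃ F).toLinearIsometry.toContinuousLinearMap).comp X).flip

theorem rotate_apply {E₁ E₂ E₃ : Type*} [NormedAddCommGroup E₁] [NormedSpace ℝ E₁]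
    [NormedAddCommGroup E₂] [NormedSpace ℝ E₂] [NormedAddCommGroup E₃] [NormedSpace ℝ E₃]
    (X : E₁ →L[ℝ] E₂ →L[ℝ] E₃ →L[ℝ] F) (a : E₁) (b : E₂) (c : E₃) :
    rotate X c a b = X a b c := rfl

theorem norm_rotate_le {E₁ E₂ E₃ : Type*} [NormedAddCommGroup E₁] [NormedSpace ℝ E₁]
    [NormedAddCommGroup E₂] [NormedSpace ℝ E₂] [NormedAddCommGroup E₃] [NormedSpace ℝ E₃]
    (X : E₁ →L[ℝ] E₂ →L[ℝ] E₃ →L[ℝ] F) : ‖rotate X‖ ≤ ‖X‖ := by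
  rw [rotate, ContinuousLinearMap.opNorm_flip, LinearIsometry.norm_toContinuousLinearMap_comp]

theorem exists_trilift [CompleteSpace F] (m : ℕ → ℕ → ℕ → E →L[ℝ] E →L[ℝ] E →L[ℝ] F) {C : ℝ}
    (hC : 0 ≤ C) (h : ∀ j k l, ‖m j k l‖ ≤ C) :
    ∃ M : Ell1 E →L[ℝ] Ell1 E →L[ℝ] Ell1 E →L[ℝ] F, ∀ j k l a b c,
      M (single j a) (single k b) (single l c) = m j k l a b c := by
  -- One step lifts the last argument to `ℓ¹` and moves it to the front. After three steps, for `l`,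
  -- `k` and `j`, the original order is restored.
  have step : ∀ {E₁ E₂ : Type _} [NormedAddCommGroup E₁] [NormedSpace ℝ E₁]
      [NormedAddCommGroup E₂] [NormedSpace ℝ E₂] (X : ℕ → E₁ →L[ℝ] E₂ →L[ℝ] E →L[ℝ] F),
      (∀ k, ‖X k‖ ≤ C) → ∃ Y : Ell1 E →L[ℝ] E₁ →L[ℝ] E₂ →L[ℝ] F, ‖Y‖ ≤ C ∧
        ∀ k a b c, Y (single k c) a b = X k a b c := by
    intro E₁ E₂ _ _ _ _ X hX
    have hb : ∀ k a, ‖rotate (X k) a‖ ≤ C * ‖a‖ := fun k a =>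
      (rotate (X k)).le_of_opNorm_le ((norm_rotate_le _).trans (hX k)) a
    exact ⟨lift (fun k => rotate (X k)) C hb, norm_lift_le hC hb, fun k a b c => by
      rw [lift_single hb, rotate_apply]⟩
  choose D hD1 hD2 using fun j k => step (fun l => m j k l) (h j k)
  choose D' hD1' hD2' using fun j => step (fun k => D j k) (hD1 j)
  obtain ⟨M, -, hM⟩ := step D' hD1'
  refine ⟨M, fun j k l a b c => ?_⟩
  rw [hM, hD2', hD2]

theorem ext_single₃ {A B : Ell1 E →L[ℝ] Ell1 E →L[ℝ] Ell1 E →L[ℝ] F}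
    (h : ∀ j k l a b c, A (single j a) (single k b) (single l c) =
      B (single j a) (single k b) (single l c)) : A = B :=
  ext_single fun j a => ext_single fun k b => ext_single fun l c => h j k l a b c

/-- The entry with index `|n|`, with the sign of `n`. -/
def signed (n : ℤ) : E →L[ℝ] Ell1 E := (n.sign : ℝ) • single n.natAbs

theorem norm_signed_le (n : ℤ) (a : E) : ‖signed n a‖ ≤ ‖a‖ := by
  rw [signed, smul_apply, norm_smul, norm_single]
  refine mul_le_of_le_one_left (norm_nonneg _) ?_
  rw [Real.norm_eq_abs, ← Int.cast_abs]
  rcases Int.sign_trichotomy n with h | h | h <;> simp [h]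

end Ell1

set_option maxSynthPendingDepth 3

/-! ### Trigonometric series with values in a Banach space -/

open scoped BoundedContinuousFunction

section Series

variable {E G H : Type*} [NormedAddCommGroup E] [NormedSpace ℝ E] [NormedAddCommGroup G]
  [NormedSpace ℝ G] [NormedAddCommGroup H] [NormedSpace ℝ H]

/-- The function `x ↦ sin (k x)`. -/
def sinWave (k : ℕ) : ℝ →ᵇ ℝ :=
  BoundedContinuousFunction.ofNormedAddCommGroup (fun x => Real.sin (k * x)) (by fun_prop) 1
    fun _ => Real.abs_sin_le_one _

/-- The function `x ↦ cos (k x)`. -/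
def cosWave (k : ℕ) : ℝ →ᵇ ℝ :=
  BoundedContinuousFunction.ofNormedAddCommGroup (fun x => Real.cos (k * x)) (by fun_prop) 1
    fun _ => Real.abs_cos_le_one _

theorem sinWave_apply (k : ℕ) (x : ℝ) : sinWave k x = Real.sin (k * x) := rfl

theorem cosWave_apply (k : ℕ) (x : ℝ) : cosWave k x = Real.cos (k * x) := rfl

theorem norm_sinWave_le (k : ℕ) : ‖sinWave k‖ ≤ 1 :=
  BoundedContinuousFunction.norm_ofNormedAddCommGroup_le _ zero_le_one _

theorem norm_cosWave_le (k : ℕ) : ‖cosWave k‖ ≤ 1 :=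
  BoundedContinuousFunction.norm_ofNormedAddCommGroup_le _ zero_le_one _

theorem norm_smul_le_of_bounded (s : ℝ →ᵇ ℝ) (g : G) (x : ℝ) : ‖s x • g‖ ≤ ‖s‖ * ‖g‖ := by
  rw [norm_smul]
  exact mul_le_mul_of_nonneg_right (s.norm_coe_le_norm x) (norm_nonneg g)

/-- The operator `g ↦ (x ↦ s(x) g)`. -/
def profile (s : ℝ →ᵇ ℝ) : G →L[ℝ] (ℝ →ᵇ G) :=
  LinearMap.mkContinuous
    { toFun := fun g => BoundedContinuousFunction.ofNormedAddCommGroup (fun x => s x • g)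
        (s.continuous.smul continuous_const) (‖s‖ * ‖g‖)
        (norm_smul_le_of_bounded s g)
      map_add' := fun g h => by
        ext x
        exact smul_add _ _ _
      map_smul' := fun c g => by
        ext x
        exact smul_comm _ _ _ } ‖s‖
    fun g => BoundedContinuousFunction.norm_ofNormedAddCommGroup_le _ (by positivity)
      (norm_smul_le_of_bounded s g)

theorem profile_apply (s : ℝ →ᵇ ℝ) (g : G) (x : ℝ) : profile s g x = s x • g := rfl

theorem norm_profile_apply_le (s : ℝ →ᵇ ℝ) (g : G) : ‖profile s g‖ ≤ ‖s‖ * ‖g‖ :=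
  BoundedContinuousFunction.norm_ofNormedAddCommGroup_le _ (by positivity)
    (norm_smul_le_of_bounded s g)

theorem norm_profile_comp_le {s : ℕ → ℝ →ᵇ ℝ} (hs : ∀ k, ‖s k‖ ≤ 1) {T : ℕ → E →L[ℝ] G} {C : ℝ}
    (hT : ∀ k a, ‖T k a‖ ≤ C * ‖a‖) (k : ℕ) (a : E) :
    ‖(profile (s k)).comp (T k) a‖ ≤ C * ‖a‖ :=
  (norm_profile_apply_le _ _).trans
    ((mul_le_of_le_one_left (norm_nonneg _) (hs k)).trans (hT k a))

/-- The series `z ↦ ∑ s_k(x) T_k z_k`. -/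
def series [CompleteSpace G] (s : ℕ → ℝ →ᵇ ℝ) (hs : ∀ k, ‖s k‖ ≤ 1) (T : ℕ → E →L[ℝ] G) (C : ℝ)
    (hT : ∀ k a, ‖T k a‖ ≤ C * ‖a‖) : Ell1 E →L[ℝ] (ℝ →ᵇ G) :=
  Ell1.lift (fun k => (profile (s k)).comp (T k)) C (norm_profile_comp_le hs hT)

theorem series_single [CompleteSpace G] {s : ℕ → ℝ →ᵇ ℝ} (hs : ∀ k, ‖s k‖ ≤ 1)
    {T : ℕ → E →L[ℝ] G} {C : ℝ} (hT : ∀ k a, ‖T k a‖ ≤ C * ‖a‖) (k : ℕ) (a : E) :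
    series s hs T C hT (Ell1.single k a) = profile (s k) (T k a) :=
  Ell1.lift_single (norm_profile_comp_le hs hT) k a

theorem hasSum_series [CompleteSpace G] {s : ℕ → ℝ →ᵇ ℝ} (hs : ∀ k, ‖s k‖ ≤ 1)
    {T : ℕ → E →L[ℝ] G} {C : ℝ} (hT : ∀ k a, ‖T k a‖ ≤ C * ‖a‖) (z : Ell1 E) (x : ℝ) :
    HasSum (fun k => s k x • T k (z k)) (series s hs T C hT z x) :=
  (Ell1.hasSum_lift (norm_profile_comp_le hs hT) z).mapL (BoundedContinuousFunction.evalCLM ℝ x)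

/-- A bounded continuous function as an element of `L²(𝕋; G)`. -/
def toCircle : (ℝ →ᵇ G) →L[ℝ] Lp G 2 circleMeasure :=
  BoundedContinuousFunction.toLp 2 circleMeasure ℝ

theorem coeFn_toCircle (u : ℝ →ᵇ G) : toCircle u =ᵐ[circleMeasure] u :=
  BoundedContinuousFunction.coeFn_toLp 2 circleMeasure ℝ u

variable {F : Type*} [NormedAddCommGroup F] [NormedSpace ℝ F] [CompleteSpace F]

/-- The pairing `u ↦ ∫ B(u(x), Ψ(x)) dx` on the torus. -/
def circlePairing (B : G →L[ℝ] H →L[ℝ] F) (Ψ : Lp H 2 circleMeasure) : (ℝ →ᵇ G) →L[ℝ] F :=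
  ((B.lpPairing circleMeasure 2 2).flip Ψ).comp toCircle

theorem circlePairing_apply (B : G →L[ℝ] H →L[ℝ] F) (Ψ : Lp H 2 circleMeasure) (u : ℝ →ᵇ G) :
    circlePairing B Ψ u = ∫ x, B (u x) (Ψ x) ∂circleMeasure := by
  change B.lpPairing circleMeasure 2 2 (toCircle u) Ψ = _
  rw [ContinuousLinearMap.lpPairing_eq_integral]
  apply integral_congr_ae
  filter_upwards [coeFn_toCircle u] with x hx
  rw [hx]

omit [CompleteSpace F] in
theorem integrable_circlePairing (B : G →L[ℝ] H →L[ℝ] F) (Ψ : Lp H 2 circleMeasure) (u : ℝ →ᵇ G) :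
    Integrable (fun x => B (u x) (Ψ x)) circleMeasure := by
  refine (memLp_one_iff_integrable.1
    (B.memLp_of_bilin 1 (Lp.memLp (toCircle u)) (Lp.memLp Ψ))).congr ?_
  filter_upwards [coeFn_toCircle u] with x hx
  rw [hx]

/-- On a single frequency the variables separate: the test function enters only through its Fourier
coefficient. -/
theorem circlePairing_profile [CompleteSpace H] (B : G →L[ℝ] H →L[ℝ] F)
    (Ψ : Lp H 2 circleMeasure) (s : ℝ →ᵇ ℝ) (g : G) :
    circlePairing B Ψ (profile s g) = B g (∫ x, s x • Ψ x ∂circleMeasure) := by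
  rw [circlePairing_apply, ← ContinuousLinearMap.integral_comp_comm _
    (integrable_test_smul s.continuous (Lp.memLp Ψ))]
  simp [profile_apply]

/-! ### Weak derivatives of trigonometric series -/

theorem memLp_periodic_test {η : ℝ → ℝ} (hη : Continuous η) : MemLp η 2 circleMeasure := by
  obtain ⟨C, hC⟩ := (isCompact_Icc (a := -Real.pi) (b := Real.pi)).exists_bound_of_continuousOn
    hη.continuousOn
  refine MemLp.of_bound hη.aestronglyMeasurable C ?_
  unfold circleMeasure
  filter_upwards [ae_restrict_mem measurableSet_Ioc] with x hx
  exact hC x ⟨hx.1.le, hx.2⟩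

theorem integral_smul_eq_circlePairing [CompleteSpace G] {η : ℝ → ℝ} (hη : Continuous η)
    (u : ℝ →ᵇ G) : ∫ x, η x • u x ∂circleMeasure =
      circlePairing (ContinuousLinearMap.lsmul ℝ ℝ).flip ((memLp_periodic_test hη).toLp η) u := by
  rw [circlePairing_apply]
  apply integral_congr_ae
  filter_upwards [(memLp_periodic_test hη).coeFn_toLp] with x hx
  simp [hx]

/-- For a fixed test function both sides of the weak derivative identity are bounded linear in `z`.
-/
theorem isPeriodicWeakDeriv_of_single [CompleteSpace G] {A B : Ell1 E →L[ℝ] (ℝ →ᵇ G)}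
    (h : ∀ k a, IsPeriodicWeakDeriv (A (Ell1.single k a)) (B (Ell1.single k a))) (z : Ell1 E) :
    IsPeriodicWeakDeriv (A z) (B z) := by
  intro η h1 h2
  have hd : Continuous (deriv η) := h1.continuous_deriv (by simp)
  rw [integral_smul_eq_circlePairing hd, integral_smul_eq_circlePairing h1.continuous]
  have key : (circlePairing (ContinuousLinearMap.lsmul ℝ ℝ).flip
        ((memLp_periodic_test hd).toLp _)).comp A =
      -((circlePairing (ContinuousLinearMap.lsmul ℝ ℝ).flip
        ((memLp_periodic_test h1.continuous).toLp _)).comp B) := by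
    refine Ell1.ext_single fun k a => ?_
    have := h k a η h1 h2
    rw [integral_smul_eq_circlePairing hd, integral_smul_eq_circlePairing h1.continuous] at this
    exact this
  exact congrArg (fun L => L z) key

theorem isPeriodicWeakDeriv_smul_const [CompleteSpace G] {s s' : ℝ → ℝ}
    (h : ∀ x, HasDerivAt s (s' x) x) (hs' : Continuous s') (hp : s Real.pi = s (-Real.pi)) (g : G) :
    IsPeriodicWeakDeriv (fun x => s x • g) (fun x => s' x • g) := by
  intro η h1 h2
  have hd : Continuous (deriv η) := h1.continuous_deriv (by simp)
  have hη : η Real.pi = η (-Real.pi) := by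
    rw [← h2 (-Real.pi)]
    congr 1
    ring
  simp only [smul_smul]
  rw [integral_smul_const, integral_smul_const, ← neg_smul]
  congr 1
  unfold circleMeasure
  rw [← intervalIntegral.integral_of_le (by linarith [Real.pi_pos]),
    ← intervalIntegral.integral_of_le (by linarith [Real.pi_pos])]
  have := intervalIntegral.integral_mul_deriv_eq_deriv_mul (a := -Real.pi) (b := Real.pi)
    (u := η) (v := s) (u' := deriv η) (v' := s')
    (fun x _ => ((h1.differentiable (by simp)) x).hasDerivAt) (fun x _ => h x)
    (hd.intervalIntegrable _ _) (hs'.intervalIntegrable _ _)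
  rw [this, hη, hp]
  ring

theorem hasDerivAt_sin_mul (k x : ℝ) :
    HasDerivAt (fun x => Real.sin (k * x)) (k * Real.cos (k * x)) x := by
  simpa [mul_comm] using ((hasDerivAt_id x).const_mul k).sin

theorem hasDerivAt_cos_mul (k x : ℝ) :
    HasDerivAt (fun x => Real.cos (k * x)) (-(k * Real.sin (k * x))) x := by
  simpa [mul_comm] using ((hasDerivAt_id x).const_mul k).cos

theorem isPeriodicWeakDeriv_sin [CompleteSpace G] (k : ℕ) (g : G) :
    IsPeriodicWeakDeriv (fun x => Real.sin (k * x) • g)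
      (fun x => Real.cos (k * x) • (k : ℝ) • g) := by
  simp only [smul_smul]
  have hs : ∀ x, HasDerivAt (fun x => Real.sin (k * x)) (Real.cos (k * x) * k) x := fun x => by
    rw [mul_comm (Real.cos _)]
    exact hasDerivAt_sin_mul k x
  exact isPeriodicWeakDeriv_smul_const hs (by fun_prop) (by simp [Real.sin_nat_mul_pi]) g

theorem isPeriodicWeakDeriv_cos [CompleteSpace G] (k : ℕ) (g : G) :
    IsPeriodicWeakDeriv (fun x => Real.cos (k * x) • (k : ℝ) • g)
      (fun x => Real.sin (k * x) • (-((k : ℝ) ^ 2)) • g) := by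
  have hs : ∀ x, HasDerivAt (fun x => Real.cos (k * x) * k) (Real.sin (k * x) * -((k : ℝ) ^ 2)) x :=
    fun x => by
      convert! (hasDerivAt_cos_mul k x).mul_const (k : ℝ) using 1
      ring
  simp only [smul_smul]
  exact isPeriodicWeakDeriv_smul_const hs (by fun_prop) (by simp) g

end Series

/-! ### The cubic term -/

/-- Multiplication of a function in `L²(ℝ)` by a function in `H¹(ℝ)`. -/
def mulH : H1 →L[ℝ] L2 →L[ℝ] L2 := mulL.comp H1.toLInf

theorem coeFn_mulH (f : H1) (u : L2) : mulH f u =ᵐ[volume] fun y => H1.fn f y * u y := by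
  filter_upwards [coeFn_mulL (H1.toLInf f) u, H1.coeFn_toLInf f] with y h1 h2
  change mulL (H1.toLInf f) u y = _
  rw [h1, h2]

theorem norm_mulH_le (f : H1) (u : L2) : ‖mulH f u‖ ≤ 2 * ‖f‖ * ‖u‖ :=
  (norm_mulL_le _ _).trans (mul_le_mul_of_nonneg_right f.norm_toLInf_le (norm_nonneg _))

section Trilinear

variable {E F G : Type*} [NormedAddCommGroup E] [NormedSpace ℝ E] [NormedAddCommGroup F]
  [NormedSpace ℝ F] [NormedAddCommGroup G] [NormedSpace ℝ G]

/-- Composition of a trilinear map with a linear map. -/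
def postcomp₃ (V : F →L[ℝ] G) (M : E →L[ℝ] E →L[ℝ] E →L[ℝ] F) : E →L[ℝ] E →L[ℝ] E →L[ℝ] G :=
  (ContinuousLinearMap.compL ℝ E (E →L[ℝ] F) (E →L[ℝ] G)
    (ContinuousLinearMap.compL ℝ E F G V)).comp M

theorem postcomp₃_apply (V : F →L[ℝ] G) (M : E →L[ℝ] E →L[ℝ] E →L[ℝ] F) (a b c : E) :
    postcomp₃ V M a b c = V (M a b c) := rfl

/-- The trilinear map `(a, b, c) ↦ Γ (A a) (B b) (D c)` with values in `L²(ℝ)`. -/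
def triple (Γ : LInf) (A B : E →L[ℝ] H1) (D : E →L[ℝ] L2) : E →L[ℝ] E →L[ℝ] E →L[ℝ] L2 :=
  (ContinuousLinearMap.compL ℝ E (L2 →L[ℝ] L2) (E →L[ℝ] L2)
    ((ContinuousLinearMap.compL ℝ E L2 L2 (mulL Γ)).comp
      ((ContinuousLinearMap.compL ℝ E L2 L2).flip D))).comp
    ((ContinuousLinearMap.compL ℝ L2 L2 L2).bilinearComp (mulH.comp A) (mulH.comp B))

theorem triple_apply (Γ : LInf) (A B : E →L[ℝ] H1) (D : E →L[ℝ] L2) (a b c : E) :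
    triple Γ A B D a b c = mulL Γ (mulH (A a) (mulH (B b) (D c))) := rfl

theorem norm_triple_le (Γ : LInf) {A B : E →L[ℝ] H1} {D : E →L[ℝ] L2} {C : ℝ} (hC : 0 ≤ C)
    (hA : ∀ a, ‖A a‖ ≤ C * ‖a‖) (hB : ∀ a, ‖B a‖ ≤ C * ‖a‖) (hD : ∀ a, ‖D a‖ ≤ C * ‖a‖)
    (a b c : E) : ‖triple Γ A B D a b c‖ ≤ 4 * ‖Γ‖ * C ^ 3 * ‖a‖ * ‖b‖ * ‖c‖ := by
  rw [triple_apply]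
  calc _ ≤ ‖Γ‖ * (2 * ‖A a‖ * (2 * ‖B b‖ * ‖D c‖)) :=
        (norm_mulL_le _ _).trans (mul_le_mul_of_nonneg_left ((norm_mulH_le _ _).trans
          (mul_le_mul_of_nonneg_left (norm_mulH_le _ _) (by positivity))) (norm_nonneg _))
    _ ≤ ‖Γ‖ * (2 * (C * ‖a‖) * (2 * (C * ‖b‖) * (C * ‖c‖))) := by
        gcongr
        · exact hA a
        · exact hB b
        · exact hD c
    _ = _ := by ring

theorem norm_trilinear_le (M : E →L[ℝ] E →L[ℝ] E →L[ℝ] F) {C : ℝ} (hC : 0 ≤ C)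
    (h : ∀ a b c, ‖M a b c‖ ≤ C * ‖a‖ * ‖b‖ * ‖c‖) : ‖M‖ ≤ C :=
  M.opNorm_le_bound hC fun a => (M a).opNorm_le_bound (by positivity) fun b =>
    (M a b).opNorm_le_bound (by positivity) fun c => h a b c

end Trilinear

/-! ### Waves as trigonometric series -/

/-- A family of operators `L²(ℝ) → H¹(ℝ)` indexed by the wavenumber, with the decay of the
resolvents of a family `-d²/dy² + k² W`. -/
structure SmoothingFamily where
  /-- the operators -/
  op : ℕ → L2 →L[ℝ] H1
  /-- the constant in the bounds -/
  bound : ℝ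
  bound_nonneg : 0 ≤ bound
  op_zero : op 0 = 0
  mul_norm_op_le : ∀ (k : ℕ) f, k * ‖op k f‖ ≤ bound * ‖f‖
  sq_mul_norm_op_le : ∀ (k : ℕ) f, (k : ℝ) ^ 2 * ‖H1.fn (op k f)‖ ≤ bound * ‖f‖

namespace SmoothingFamily

variable (R : SmoothingFamily)

theorem norm_op_le (k : ℕ) (f : L2) : ‖R.op k f‖ ≤ R.bound * ‖f‖ := by
  rcases Nat.eq_zero_or_pos k with rfl | hk
  · rw [R.op_zero, zero_apply, norm_zero]
    exact mul_nonneg R.bound_nonneg (norm_nonneg f)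
  · refine le_trans ?_ (R.mul_norm_op_le k f)
    exact le_mul_of_one_le_left (norm_nonneg _) (by exact_mod_cast hk)

theorem norm_smul_op_le (k : ℕ) (f : L2) : ‖((k : ℝ) • R.op k) f‖ ≤ R.bound * ‖f‖ := by
  rw [smul_apply, norm_smul, Real.norm_of_nonneg k.cast_nonneg]
  exact R.mul_norm_op_le k f

theorem norm_smul_fn_op_le (k : ℕ) (f : L2) :
    ‖((k : ℝ) • H1.fn.comp (R.op k)) f‖ ≤ R.bound * ‖f‖ := by
  have h := R.norm_smul_op_le k f
  refine le_trans ?_ h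
  rw [smul_apply, smul_apply, ContinuousLinearMap.comp_apply, ← map_smul]
  exact H1.norm_fn_le _

theorem norm_sq_smul_fn_op_le (k : ℕ) (f : L2) :
    ‖(((k : ℝ) ^ 2) • H1.fn.comp (R.op k)) f‖ ≤ R.bound * ‖f‖ := by
  rw [smul_apply, norm_smul, Real.norm_of_nonneg (by positivity)]
  exact R.sq_mul_norm_op_le k f

theorem norm_neg_sq_smul_fn_op_le (k : ℕ) (f : L2) :
    ‖((-(k : ℝ) ^ 2) • H1.fn.comp (R.op k)) f‖ ≤ R.bound * ‖f‖ := by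
  rw [neg_smul, neg_apply, norm_neg]
  exact R.norm_sq_smul_fn_op_le k f

/-- The series `∑ sin(k x) R_k z_k`. -/
def profileSum : Ell1 L2 →L[ℝ] (ℝ →ᵇ H1) :=
  series sinWave norm_sinWave_le R.op R.bound R.norm_op_le

/-- The first derivative of the series `∑ sin(k x) R_k z_k`. -/
def profileSumX : Ell1 L2 →L[ℝ] (ℝ →ᵇ H1) :=
  series cosWave norm_cosWave_le (fun k => (k : ℝ) • R.op k) R.bound R.norm_smul_op_le

/-- The second derivative of the series `∑ sin(k x) R_k z_k`. -/
def profileSumXX : Ell1 L2 →L[ℝ] (ℝ →ᵇ L2) :=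
  series sinWave norm_sinWave_le (fun k => (-(k : ℝ) ^ 2) • H1.fn.comp (R.op k)) R.bound
    R.norm_neg_sq_smul_fn_op_le

theorem profileSum_single (k : ℕ) (a : L2) :
    R.profileSum (Ell1.single k a) = profile (sinWave k) (R.op k a) :=
  series_single norm_sinWave_le R.norm_op_le k a

theorem profileSumX_single (k : ℕ) (a : L2) :
    R.profileSumX (Ell1.single k a) = profile (cosWave k) ((k : ℝ) • R.op k a) :=
  series_single norm_cosWave_le R.norm_smul_op_le k a

theorem profileSumXX_single (k : ℕ) (a : L2) :
    R.profileSumXX (Ell1.single k a) =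
      profile (sinWave k) ((-(k : ℝ) ^ 2) • H1.fn (R.op k a)) :=
  series_single norm_sinWave_le R.norm_neg_sq_smul_fn_op_le k a

theorem isPeriodicWeakDeriv_profileSum (z : Ell1 L2) :
    IsPeriodicWeakDeriv (R.profileSum z) (R.profileSumX z) := by
  refine isPeriodicWeakDeriv_of_single (fun k a => ?_) z
  rw [profileSum_single, profileSumX_single]
  exact isPeriodicWeakDeriv_sin k (R.op k a)

theorem isPeriodicWeakDeriv_profileSumX (z : Ell1 L2) :
    IsPeriodicWeakDeriv (fun x => H1.fn (R.profileSumX z x)) (R.profileSumXX z) := by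
  have key := isPeriodicWeakDeriv_of_single
    -- The second derivative is taken in `L²(ℝ)`, so the series for `Φ_x` is first rebuilt with
    -- values in `L²`; its sums agree with the images of the `H¹` sums.
    (A := (series cosWave norm_cosWave_le (fun k => (k : ℝ) • H1.fn.comp (R.op k)) R.bound
      R.norm_smul_fn_op_le)) (B := R.profileSumXX) (fun k a => by
        rw [profileSumXX_single, series_single]
        exact isPeriodicWeakDeriv_cos k (H1.fn (R.op k a))) z
  convert! key using 1
  funext x
  have h1 := (hasSum_series norm_cosWave_le R.norm_smul_op_le z x).mapL H1.fn
  have h2 := hasSum_series norm_cosWave_le R.norm_smul_fn_op_le z x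
  exact h1.unique h2

/-- The wave `∑ sin(k x) R_k z_k`. -/
def wave : Ell1 L2 →L[ℝ] WaveSpace :=
  ((toCircle.comp R.profileSum).prod
    ((toCircle.comp R.profileSumX).prod (toCircle.comp R.profileSumXX))).codRestrict WaveSpace
    fun z => by
      refine ⟨.congr (coeFn_toCircle _) (coeFn_toCircle _) (R.isPeriodicWeakDeriv_profileSum z),
        .congr ?_ (coeFn_toCircle _) (R.isPeriodicWeakDeriv_profileSumX z)⟩
      filter_upwards [coeFn_toCircle (R.profileSumX z)] with x hx
      exact congrArg H1.fn hx

theorem fn_wave (z : Ell1 L2) : WaveSpace.fn (R.wave z) =ᵐ[circleMeasure] R.profileSum z :=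
  coeFn_toCircle _

theorem dx_wave (z : Ell1 L2) : WaveSpace.dx (R.wave z) =ᵐ[circleMeasure] R.profileSumX z :=
  coeFn_toCircle _

theorem dxx_wave (z : Ell1 L2) : WaveSpace.dxx (R.wave z) =ᵐ[circleMeasure] R.profileSumXX z :=
  coeFn_toCircle _

theorem hasSum_profileSum (z : Ell1 L2) (x : ℝ) :
    HasSum (fun k : ℕ => Real.sin (k * x) • R.op k (z k)) (R.profileSum z x) :=
  hasSum_series norm_sinWave_le R.norm_op_le z x

end SmoothingFamily

/-- The series `∑ sin(k x) z_k`. -/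
def sineSum : Ell1 L2 →L[ℝ] (ℝ →ᵇ L2) :=
  series sinWave norm_sinWave_le (fun _ => ContinuousLinearMap.id ℝ L2) 1
    fun _ a => (one_mul ‖a‖).ge

theorem sineSum_single (k : ℕ) (a : L2) : sineSum (Ell1.single k a) = profile (sinWave k) a :=
  series_single norm_sinWave_le _ k a

/-- The sine is odd. This lets the product formulas use negative frequencies without case
distinctions. -/
theorem sineSum_signed (n : ℤ) (a : L2) (x : ℝ) :
    sineSum (Ell1.signed n a) x = Real.sin (n * x) • a := by
  rw [Ell1.signed, smul_apply, map_smul, sineSum_single, BoundedContinuousFunction.smul_apply,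
    profile_apply, sinWave_apply, smul_smul]
  congr 1
  obtain ⟨m, rfl | rfl⟩ := n.eq_nat_or_neg
  · rcases Nat.eq_zero_or_pos m with rfl | hm
    · simp
    · simp [Int.sign_eq_one_of_pos (by exact_mod_cast hm : (0 : ℤ) < m)]
  · rcases Nat.eq_zero_or_pos m with rfl | hm
    · simp
    · simp [Int.sign_eq_one_of_pos (by exact_mod_cast hm : (0 : ℤ) < m)]

/-! ### The cubic nonlinearity -/

/-- The function `Γ (3 f² u + 6 f g²)`, with `f`, `g` and `u` in the roles of `Φ`, `Φ_x` and
`Φ_xx`. -/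
def cubic (Γ : LInf) (f g : H1) (u : L2) : L2 :=
  mulL Γ ((3 : ℝ) • mulH f (mulH f u) + (6 : ℝ) • mulH f (mulH g (H1.fn g)))

theorem inner_cubic (Γ : LInf) (f g : H1) (u ψ : L2) : inner ℝ (cubic Γ f g u) ψ =
    ∫ y, Γ y * (3 * H1.fn f y ^ 2 * u y + 6 * H1.fn f y * H1.fn g y ^ 2) * ψ y := by
  rw [cubic, inner_mulL]
  apply integral_congr_ae
  filter_upwards [Lp.coeFn_add ((3 : ℝ) • mulH f (mulH f u)) ((6 : ℝ) • mulH f (mulH g (H1.fn g))),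
    Lp.coeFn_smul (3 : ℝ) (mulH f (mulH f u)), Lp.coeFn_smul (6 : ℝ) (mulH f (mulH g (H1.fn g))),
    coeFn_mulH f (mulH f u), coeFn_mulH f u, coeFn_mulH f (mulH g (H1.fn g)),
    coeFn_mulH g (H1.fn g)] with y h1 h2 h3 h4 h5 h6 h7
  rw [h1, Pi.add_apply, h2, h3, Pi.smul_apply, Pi.smul_apply, h4, h5, h6, h7]
  simp only [smul_eq_mul]
  ring

/-- The frequencies generated by `-3 sin(jx) sin(kx) (sin(lx))_xx`. -/
def sineTriple (j k l : ℤ) : L2 →L[ℝ] Ell1 L2 :=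
  (3 / 4 : ℝ) • (Ell1.signed (j + k - l) + Ell1.signed (j - k + l) + Ell1.signed (-j + k + l)
    - Ell1.signed (j + k + l))

/-- The frequencies generated by `-6 sin(jx) cos(kx) cos(lx)`. -/
def cosineTriple (j k l : ℤ) : L2 →L[ℝ] Ell1 L2 :=
  (-(3 / 2) : ℝ) • (Ell1.signed (j + k + l) + Ell1.signed (j + k - l) + Ell1.signed (j - k + l)
    + Ell1.signed (j - k - l))

theorem norm_signed_four_le (n₁ n₂ n₃ n₄ : ℤ) (a : L2) :
    ‖Ell1.signed n₁ a‖ + ‖Ell1.signed n₂ a‖ + ‖Ell1.signed n₃ a‖ + ‖Ell1.signed n₄ a‖ ≤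
      4 * ‖a‖ := by
  linarith [Ell1.norm_signed_le n₁ a, Ell1.norm_signed_le n₂ a, Ell1.norm_signed_le n₃ a,
    Ell1.norm_signed_le n₄ a]

theorem norm_sineTriple_le (j k l : ℤ) (a : L2) : ‖sineTriple j k l a‖ ≤ 3 * ‖a‖ := by
  rw [sineTriple, smul_apply, norm_smul, Real.norm_of_nonneg (by norm_num)]
  have h := norm_signed_four_le (j + k - l) (j - k + l) (-j + k + l) (j + k + l) a
  have h' := (norm_sub_le (Ell1.signed (j + k - l) a + Ell1.signed (j - k + l) a +
    Ell1.signed (-j + k + l) a) (Ell1.signed (j + k + l) a)).trans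
    (add_le_add_left norm_add₃_le _)
  simp only [sub_apply, add_apply]
  linarith

theorem norm_cosineTriple_le (j k l : ℤ) (a : L2) : ‖cosineTriple j k l a‖ ≤ 6 * ‖a‖ := by
  rw [cosineTriple, smul_apply, norm_smul, norm_neg, Real.norm_of_nonneg (by norm_num)]
  have h := norm_signed_four_le (j + k + l) (j + k - l) (j - k + l) (j - k - l) a
  have h' := (norm_add_le (Ell1.signed (j + k + l) a + Ell1.signed (j + k - l) a +
    Ell1.signed (j - k + l) a) (Ell1.signed (j - k - l) a)).trans
    (add_le_add_left norm_add₃_le _)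
  simp only [add_apply]
  linarith

theorem sineSum_sineTriple (j k l : ℕ) (a : L2) (x : ℝ) : sineSum (sineTriple j k l a) x =
    (3 * Real.sin (j * x) * Real.sin (k * x) * Real.sin (l * x)) • a := by
  simp only [sineTriple, smul_apply, sub_apply, add_apply, map_smul, map_sub, map_add,
    BoundedContinuousFunction.smul_apply, BoundedContinuousFunction.sub_apply,
    BoundedContinuousFunction.add_apply, sineSum_signed]
  rw [← add_smul, ← add_smul, ← sub_smul, smul_smul]
  congr 1
  push_cast
  simp only [add_mul, sub_mul, neg_mul, Real.sin_add, Real.sin_sub, Real.cos_add, Real.cos_sub,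
    Real.sin_neg, Real.cos_neg]
  ring

theorem sineSum_cosineTriple (j k l : ℕ) (a : L2) (x : ℝ) : sineSum (cosineTriple j k l a) x =
    (-6 * Real.sin (j * x) * Real.cos (k * x) * Real.cos (l * x)) • a := by
  simp only [cosineTriple, smul_apply, add_apply, map_smul, map_add,
    BoundedContinuousFunction.smul_apply, BoundedContinuousFunction.add_apply, sineSum_signed]
  rw [← add_smul, ← add_smul, ← add_smul, smul_smul]
  congr 1
  push_cast
  simp only [add_mul, sub_mul, neg_mul, Real.sin_add, Real.sin_sub, Real.cos_add, Real.cos_sub]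
  ring

namespace SmoothingFamily

variable (R : SmoothingFamily)

/-- The coefficients of the cubic nonlinearity. -/
def cubicCoeff (Γ : LInf) (j k l : ℕ) : L2 →L[ℝ] L2 →L[ℝ] L2 →L[ℝ] Ell1 L2 :=
  postcomp₃ (sineTriple j k l) (triple Γ (R.op j) (R.op k) (((l : ℝ) ^ 2) • H1.fn.comp (R.op l)))
  + postcomp₃ (cosineTriple j k l)
      (triple Γ (R.op j) ((k : ℝ) • R.op k) ((l : ℝ) • H1.fn.comp (R.op l)))

/-- The factor `l²` falls on one resolvent, or `k` and `l` on two of them, which is exactly the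
decay available. The constant is `3·4 + 6·4`, from the frequency maps and the two embeddings into
`L^∞`. -/
theorem norm_cubicCoeff_le (Γ : LInf) (j k l : ℕ) :
    ‖R.cubicCoeff Γ j k l‖ ≤ 36 * ‖Γ‖ * R.bound ^ 3 := by
  have hC := R.bound_nonneg
  refine norm_trilinear_le _ (by positivity) fun a b c => ?_
  have h1 := norm_triple_le Γ hC (R.norm_op_le j) (R.norm_op_le k) (R.norm_sq_smul_fn_op_le l) a b c
  have h2 := norm_triple_le Γ hC (R.norm_op_le j) (R.norm_smul_op_le k) (R.norm_smul_fn_op_le l)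
    a b c
  rw [cubicCoeff, add_apply, add_apply, add_apply, postcomp₃_apply, postcomp₃_apply]
  have h3 := norm_sineTriple_le j k l
    (triple Γ (R.op j) (R.op k) (((l : ℝ) ^ 2) • H1.fn.comp (R.op l)) a b c)
  have h4 := norm_cosineTriple_le j k l
    (triple Γ (R.op j) ((k : ℝ) • R.op k) ((l : ℝ) • H1.fn.comp (R.op l)) a b c)
  refine (norm_add_le _ _).trans ?_
  linarith

theorem exists_cubicOp (Γ : LInf) : ∃ M : Ell1 L2 →L[ℝ] Ell1 L2 →L[ℝ] Ell1 L2 →L[ℝ] Ell1 L2,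
    ∀ j k l a b c, M (Ell1.single j a) (Ell1.single k b) (Ell1.single l c) =
      R.cubicCoeff Γ j k l a b c :=
  Ell1.exists_trilift (R.cubicCoeff Γ) (mul_nonneg (by positivity) (pow_nonneg R.bound_nonneg 3))
    (R.norm_cubicCoeff_le Γ)

/-- The cubic nonlinearity as a trilinear map on coefficient sequences. -/
def cubicOp (Γ : LInf) : Ell1 L2 →L[ℝ] Ell1 L2 →L[ℝ] Ell1 L2 →L[ℝ] Ell1 L2 :=
  Classical.choose (R.exists_cubicOp Γ)

theorem cubicOp_single (Γ : LInf) (j k l : ℕ) (a b c : L2) :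
    R.cubicOp Γ (Ell1.single j a) (Ell1.single k b) (Ell1.single l c) =
      R.cubicCoeff Γ j k l a b c :=
  Classical.choose_spec (R.exists_cubicOp Γ) j k l a b c

/-- Both sides are diagonals of bounded trilinear maps, which agree on single frequencies by the
product formulas. The minus sign places the nonlinearity on the right-hand side. -/
theorem sineSum_cubicOp (Γ : LInf) (z : Ell1 L2) (x : ℝ) : sineSum (R.cubicOp Γ z z z) x =
    -cubic Γ (R.profileSum z x) (R.profileSumX z x) (R.profileSumXX z x) := by
  set U := (BoundedContinuousFunction.evalCLM ℝ x).comp R.profileSum with hU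
  set Ux := (BoundedContinuousFunction.evalCLM ℝ x).comp R.profileSumX with hUx
  set Uxx := (BoundedContinuousFunction.evalCLM ℝ x).comp R.profileSumXX with hUxx
  have key : postcomp₃ ((BoundedContinuousFunction.evalCLM ℝ x).comp sineSum) (R.cubicOp Γ) =
      (-3 : ℝ) • triple Γ U U Uxx + (-6 : ℝ) • triple Γ U Ux (H1.fn.comp Ux) := by
    refine Ell1.ext_single₃ fun j k l a b c => ?_
    simp only [postcomp₃_apply, add_apply, smul_apply, triple_apply, cubicOp_single,
      ContinuousLinearMap.comp_apply, cubicCoeff, profileSum_single, profileSumX_single,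
      profileSumXX_single, map_add, hU, hUx, hUxx, BoundedContinuousFunction.evalCLM_apply,
      sineSum_sineTriple, sineSum_cosineTriple, profile_apply, sinWave_apply, cosWave_apply,
      map_smul, smul_smul]
    congr 2 <;> ring
  have := congrArg (fun T => T z z z) key
  simp only [postcomp₃_apply, add_apply, smul_apply, triple_apply, ContinuousLinearMap.comp_apply,
    hU, hUx, hUxx, BoundedContinuousFunction.evalCLM_apply] at this
  rw [this, cubic, map_add, map_smul, map_smul, neg_smul, neg_smul, neg_add]

end SmoothingFamily

/-! ### Weak solutions -/

theorem integral_one_sub_mul (V0 : LInf) (lam : ℝ) (f g : L2) :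
    ∫ y, (1 - lam * V0 y) * f y * g y = inner ℝ (f - lam • mulL V0 f) g := by
  rw [inner_eq_integral]
  apply integral_congr_ae
  filter_upwards [Lp.coeFn_sub f (lam • mulL V0 f), Lp.coeFn_smul lam (mulL V0 f),
    coeFn_mulL V0 f] with y h1 h2 h3
  rw [h1, Pi.sub_apply, h2, Pi.smul_apply, h3, smul_eq_mul]
  ring

theorem schrodingerForm_eq_inner (V0 : LInf) (V1 : H1 →L[ℝ] StrongDual ℝ H1) (k : ℕ) (lam : ℝ)
    (φ ψ : H1) : schrodingerForm V0 V1 k lam φ ψ = inner ℝ (H1.der φ) (H1.der ψ) +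
      (k : ℝ) ^ 2 * (inner ℝ (H1.fn φ - lam • mulL V0 (H1.fn φ)) (H1.fn ψ) - V1 φ ψ) := by
  rw [schrodingerForm, integral_one_sub_mul, inner_eq_integral (H1.der φ)]

theorem integral_energy_density (V0 : LInf) (lam : ℝ) (f g : H1) (u : L2) :
    ∫ y, (H1.der f y * H1.der g y - (1 - lam * V0 y) * u y * H1.fn g y) =
      inner ℝ (H1.der f) (H1.der g) - inner ℝ (u - lam • mulL V0 u) (H1.fn g) := by
  rw [integral_sub (integrable_L2_mul _ (Lp.memLp _)) (integrable_LInf_mul _ _ _ _),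
    integral_one_sub_mul, inner_eq_integral (H1.der f)]

/-- The weak derivative is tested with `cos(kx)`. This transfers the `x`-derivative from the test
function in the `V₁` term and yields the factor `k²` of `L^k`. -/
theorem cos_smul_integral_eq {E : Type*} [NormedAddCommGroup E] [NormedSpace ℝ E] {u v : ℝ → E}
    (h : IsPeriodicWeakDeriv u v) (k : ℕ) :
    (k : ℝ) • ∫ x, cosWave k x • v x ∂circleMeasure =
      ((k : ℝ) ^ 2) • ∫ x, sinWave k x • u x ∂circleMeasure := by
  have h1 := h (fun x => Real.cos (k * x)) (by fun_prop) fun x => by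
    beta_reduce
    rw [mul_add, Real.cos_add_nat_mul_two_pi]
  have h2 : deriv (fun x : ℝ => Real.cos (k * x)) = fun x => -(k * Real.sin (k * x)) :=
    funext fun x => (hasDerivAt_cos_mul k x).deriv
  rw [h2] at h1
  simp only [neg_smul, mul_smul, integral_neg, integral_smul, neg_inj] at h1
  simp only [cosWave_apply, sinWave_apply]
  rw [← h1, smul_smul, sq]

/-- The form `(φ, ψ) ↦ ∫ φ' ψ'`. -/
def derForm : H1 →L[ℝ] H1 →L[ℝ] ℝ := (innerSL ℝ).bilinearComp H1.der H1.der

/-- The form `(f, ψ) ↦ ∫ (1 - λ V₀) f ψ`. -/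
def weightForm (V0 : LInf) (lam : ℝ) : L2 →L[ℝ] H1 →L[ℝ] ℝ :=
  (innerSL ℝ).bilinearComp (ContinuousLinearMap.id ℝ L2 - lam • mulL V0) H1.fn

/-- The form `(f, ψ) ↦ ∫ f ψ`. -/
def pairForm : L2 →L[ℝ] H1 →L[ℝ] ℝ :=
  (innerSL ℝ).bilinearComp (ContinuousLinearMap.id ℝ L2) H1.fn

theorem derForm_apply (φ ψ : H1) : derForm φ ψ = inner ℝ (H1.der φ) (H1.der ψ) := rfl

theorem weightForm_apply (V0 : LInf) (lam : ℝ) (f : L2) (ψ : H1) :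
    weightForm V0 lam f ψ = inner ℝ (f - lam • mulL V0 f) (H1.fn ψ) := rfl

theorem pairForm_apply (f : L2) (ψ : H1) : pairForm f ψ = inner ℝ f (H1.fn ψ) := rfl

/-- The action of an operator on the component `n` of a sequence. -/
def compAt (n : ℕ) (P : L2 →L[ℝ] L2) : Ell1 L2 →L[ℝ] Ell1 L2 :=
  (Ell1.single n).comp (P.comp (Ell1.eval n))

theorem compAt_apply (n : ℕ) (P : L2 →L[ℝ] L2) (z : Ell1 L2) :
    compAt n P z = Ell1.single n (P (z n)) := rfl

theorem compAt_single_self (n : ℕ) (P : L2 →L[ℝ] L2) (a : L2) :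
    compAt n P (Ell1.single n a) = Ell1.single n (P a) := by
  rw [compAt_apply, Ell1.single_apply_self]

theorem compAt_single_ne {n k : ℕ} (h : n ≠ k) (P : L2 →L[ℝ] L2) (a : L2) :
    compAt n P (Ell1.single k a) = 0 := by
  rw [compAt_apply, Ell1.single_apply_ne h, map_zero, map_zero]

namespace SmoothingFamily

variable (R : SmoothingFamily)

theorem norm_potential_le (V0 : LInf) (k : ℕ) (a : L2) :
    ‖((Ell1.single k).comp ((mulL V0).comp (((k : ℝ) ^ 2) • H1.fn.comp (R.op k)))) a‖ ≤
      ‖V0‖ * R.bound * ‖a‖ := by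
  rw [ContinuousLinearMap.comp_apply, Ell1.norm_single, mul_assoc]
  exact (norm_mulL_le _ _).trans
    (mul_le_mul_of_nonneg_left (R.norm_sq_smul_fn_op_le k a) (norm_nonneg _))

/-- The operator `z ↦ (k² V₀ R_k z_k)`. -/
def potential (V0 : LInf) : Ell1 L2 →L[ℝ] Ell1 L2 :=
  Ell1.lift _ (‖V0‖ * R.bound) (R.norm_potential_le V0)

theorem potential_single (V0 : LInf) (k : ℕ) (a : L2) : R.potential V0 (Ell1.single k a) =
    Ell1.single k (mulL V0 (((k : ℝ) ^ 2) • H1.fn (R.op k a))) :=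
  Ell1.lift_single (R.norm_potential_le V0) k a

variable {R} {V0 : LInf} {V1 : H1 →L[ℝ] StrongDual ℝ H1} {kstar : ℕ} {lamstar : ℝ}
  {P : L2 →L[ℝ] L2}

/-- At frequency 0 no resolvent identity is available, but then the sine coefficient `X` of the test
function vanishes. -/
theorem pairForm_ite_eq_schrodingerForm
    (hR : ∀ k, 1 ≤ k → k ≠ kstar → ∀ f ψ,
      schrodingerForm V0 V1 k lamstar (R.op k f) ψ = inner ℝ f (H1.fn ψ))
    (hR' : ∀ f ψ, schrodingerForm V0 V1 kstar lamstar (R.op kstar f) ψ =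
      inner ℝ (f - P f) (H1.fn ψ)) (k : ℕ) (a : L2) (X : H1) (hX : k = 0 → X = 0) :
    pairForm (if k = kstar then a - P a else a) X =
      schrodingerForm V0 V1 k lamstar (R.op k a) X := by
  rw [pairForm_apply]
  split_ifs with h
  · rw [h, hR']
  · rcases Nat.eq_zero_or_pos k with h0 | h0
    · rw [hX h0, map_zero, inner_zero_right, schrodingerForm_eq_inner]
      simp
    · exact (hR k h0 h a X).symm

/-- Frequency by frequency the linear terms are `L_{λ*}^k R_k z_k` minus the perturbation `σk²V₀R_k
z_k`, paired with the sine coefficient of `Ψ`. At `k*` the bordered inverse leaves `z - Pz`. -/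
theorem circlePairing_wave
    (hR : ∀ k, 1 ≤ k → k ≠ kstar → ∀ f ψ,
      schrodingerForm V0 V1 k lamstar (R.op k f) ψ = inner ℝ f (H1.fn ψ))
    (hR' : ∀ f ψ, schrodingerForm V0 V1 kstar lamstar (R.op kstar f) ψ =
      inner ℝ (f - P f) (H1.fn ψ))
    {Ψ Ψx : L2H1} (h : IsPeriodicWeakDeriv Ψ Ψx) (σ : ℝ) (z : Ell1 L2) :
    circlePairing derForm Ψ (R.profileSum z)
        - circlePairing (weightForm V0 (lamstar + σ)) Ψ (R.profileSumXX z)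
        - circlePairing V1 Ψx (R.profileSumX z) =
      circlePairing pairForm Ψ (sineSum (z - compAt kstar P z - σ • R.potential V0 z)) := by
  have key : (circlePairing derForm Ψ).comp R.profileSum
        - (circlePairing (weightForm V0 (lamstar + σ)) Ψ).comp R.profileSumXX
        - (circlePairing V1 Ψx).comp R.profileSumX =
      (circlePairing pairForm Ψ).comp (sineSum.comp
        (ContinuousLinearMap.id ℝ (Ell1 L2) - compAt kstar P - σ • R.potential V0)) := by
    refine Ell1.ext_single fun k a => ?_
    set X := ∫ x, sinWave k x • Ψ x ∂circleMeasure with hX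
    have hX0 : k = 0 → X = 0 := by
      rintro rfl
      simp [hX, sinWave_apply]
    have h1 : Ell1.single k a - compAt kstar P (Ell1.single k a) =
        Ell1.single k (if k = kstar then a - P a else a) := by
      split_ifs with hk
      · rw [hk, compAt_single_self, map_sub]
      · rw [compAt_single_ne (Ne.symm hk), sub_zero]
    simp only [sub_apply, smul_apply, ContinuousLinearMap.comp_apply, ContinuousLinearMap.id_apply,
      h1, potential_single, profileSum_single, profileSumX_single, profileSumXX_single]
    rw [← map_smul (Ell1.single k), ← map_sub (Ell1.single k), sineSum_single,
      circlePairing_profile, circlePairing_profile, circlePairing_profile, circlePairing_profile,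
      map_sub, sub_apply, ← hX, pairForm_ite_eq_schrodingerForm hR hR' k a X hX0, map_smul V1, smul_apply,
      ← map_smul (V1 _), cos_smul_integral_eq h, ← hX, schrodingerForm_eq_inner]
    simp only [derForm_apply, weightForm_apply, pairForm_apply, map_smul, smul_apply,
      smul_eq_mul, inner_sub_left, inner_smul_left, RCLike.conj_to_real]
    ring
  exact congrArg (fun T => T z) key

/-- Reduces the weak equation to an identity between sequences in `ℓ¹`, to which the abstract
bifurcation argument applies. -/
theorem isWeakSolution_wave {Γ : LInf}
    (hR : ∀ k, 1 ≤ k → k ≠ kstar → ∀ f ψ,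
      schrodingerForm V0 V1 k lamstar (R.op k f) ψ = inner ℝ f (H1.fn ψ))
    (hR' : ∀ f ψ, schrodingerForm V0 V1 kstar lamstar (R.op kstar f) ψ =
      inner ℝ (f - P f) (H1.fn ψ)) {σ : ℝ} {z : Ell1 L2}
    (hz : z - compAt kstar P z = σ • R.potential V0 z + R.cubicOp Γ z z z) :
    IsWeakSolution V0 V1 Γ (lamstar + σ) (R.wave z) := by
  intro Ψ Ψx h
  have h1 : (∫ x, (∫ y, (H1.der (WaveSpace.fn (R.wave z) x) y * H1.der (Ψ x) y
        - (1 - (lamstar + σ) * V0 y) * WaveSpace.dxx (R.wave z) x y * H1.fn (Ψ x) y))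
          ∂circleMeasure) = circlePairing derForm Ψ (R.profileSum z)
        - circlePairing (weightForm V0 (lamstar + σ)) Ψ (R.profileSumXX z) := by
    rw [circlePairing_apply, circlePairing_apply, ← integral_sub (integrable_circlePairing _ _ _)
      (integrable_circlePairing _ _ _)]
    apply integral_congr_ae
    filter_upwards [R.fn_wave z, R.dxx_wave z] with x e1 e2
    rw [e1, e2, integral_energy_density]
    rfl
  have h2 : ∫ x, V1 (WaveSpace.dx (R.wave z) x) (Ψx x) ∂circleMeasure =
      circlePairing V1 Ψx (R.profileSumX z) := by
    rw [circlePairing_apply]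
    apply integral_congr_ae
    filter_upwards [R.dx_wave z] with x e1
    rw [e1]
  have h3 : (∫ x, (∫ y, Γ y * (3 * H1.fn (WaveSpace.fn (R.wave z) x) y ^ 2
        * WaveSpace.dxx (R.wave z) x y + 6 * H1.fn (WaveSpace.fn (R.wave z) x) y
        * H1.fn (WaveSpace.dx (R.wave z) x) y ^ 2) * H1.fn (Ψ x) y) ∂circleMeasure) =
      -circlePairing pairForm Ψ (sineSum (R.cubicOp Γ z z z)) := by
    rw [circlePairing_apply, ← integral_neg]
    apply integral_congr_ae
    filter_upwards [R.fn_wave z, R.dx_wave z, R.dxx_wave z] with x e1 e2 e3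
    rw [e1, e2, e3, ← inner_cubic, sineSum_cubicOp, pairForm_apply, inner_neg_left, neg_neg]
  rw [h1, h2, h3, circlePairing_wave hR hR' h, hz, add_sub_cancel_left, add_neg_cancel]

end SmoothingFamily

/-! ### Bifurcation from a simple eigenvalue for a cubic equation -/

section Branch

variable {Z : Type*} [NormedAddCommGroup Z] [NormedSpace ℝ Z]

/-- The right-hand side `σ V y + τ M(y, y, y)` at `y = e + w`, for `v = (τ, w, σ)`. -/
def branchRhs (V : Z →L[ℝ] Z) (M : Z →L[ℝ] Z →L[ℝ] Z →L[ℝ] Z) (e : Z) (v : ℝ × Z × ℝ) : Z :=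
  v.2.2 • V (e + v.2.1) + v.1 • M (e + v.2.1) (e + v.2.1) (e + v.2.1)

/-- The Lyapunov-Schmidt system for `w` and `σ`. -/
def branchMap (K V : Z →L[ℝ] Z) (ℓ : Z →L[ℝ] ℝ) (M : Z →L[ℝ] Z →L[ℝ] Z →L[ℝ] Z) (e : Z)
    (v : ℝ × Z × ℝ) : Z × ℝ :=
  (v.2.1 - (branchRhs V M e v - K (branchRhs V M e v)), ℓ (branchRhs V M e v))

theorem contDiff_cubic {n : WithTop ℕ∞} (M : Z →L[ℝ] Z →L[ℝ] Z →L[ℝ] Z) :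
    ContDiff ℝ n fun y => M y y y :=
  (M.contDiff.clm_apply contDiff_id).clm_apply contDiff_id

theorem contDiff_branchRhs (V : Z →L[ℝ] Z) (M : Z →L[ℝ] Z →L[ℝ] Z →L[ℝ] Z) (e : Z)
    {n : WithTop ℕ∞} : ContDiff ℝ n (branchRhs V M e) := by
  have hy : ContDiff ℝ n fun v : ℝ × Z × ℝ => e + v.2.1 := by fun_prop
  exact ((contDiff_snd.comp contDiff_snd).smul (V.contDiff.comp hy)).add
    (contDiff_fst.smul ((contDiff_cubic M).comp hy))

theorem contDiff_branchMap (K V : Z →L[ℝ] Z) (ℓ : Z →L[ℝ] ℝ) (M : Z →L[ℝ] Z →L[ℝ] Z →L[ℝ] Z)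
    (e : Z) {n : WithTop ℕ∞} : ContDiff ℝ n (branchMap K V ℓ M e) := by
  have h := contDiff_branchRhs V M e (n := n)
  exact ((contDiff_fst.comp contDiff_snd).sub (h.sub (K.contDiff.comp h))).prodMk
    (ℓ.contDiff.comp h)

/-- The derivative of the Lyapunov-Schmidt system in `(w, σ)`. -/
def branchDeriv (a : Z) (d : ℝ) : (Z × ℝ) →L[ℝ] Z × ℝ :=
  (ContinuousLinearMap.fst ℝ Z ℝ - (ContinuousLinearMap.snd ℝ Z ℝ).smulRight a).prod
    (d • ContinuousLinearMap.snd ℝ Z ℝ)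

theorem branchDeriv_isInvertible (a : Z) {d : ℝ} (hd : d ≠ 0) : (branchDeriv a d).IsInvertible := by
  refine ⟨ContinuousLinearEquiv.equivOfInverse (branchDeriv a d)
    ((ContinuousLinearMap.fst ℝ Z ℝ + (ContinuousLinearMap.snd ℝ Z ℝ).smulRight (d⁻¹ • a)).prod
      (d⁻¹ • ContinuousLinearMap.snd ℝ Z ℝ)) (fun v => ?_) (fun v => ?_), rfl⟩
  · ext
    · simp only [branchDeriv, ContinuousLinearMap.prod_apply, add_apply, sub_apply, smul_apply,
        ContinuousLinearMap.smulRight_apply, ContinuousLinearMap.coe_fst',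
        ContinuousLinearMap.coe_snd', smul_smul, smul_eq_mul]
      rw [mul_right_comm, mul_inv_cancel₀ hd, one_mul, sub_add_cancel]
    · simp [branchDeriv, hd]
  · ext
    · simp [branchDeriv, smul_smul, mul_comm]
    · simp [branchDeriv, hd]

/-- At `τ = 0` the cubic term is absent, and `σV(e + w)` is linear at the origin up to a product of
small quantities. The derivative is triangular, with pivot `ℓ(Ve)`. -/
theorem hasFDerivAt_branchMap (K V : Z →L[ℝ] Z) (ℓ : Z →L[ℝ] ℝ) (M : Z →L[ℝ] Z →L[ℝ] Z →L[ℝ] Z)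
    (e : Z) : HasFDerivAt (fun w : Z × ℝ => branchMap K V ℓ M e (0, w))
      (branchDeriv (V e - K (V e)) (ℓ (V e))) 0 := by
  have h1 : HasFDerivAt (fun w : Z × ℝ => e + w.1) (ContinuousLinearMap.fst ℝ Z ℝ) 0 :=
    hasFDerivAt_fst.const_add e
  have h2 : HasFDerivAt (fun w : Z × ℝ => w.2) (ContinuousLinearMap.snd ℝ Z ℝ) 0 := hasFDerivAt_snd
  have h3 := h2.smul (V.hasFDerivAt.comp (0 : Z × ℝ) h1)
  have h4 : HasFDerivAt (fun w : Z × ℝ => branchRhs V M e (0, w))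
      ((ContinuousLinearMap.snd ℝ Z ℝ).smulRight (V e)) 0 := by
    convert! h3 using 1
    · funext w
      simp [branchRhs]
    · ext w <;> simp
  have h5 := (hasFDerivAt_fst.sub (h4.sub (K.hasFDerivAt.comp (0 : Z × ℝ) h4))).prodMk
    (ℓ.hasFDerivAt.comp (0 : Z × ℝ) h4)
  convert! h5 using 1
  ext w <;> simp [branchDeriv]

/-- Lyapunov-Schmidt reduction with `y = e + w`: the complement equation determines `w`, the
solvability condition `ℓ = 0` determines `σ`, and `τ` is the parameter. -/
theorem exists_branch [CompleteSpace Z] {K V : Z →L[ℝ] Z} {ℓ : Z →L[ℝ] ℝ}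
    (M : Z →L[ℝ] Z →L[ℝ] Z →L[ℝ] Z) {e : Z} (hKe : K e = e) (hK : ∀ z, ℓ z = 0 → K z = 0)
    (hd : ℓ (V e) ≠ 0) :
    ∃ (y : ℝ → Z) (σ : ℝ → ℝ), y 0 = e ∧ σ 0 = 0 ∧
      (∀ᶠ τ in 𝓝 (0 : ℝ), ContDiffAt ℝ ∞ y τ ∧ ContDiffAt ℝ ∞ σ τ ∧
        y τ - K (y τ) = σ τ • V (y τ) + τ • M (y τ) (y τ) (y τ)) ∧
      deriv σ 0 * ℓ (V e) + ℓ (M e e e) = 0 := by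
  -- Analyticity at a point persists nearby, whereas `ContDiffAt` of order `∞` need not; this gives
  -- smoothness on a whole neighbourhood.
  have hf : ContDiffAt ℝ ω (branchMap K V ℓ M e) (0, 0) := (contDiff_branchMap K V ℓ M e).contDiffAt
  have hcomp : HasFDerivAt (fun w : Z × ℝ => branchMap K V ℓ M e (0, w))
      (fderiv ℝ (branchMap K V ℓ M e) (0, 0) ∘L .inr ℝ ℝ (Z × ℝ)) 0 :=
    (hf.differentiableAt (by simp)).hasFDerivAt.comp (0 : Z × ℝ)
      (ContinuousLinearMap.inr ℝ ℝ (Z × ℝ)).hasFDerivAt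
  have hinv : (fderiv ℝ (branchMap K V ℓ M e) (0, 0) ∘L .inr ℝ ℝ (Z × ℝ)).IsInvertible := by
    rw [hcomp.unique (hasFDerivAt_branchMap K V ℓ M e)]
    exact branchDeriv_isInvertible _ hd
  set ξ := hf.implicitFunction (by simp) hinv with hξ
  have hξ0 : ξ 0 = 0 := hf.implicitFunction_apply_self (by simp) hinv
  have hξc : ContDiffAt ℝ ω ξ 0 := hf.contDiffAt_implicitFunction (by simp) hinv
  have hξe : ∀ᶠ τ in 𝓝 (0 : ℝ), branchMap K V ℓ M e (τ, ξ τ) = 0 := by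
    have := hf.eventually_apply_implicitFunction (by simp) hinv
    simpa [branchMap, branchRhs] using this
  have hy : ∀ {n : WithTop ℕ∞} {τ : ℝ}, ContDiffAt ℝ n ξ τ →
      ContDiffAt ℝ n (fun τ => e + (ξ τ).1) τ := fun h => contDiffAt_const.add h.fst
  refine ⟨fun τ => e + (ξ τ).1, fun τ => (ξ τ).2, by simp [hξ0], by simp [hξ0], ?_, ?_⟩
  · filter_upwards [hξe, hξc.eventually (by simp)] with τ h1 h2
    refine ⟨(hy h2).of_le le_top, h2.snd.of_le le_top, ?_⟩
    have e1 := congrArg Prod.fst h1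
    have e2 := congrArg Prod.snd h1
    simp only [branchMap, Prod.fst_zero, Prod.snd_zero] at e1 e2
    -- The solvability condition gives `K` of the right-hand side equal to 0. Hence `w` is that
    -- right-hand side and `Kw = 0`.
    rw [hK _ e2, sub_zero, sub_eq_zero] at e1
    change e + (ξ τ).1 - K (e + (ξ τ).1) = branchRhs V M e (τ, ξ τ)
    rw [map_add, hKe, add_sub_add_left_eq_sub, e1, hK _ e2, sub_zero]
  · have hD : DifferentiableAt ℝ ξ 0 := hξc.differentiableAt (by simp)
    have hyD : DifferentiableAt ℝ (fun τ => e + (ξ τ).1) 0 :=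
      (hy hξc).differentiableAt (by simp)
    have hσD : HasDerivAt (fun τ => (ξ τ).2) (deriv (fun τ => (ξ τ).2) 0) 0 :=
      (hξc.snd.differentiableAt (by simp)).hasDerivAt
    have hV : DifferentiableAt ℝ (fun τ => V (e + (ξ τ).1)) 0 := V.differentiableAt.comp 0 hyD
    have hM : DifferentiableAt ℝ
        (fun τ => M (e + (ξ τ).1) (e + (ξ τ).1) (e + (ξ τ).1)) 0 :=
      DifferentiableAt.comp (g := fun y => M y y y) (0 : ℝ)
        (((contDiff_cubic M (n := 1)).differentiable (by simp)) (e + (ξ 0).1)) hyD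
    -- The solvability condition is differentiated in `τ` at 0. Since `σ(0) = 0` and `τ = 0`, the
    -- derivative of `y` drops out.
    have h1 := (ℓ.hasFDerivAt.comp_hasDerivAt (0 : ℝ)
      ((hσD.smul hV.hasDerivAt).add ((hasDerivAt_id (0 : ℝ)).smul hM.hasDerivAt)))
    have h2 : HasDerivAt (fun τ => ℓ (branchRhs V M e (τ, ξ τ))) 0 0 := by
      refine (hasDerivAt_const (0 : ℝ) (0 : ℝ)).congr_of_eventuallyEq ?_
      filter_upwards [hξe] with τ h
      exact congrArg Prod.snd h
    have h3 := h1.unique h2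
    simpa [hξ0] using h3

end Branch

/-! ### Derivatives of functions of `ε²` -/

theorem hasDerivAt_even {σ : ℝ → ℝ} {ε : ℝ} (h : DifferentiableAt ℝ σ (ε ^ 2)) (c : ℝ) :
    HasDerivAt (fun ε => c + σ (ε ^ 2)) (deriv σ (ε ^ 2) * (2 * ε)) ε := by
  have h1 : HasDerivAt (fun ε : ℝ => ε ^ 2) (2 * ε) ε := by simpa using hasDerivAt_pow 2 ε
  exact (HasDerivAt.comp (h₂ := σ) (h := fun ε : ℝ => ε ^ 2) ε h.hasDerivAt h1).const_add c

theorem deriv_even_zero {σ : ℝ → ℝ} (h : ContDiffAt ℝ 2 σ 0) (c : ℝ) :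
    deriv (fun ε => c + σ (ε ^ 2)) 0 = 0 := by
  have := (hasDerivAt_even (σ := σ) (ε := 0) (by simpa using h.differentiableAt (by simp)) c).deriv
  simpa using this

theorem iteratedDeriv_two_even_zero {σ : ℝ → ℝ} (h : ContDiffAt ℝ 2 σ 0) (c : ℝ) :
    iteratedDeriv 2 (fun ε => c + σ (ε ^ 2)) 0 = 2 * deriv σ 0 := by
  rw [iteratedDeriv_succ, iteratedDeriv_one]
  have hsq : Filter.Tendsto (fun ε : ℝ => ε ^ 2) (𝓝 0) (𝓝 0) := by
    simpa using (continuous_pow 2).tendsto (0 : ℝ)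
  have h1 : deriv (fun ε => c + σ (ε ^ 2)) =ᶠ[𝓝 0] fun ε => deriv σ (ε ^ 2) * (2 * ε) := by
    filter_upwards [hsq.eventually (h.eventually (by simp))] with ε hε
    exact (hasDerivAt_even (hε.differentiableAt (by simp)) c).deriv
  rw [h1.deriv_eq]
  have h2 : DifferentiableAt ℝ (deriv σ) (0 ^ 2) := by
    rw [zero_pow two_ne_zero]
    have h0 : ContDiffAt ℝ 1 (fun x => fderiv ℝ σ x 1) 0 :=
      (h.fderiv_right (m := 1) (by norm_num)).clm_apply contDiffAt_const
    simpa only [fderiv_apply_one_eq_deriv] using h0.differentiableAt (by simp)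
  have h3 : DifferentiableAt ℝ (fun ε : ℝ => deriv σ (ε ^ 2)) 0 :=
    DifferentiableAt.comp (g := deriv σ) (f := fun ε : ℝ => ε ^ 2) (0 : ℝ) h2
      (differentiableAt_pow 2)
  have h4 := h3.hasDerivAt.mul ((hasDerivAt_id (0 : ℝ)).const_mul 2)
  rw [show (fun ε => deriv σ (ε ^ 2) * (2 * ε)) =
    (fun ε : ℝ => deriv σ (ε ^ 2)) * fun ε => 2 * id ε from rfl, h4.deriv]
  simp [mul_comm]

/-! ### The bifurcating branch -/

theorem Ell1.signed_natCast_apply {E : Type*} [NormedAddCommGroup E] [NormedSpace ℝ E] {k : ℕ}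
    (hk : 1 ≤ k) (a : E) : (Ell1.signed (k : ℤ) a) k = a := by
  rw [Ell1.signed, Int.sign_eq_one_of_pos (by exact_mod_cast hk), Int.natAbs_natCast, Int.cast_one,
    one_smul, Ell1.single_apply_self]

theorem Ell1.signed_neg {E : Type*} [NormedAddCommGroup E] [NormedSpace ℝ E] (n : ℤ) (a : E) :
    Ell1.signed (-n) a = -Ell1.signed n a := by
  simp [Ell1.signed]

theorem Ell1.signed_apply_of_natAbs_ne {E : Type*} [NormedAddCommGroup E] [NormedSpace ℝ E] {n : ℤ}
    {k : ℕ} (h : k ≠ n.natAbs) (a : E) : (Ell1.signed n a) k = 0 := by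
  rw [Ell1.signed, smul_apply]
  change (n.sign : ℝ) • (Ell1.single n.natAbs a) k = 0
  rw [Ell1.single_apply_ne h, smul_zero]

/-- Three of the four frequencies equal `k`; the fourth is `3k` and does not contribute. -/
theorem sineTriple_self_apply {k : ℕ} (hk : 1 ≤ k) (a : L2) :
    (sineTriple k k k a) k = (9 / 4 : ℝ) • a := by
  have h3 : (Ell1.signed ((k : ℤ) + k + k) a) k = 0 :=
    Ell1.signed_apply_of_natAbs_ne (by omega) a
  have h1 := Ell1.signed_natCast_apply hk a
  simp only [sineTriple, smul_apply, sub_apply, add_apply, add_sub_cancel_right, sub_self, zero_add,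
    neg_add_cancel]
  change (3 / 4 : ℝ) • ((Ell1.signed (k : ℤ) a) k + (Ell1.signed (k : ℤ) a) k
    + (Ell1.signed (k : ℤ) a) k - (Ell1.signed ((k : ℤ) + k + k) a) k) = _
  rw [h1, h3]
  module

/-- The frequencies are `3k`, `k`, `k` and `-k`. The last has a negative sign and cancels one of the
two contributions. -/
theorem cosineTriple_self_apply {k : ℕ} (hk : 1 ≤ k) (a : L2) :
    (cosineTriple k k k a) k = (-(3 / 2) : ℝ) • a := by
  have h3 : (Ell1.signed ((k : ℤ) + k + k) a) k = 0 :=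
    Ell1.signed_apply_of_natAbs_ne (by omega) a
  have h1 := Ell1.signed_natCast_apply hk a
  simp only [cosineTriple, smul_apply, add_apply, add_sub_cancel_right, sub_self, zero_add,
    zero_sub, Ell1.signed_neg]
  change (-(3 / 2) : ℝ) • ((Ell1.signed ((k : ℤ) + k + k) a) k + (Ell1.signed (k : ℤ) a) k
    + (Ell1.signed (k : ℤ) a) k + -(Ell1.signed (k : ℤ) a) k) = _
  rw [h1, h3]
  module

theorem inner_mulL_mulH (Γ : LInf) (φ : H1) :
    inner ℝ (H1.fn φ) (mulL Γ (mulH φ (mulH φ (H1.fn φ)))) = ∫ y, Γ y * H1.fn φ y ^ 4 := by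
  rw [real_inner_comm, inner_mulL]
  apply integral_congr_ae
  filter_upwards [coeFn_mulH φ (mulH φ (H1.fn φ)), coeFn_mulH φ (H1.fn φ)] with y h1 h2
  rw [h1, h2]
  ring

theorem inner_mulL_self (V : LInf) (φ : H1) :
    inner ℝ (H1.fn φ) (mulL V (H1.fn φ)) = ∫ y, V y * H1.fn φ y ^ 2 := by
  rw [real_inner_comm, inner_mulL]
  congr 1 with y
  ring

namespace SmoothingFamily

variable {R : SmoothingFamily} {V0 Γ : LInf} {V1 : H1 →L[ℝ] StrongDual ℝ H1} {kstar : ℕ}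
  {lamstar : ℝ} {φstar : H1}

/-- On `(0, π/k*)`, a set of positive measure, `sin(k*x)` is positive. -/
theorem wave_single_ne_zero (hk : 1 ≤ kstar) (hφ : φstar ≠ 0)
    (hop : R.op kstar (H1.fn φstar) = φstar) : R.wave (Ell1.single kstar (H1.fn φstar)) ≠ 0 := by
  intro h0
  have h1 := R.fn_wave (Ell1.single kstar (H1.fn φstar))
  rw [profileSum_single, hop, h0] at h1
  have h2 : (fun _ => (0 : H1)) =ᵐ[circleMeasure] profile (sinWave kstar) φstar :=
    (Lp.coeFn_zero H1 2 circleMeasure).symm.trans h1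
  have hk0 : (0 : ℝ) < kstar := by exact_mod_cast hk
  have hk1 : (1 : ℝ) ≤ kstar := by exact_mod_cast hk
  have hπ : 0 < Real.pi / kstar := by positivity
  have hsub : Ioo 0 (Real.pi / kstar) ⊆ Ioc (-Real.pi) Real.pi := fun x hx =>
    ⟨by linarith [hx.1, Real.pi_pos], hx.2.le.trans (div_le_self Real.pi_pos.le hk1)⟩
  have h3 := ae_restrict_of_ae_restrict_of_subset hsub h2
  have : (ae (volume.restrict (Ioo 0 (Real.pi / (kstar : ℝ))))).NeBot := by
    rw [ae_neBot, Ne, Measure.restrict_eq_zero, Real.volume_Ioo]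
    simpa using hπ
  obtain ⟨x, hx1, hx2⟩ := (h3.and (ae_restrict_mem measurableSet_Ioo)).exists
  rw [profile_apply, sinWave_apply] at hx1
  have hsin : 0 < Real.sin (kstar * x) := Real.sin_pos_of_pos_of_lt_pi (mul_pos hk0 hx2.1)
    (by rw [mul_comm]; exact (lt_div_iff₀ hk0).1 hx2.2)
  exact (smul_ne_zero hsin.ne' hφ) hx1.symm

/-- The constant is `9/4 - 3/2 = 3/4`, the weight of `sin` in `sin³`; the factor `k*²` comes from
the two `x`-derivatives. -/
theorem cubicOp_self_apply (hk : 1 ≤ kstar) (hop : R.op kstar (H1.fn φstar) = φstar) :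
    (R.cubicOp Γ (Ell1.single kstar (H1.fn φstar)) (Ell1.single kstar (H1.fn φstar))
      (Ell1.single kstar (H1.fn φstar))) kstar =
      (3 / 4 * (kstar : ℝ) ^ 2) • mulL Γ (mulH φstar (mulH φstar (H1.fn φstar))) := by
  rw [cubicOp_single, cubicCoeff, add_apply, add_apply, add_apply, postcomp₃_apply,
    postcomp₃_apply]
  change (sineTriple _ _ _ _) kstar + (cosineTriple _ _ _ _) kstar = _
  rw [sineTriple_self_apply hk, cosineTriple_self_apply hk]
  simp only [triple_apply, smul_apply, ContinuousLinearMap.comp_apply, hop, map_smul]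
  module

/-- The abstract branch at `τ = ε²`, multiplied by `ε`, is the coefficient sequence of the wave. The
continuous factor `y` stays near `e`, whose wave is nonzero, so the wave is nontrivial for `ε ≠ 0`.
-/
theorem exists_isBifurcatingBranch (hk : 1 ≤ kstar) (hφ : φstar ≠ 0)
    (hR : ∀ k, 1 ≤ k → k ≠ kstar → ∀ f ψ,
      schrodingerForm V0 V1 k lamstar (R.op k f) ψ = inner ℝ f (H1.fn ψ))
    (hR' : ∀ f ψ, schrodingerForm V0 V1 kstar lamstar (R.op kstar f) ψ =
      inner ℝ (f - lineProj (H1.fn φstar) f) (H1.fn ψ))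
    (hop : R.op kstar (H1.fn φstar) = φstar)
    (htrans : ∫ y, V0 y * H1.fn φstar y ^ 2 ≠ 0) {I : Set ℝ} (hI : I ∈ 𝓝 lamstar) (Γ : LInf) :
    ∃ ε₀ > 0, ∃ (Φ : ℝ → WaveSpace) (lam : ℝ → ℝ),
      IsBifurcatingBranch V0 V1 Γ kstar lamstar I φstar ε₀ Φ lam := by
  have hk0 : (kstar : ℝ) ≠ 0 := by exact_mod_cast (by omega : kstar ≠ 0)
  have hfn : H1.fn φstar ≠ 0 := fun h => hφ (H1.fn_injective (by rw [h, map_zero]))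
  set e : Ell1 L2 := Ell1.single kstar (H1.fn φstar) with he
  set ℓ : Ell1 L2 →L[ℝ] ℝ := (innerSL ℝ (H1.fn φstar)).comp (Ell1.eval kstar) with hℓ
  have hℓa : ∀ z, ℓ z = inner ℝ (H1.fn φstar) (z kstar) := fun z => rfl
  have hKe : compAt kstar (lineProj (H1.fn φstar)) e = e := by
    rw [he, compAt_single_self, lineProj_self hfn]
  have hK : ∀ z, ℓ z = 0 → compAt kstar (lineProj (H1.fn φstar)) z = 0 := fun z hz => by
    rw [hℓa] at hz
    rw [compAt_apply, lineProj_apply, hz, mul_zero, zero_smul, map_zero]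
  have hV : ℓ (R.potential V0 e) = (kstar : ℝ) ^ 2 * ∫ y, V0 y * H1.fn φstar y ^ 2 := by
    rw [hℓa, he, potential_single, Ell1.single_apply_self, hop, map_smul, inner_smul_right,
      inner_mulL_self]
  have hM : ℓ (R.cubicOp Γ e e e) =
      3 / 4 * (kstar : ℝ) ^ 2 * ∫ y, Γ y * H1.fn φstar y ^ 4 := by
    rw [hℓa, he, cubicOp_self_apply hk hop, inner_smul_right, inner_mulL_mulH]
  have hd : ℓ (R.potential V0 e) ≠ 0 := by
    rw [hV]
    exact mul_ne_zero (pow_ne_zero 2 hk0) htrans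
  obtain ⟨y, σ, hy0, hσ0, hev, hder⟩ := exists_branch (R.cubicOp Γ) hKe hK hd
  have hwe : R.wave e ≠ 0 := wave_single_ne_zero hk hφ hop
  obtain ⟨hyc, hσc, -⟩ := hev.self_of_nhds
  have hev1 : ∀ᶠ τ in 𝓝 (0 : ℝ), lamstar + σ τ ∈ I := by
    have : ContinuousAt (fun τ => lamstar + σ τ) 0 := continuousAt_const.add hσc.continuousAt
    exact this.eventually_mem (by simpa [hσ0] using hI)
  have hev2 : ∀ᶠ τ in 𝓝 (0 : ℝ), R.wave (y τ) ≠ 0 := by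
    have : ContinuousAt (fun τ => R.wave (y τ)) 0 :=
      R.wave.continuous.continuousAt.comp hyc.continuousAt
    exact this.eventually_ne (by rwa [hy0])
  have hsq : Filter.Tendsto (fun ε : ℝ => ε ^ 2) (𝓝 0) (𝓝 0) := by
    simpa using (continuous_pow 2).tendsto (0 : ℝ)
  obtain ⟨ε₀, hε₀, hall⟩ := Metric.eventually_nhds_iff_ball.1
    (hsq.eventually (hev.and (hev1.and hev2)))
  rw [Real.ball_eq_Ioo, zero_sub, zero_add] at hall
  have hyε : ∀ {ε : ℝ}, ContDiffAt ℝ ∞ y (ε ^ 2) →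
      ContDiffAt ℝ ∞ (fun ε => ε • y (ε ^ 2)) ε := fun {ε} h =>
    contDiffAt_id.smul (ContDiffAt.comp (g := y) (f := fun ε : ℝ => ε ^ 2) ε h
      (contDiffAt_id.pow 2))
  have hder0 : HasDerivAt (fun ε => R.wave (ε • y (ε ^ 2))) (R.wave e) 0 := by
    have h1 : DifferentiableAt ℝ (fun ε : ℝ => y (ε ^ 2)) 0 :=
      DifferentiableAt.comp (g := y) (f := fun ε : ℝ => ε ^ 2) (0 : ℝ)
        (by simpa using hyc.differentiableAt (by simp)) (differentiableAt_pow 2)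
    have h2 := R.wave.hasFDerivAt.comp_hasDerivAt (0 : ℝ)
      ((hasDerivAt_id (0 : ℝ)).smul h1.hasDerivAt)
    convert! h2 using 1
    simp [hy0]
  have hσ2 : ContDiffAt ℝ 2 σ 0 := contDiffAt_infty.1 hσc 2
  refine ⟨ε₀, hε₀, fun ε => R.wave (ε • y (ε ^ 2)), fun ε => lamstar + σ (ε ^ 2), ?_⟩
  refine
    { smooth_wave := fun ε hε =>
        (R.wave.contDiff.contDiffAt.comp ε (hyε (hall ε hε).1.1)).contDiffWithinAt
      smooth_param := fun ε hε =>
        (contDiffAt_const.add (ContDiffAt.comp (g := σ) (f := fun ε : ℝ => ε ^ 2) ε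
          (hall ε hε).1.2.1 (contDiffAt_id.pow 2))).contDiffWithinAt
      mem := fun ε hε => (hall ε hε).2.1
      solution := fun ε hε => ?_
      nontrivial := fun ε hε h0 => ?_
      sine := fun ε hε => ⟨fun k => R.op k ((ε • y (ε ^ 2)) k), ?_⟩
      wave_zero := by rw [zero_smul, map_zero]
      wave_deriv := ?_
      param_zero := by simp [hσ0]
      param_deriv := deriv_even_zero hσ2 lamstar
      param_deriv_two := ?_ }
  -- With `z = εy` the cubic term carries `ε³ = ε·ε²`, so the equation for `z` is `ε` times the
  -- equation for `y` at `τ = ε²`.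
  · refine isWeakSolution_wave (P := lineProj (H1.fn φstar)) hR hR' ?_
    rw [map_smul, ← smul_sub, (hall ε hε).1.2.2]
    simp only [map_smul, smul_apply]
    module
  · rw [map_smul]
    exact smul_ne_zero h0 (hall ε hε).2.2
  · filter_upwards [R.fn_wave (ε • y (ε ^ 2))] with x hx
    rw [hx]
    exact R.hasSum_profileSum _ x
  · rw [hder0.deriv]
    filter_upwards [R.fn_wave e] with x hx
    rw [hx, he, profileSum_single, hop, profile_apply, sinWave_apply]
  · rw [iteratedDeriv_two_even_zero hσ2]
    rw [hV, hM] at hder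
    field_simp
    -- The factor `k*²` is common to both terms and cancels. The factor 2 from `λ''(0) = 2σ'(0)`
    -- turns 3/4 into 3/2.
    have h4 : (kstar : ℝ) ^ 2 * (deriv σ 0 * (∫ y, V0 y * H1.fn φstar y ^ 2) +
        3 / 4 * ∫ y, Γ y * H1.fn φstar y ^ 4) = 0 := by linarith
    have h5 := (mul_eq_zero.1 h4).resolve_left (pow_ne_zero 2 hk0)
    linarith

end SmoothingFamily

theorem Resonant.exists_isBifurcatingBranch {b β α lamstar : ℝ} {kstar : ℕ}
    (h : Resonant b β α lamstar kstar) {I : Set ℝ}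
    (hI : BifurcationHypotheses (stepOutside b) (stepDelta b β α) kstar lamstar I) (Γ : LInf)
    {φstar : H1} (hφ : φstar ≠ 0)
    (hker : InKernel (stepOutside b) (stepDelta b β α) kstar lamstar φstar) :
    ∃ ε₀ > 0, ∃ (Φ : ℝ → WaveSpace) (lam : ℝ → ℝ),
      IsBifurcatingBranch (stepOutside b) (stepDelta b β α) Γ kstar lamstar I φstar ε₀ Φ lam := by
  obtain ⟨R, C, hC, h0, hR, hR', hop, h2, h1⟩ := h.exists_inverses hφ hker
  refine SmoothingFamily.exists_isBifurcatingBranch (R := ⟨R, C, hC, h0, h1, h2⟩) h.one_le hφ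
    (fun k hk hne f ψ => ?_) (fun f ψ => ?_) hop (hI.transversal φstar hφ hker)
    (hI.isOpen.mem_nhds hI.mem) Γ
  · rw [schrodingerForm_eq_stepForm]
    exact hR k hk hne f ψ
  · rw [schrodingerForm_eq_stepForm]
    exact hR' f ψ

end TravelingWave

end

/-! ### The main theorem -/

theorem corollary2p6 (Γ : TravelingWave.LInf) (kstar : ℕ) (hk : 1 ≤ kstar) (b β lamstar α : ℝ)
    (hb : 0 < b) (hβ : β < 1) (hlam : lamstar < 1)
    (hα : α = 2 * √(1 - β) / kstar *
      ((√(1 - β) * Real.sinh (kstar * √(1 - β) * b)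
          + √(1 - lamstar) * Real.cosh (kstar * √(1 - β) * b)) /
        (√(1 - β) * Real.cosh (kstar * √(1 - β) * b)
          + √(1 - lamstar) * Real.sinh (kstar * √(1 - β) * b)))) :
    ∃ I : Set ℝ,
      TravelingWave.BifurcationHypotheses (TravelingWave.stepOutside b)
        (TravelingWave.stepDelta b β α) kstar lamstar I ∧
      ∀ φstar : TravelingWave.H1, φstar ≠ 0 →
        TravelingWave.InKernel (TravelingWave.stepOutside b) (TravelingWave.stepDelta b β α)
          kstar lamstar φstar →
        ∃ ε₀ > 0, ∃ (Φ : ℝ → TravelingWave.WaveSpace) (lam : ℝ → ℝ),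
          TravelingWave.IsBifurcatingBranch (TravelingWave.stepOutside b)
            (TravelingWave.stepDelta b β α) Γ kstar lamstar I φstar ε₀ Φ lam := by
  have h : TravelingWave.Resonant b β α lamstar kstar := by
    refine ⟨hb, hβ, hlam, hk, ?_⟩
    -- The prescribed strength is `α = 2√(1-β)/D_{k*}(λ*)`, exactly what makes `κG(0) = 1` at the
    -- critical pair.
    rw [hα, TravelingWave.dispersion, ← div_div, div_eq_mul_inv (_ / _) (_ / _), inv_div]
  obtain ⟨I, hI⟩ := h.exists_bifurcationHypotheses
  exact ⟨I, hI, fun φstar hφ hker => h.exists_isBifurcatingBranch hI Γ hφ hker⟩
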